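/- Fix $0<t<1$, $\gamma\ge 1$ and $a>a_0:=\dfrac{1-t^2}{t\,((\gamma+1)t+2\sqrt\gamma)}$. With principal logarithms let $$W(z)=-\gamma a\log(1+tz)-a\log(1+t/z)+\log z,\qquad W'(z)=-\frac{\gamma a}{z+t^{-1}}-\frac{a}{z+t}+\frac{a+1}{z}.$$ Let $\xi\in\mathbb C$ with $\operatorname{Im}\xi>0$, let $\Gamma_1,\Gamma_2$ be disjoint open arcs and let $h$ be a function such that: * $\Gamma_1$ is a simple regular $C^1$ arc from $\overline\xi$ to $\xi$ (end points excluded), symmetric about $\mathbb R$, which does not meet $(-\infty,0]$; $\Gamma_2$ is a simple regular $C^1$ arc from $\xi$ to $\overline\xi$ (end points excluded), symmetric about $\mathbb R$, which does not meet $(-\infty,-1/t]\cup[-t,\infty)$; * $h$ is analytic in $\mathbb C\setminus\overline{\Gamma_1}$ and continuous up to the boundary (including the end points), with boundary values $h_+$ from the left and $h_-$ from the right of the oriented arc $\Gamma_1$; * (a) $h_++h_-=W'$ on $\Gamma_1$; (b) $h(z)=\frac1z+O(z^{-2})$ as $z\to\infty$; (c) $i(h_+-h_-)\,dz>0$ on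 $\Gamma_1$; (d) $(2h-W')\,dz<0$ on $\Gamma_2\cap\mathbb C_+$ and $(2h-W')\,dz>0$ on $\Gamma_2\cap\mathbb C_-$. Then $\Gamma_1$ meets $\mathbb R$ in exactly one point $p_i$, and $p_i>0$. Let $D=\mathbb C\setminus(\overline{\Gamma_1}\cup(-\infty,p_i])$ and let $\ln$ be the principal logarithm. The following hold. 1. The function $$g(z)=\int_\infty^z\Bigl(h(s)-\frac1s\Bigr)ds+\ln z,\qquad z\in D,$$ with the integral along any curve from $\infty$ to $z$ in $D$, is well defined (such curves exist, and the integral converges and does not depend on the curve) and analytic in $D$, and $e^{g}$ extends to an analytic function in $\mathbb C\setminus\overline{\Gamma_1}$, again denoted $e^g$. 2. $e^{g(z)}=z\,(1+O(1/z))$ as $z\to\infty$. 3. The boundary value $g(\xi)$ exists; put $\ell=2g(\xi)-W(\xi)$. The boundary values $g_\pm$ exist on $\Gamma_1\setminus\{p_i\}$, those of $e^{g}$ exist and are non-zero on all of $\Gamma_1$ (at $p_i$, $g_\pm$ stands for any logarithm of them), and $e^{g_+(z)+g_-(z)-W(z)-\ell}=1$ for $z\in\Gamma_1$. There is a function $R(z)=\sqrt{(z-\xi)(z-\overline\xi)}$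 which is analytic in $\mathbb C\setminus\overline{\Gamma_1}$ with $R(z)\sim z$ as $z\to\infty$. For any such $R$ put $$\Phi(z)=(1+\gamma a)\frac{R(z)(z+z_0)}{z(z+t)(z+t^{-1})},\qquad z_0=\frac{a+1}{-R(0)(1+\gamma a)}.$$ 4. For $z\in\mathbb C\setminus\bigl(\overline{\Gamma_1}\cup(-\infty,0]\bigr)$ the value $e^{\Psi_1(z)}=\exp\bigl\{\int_\xi^z\Phi(s)\,ds\bigr\}$, with the integral along any curve from $\xi$ to $z$ which, apart from its starting point, does not meet $\overline{\Gamma_1}\cup(-\infty,0]$, is well defined (such curves exist, and the value does not depend on the curve); its boundary value from the left of $\Gamma_1$ exists, and $e^{g_+(z)-g_-(z)}=e^{\Psi_{1+}(z)}$ for $z\in\Gamma_1$. 5. $e^{2g(z)-W(z)-\ell}=e^{\Psi_2(z)}$ for $z\in\Gamma_2$, where $\Psi_2(z)=\int_\xi^z\Phi(s)\,ds$ along $\Gamma_2$. -/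

import Mathlib

open Complex ComplexConjugate Filter Topology Set MeasureTheory Asymptotics Bornology

namespace GFun

noncomputable section

/-- The critical value `a₀`. -/
def a0 (t γ : ℝ) : ℝ := (1 - t ^ 2) / (t * ((γ + 1) * t + 2 * √γ))

/-- `W(z) = -γ a log(1 + t z) - a log(1 + t / z) + log z`, with principal logarithms. -/
def W (t γ a : ℝ) (z : ℂ) : ℂ :=
  -((γ : ℂ) * a * log (1 + t * z)) - a * log (1 + t / z) + log z

/-- The rational function `W'(z)`. -/
def W' (t γ a : ℝ) (z : ℂ) : ℂ :=
  -((γ : ℂ) * a / (z + (t : ℂ)⁻¹)) - a / (z + t) + (a + 1) / z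

/-- `W'` is indeed the derivative of `W` off the negative real axis. -/
theorem hasDerivAt_W {t γ a : ℝ} (ht : 0 < t) {z : ℂ} (hz : z ∈ slitPlane) :
    HasDerivAt (W t γ a) (W' t γ a z) z := by
  have hz0 : z ≠ 0 := slitPlane_ne_zero hz
  have htc : (t : ℂ) ≠ 0 := by exact_mod_cast ht.ne'
  have h1 : (1 + t * z : ℂ) ∈ slitPlane := by
    rw [mem_slitPlane_iff] at hz ⊢
    rcases hz with h | h
    · left; simp; positivity
    · right; simp [ht.ne', h]
  have h2 : (1 + t / z : ℂ) ∈ slitPlane := by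
    have hn : 0 < normSq z := normSq_pos.2 hz0
    rw [mem_slitPlane_iff] at hz ⊢
    rcases hz with h | h
    · left; simp [Complex.div_re]; positivity
    · right; simp [Complex.div_im, ht.ne', h, hn.ne']
  have n1 := slitPlane_ne_zero h1
  have n2 := slitPlane_ne_zero h2
  have n3 : z + (t : ℂ)⁻¹ ≠ 0 := by
    intro h; apply n1; field_simp at h; linear_combination h
  have n4 : z + (t : ℂ) ≠ 0 := by
    intro h; apply n2; field_simp; simpa using h
  have d1 : HasDerivAt (fun z : ℂ => 1 + t * z) (t : ℂ) z := by
    simpa using ((hasDerivAt_id z).const_mul (t : ℂ)).const_add 1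
  have d2 : HasDerivAt (fun z : ℂ => 1 + t / z) (-(t : ℂ) / z ^ 2) z := by
    have := ((hasDerivAt_inv hz0).const_mul (t : ℂ)).const_add 1
    exact this.congr_deriv (by ring)
  have := (((d1.clog h1).const_mul ((γ : ℂ) * a)).neg.sub
    ((d2.clog h2).const_mul (a : ℂ))).add (hasDerivAt_log hz)
  refine this.congr_deriv ?_
  have e1 : (t : ℂ) / (1 + t * z) = 1 / (z + (t : ℂ)⁻¹) := by
    rw [div_eq_div_iff n1 n3, mul_add, mul_inv_cancel₀ htc]; ring
  have e2 : -(t : ℂ) / z ^ 2 / (1 + t / z) = 1 / (z + t) - 1 / z := by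
    have : (1 + t / z : ℂ) = (z + t) / z := by field_simp
    rw [this]; field_simp; ring
  rw [e1, e2]
  unfold W'
  ring

/-! ### Curves -/

/-- A smooth simple arc from `A` to `B`: an injective regular `C¹` parametrization on `[0, 1]`.
A `C¹` map on a closed interval is the restriction of a `C¹` map on `ℝ`, and only the restriction
to `[0, 1]` is ever used. -/
structure IsSimpleArc (c : ℝ → ℂ) (A B : ℂ) : Prop where
  contDiff : ContDiff ℝ 1 c
  regular : ∀ u ∈ Icc (0 : ℝ) 1, deriv c u ≠ 0
  inj : InjOn c (Icc 0 1)
  source : c 0 = A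
  target : c 1 = B

/-- The open curve, without its end points. -/
def openArc (c : ℝ → ℂ) : Set ℂ := c '' Ioo 0 1

/-- The closed curve, with its end points. -/
def closedArc (c : ℝ → ℂ) : Set ℂ := c '' Icc 0 1

/-- The ray `(-∞, x]`, as a subset of `ℂ`. -/
def leftRay (x : ℝ) : Set ℂ := (fun r : ℝ => (r : ℂ)) '' Iic x

/-- The neighbourhoods of `c u` on the `+` side, that is on the left of the oriented curve `c`:
the points near `c u` on the left of the curve are those of the form `c v + ε i c'(v)` with `v`
near `u` and `ε > 0` small. -/
def plusSide (c : ℝ → ℂ) (u : ℝ) : Filter ℂ :=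
  Filter.map (fun q : ℝ × ℝ => c q.1 + q.2 * I * deriv c q.1) (𝓝 u ×ˢ 𝓝[>] (0 : ℝ))

/-- The neighbourhoods of `c u` on the `-` side, that is on the right of the oriented curve `c`. -/
def minusSide (c : ℝ → ℂ) (u : ℝ) : Filter ℂ :=
  Filter.map (fun q : ℝ × ℝ => c q.1 + q.2 * I * deriv c q.1) (𝓝 u ×ˢ 𝓝[<] (0 : ℝ))

/-- The contour integral `∫ f(z) dz` over the part of the curve `c` with parameter from `α` to
`β`. -/
def contourIntegral (f : ℂ → ℂ) (c : ℝ → ℂ) (α β : ℝ) : ℂ := ∫ u in α..β, f (c u) * deriv c u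

/-- The integrand of the contour integral is integrable. -/
def ContourIntegrable (f : ℂ → ℂ) (c : ℝ → ℂ) (α β : ℝ) : Prop :=
  IntervalIntegrable (fun u => f (c u) * deriv c u) volume α β

/-- `c`, run backwards from parameter `+∞` to parameter `0`, is a curve in `D` from `∞` to `z`.
Speed zero is allowed, so that corners are allowed too. -/
structure IsCurveFromInfty (D : Set ℂ) (c : ℝ → ℂ) (z : ℂ) : Prop where
  contDiff : ContDiff ℝ 1 c
  target : c 0 = z
  mem : ∀ u, 0 ≤ u → c u ∈ D
  infty : Tendsto c atTop (cobounded ℂ)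

/-- `c` is a curve from `A` to `z` which runs inside `D` except for its starting point.
Speed zero is allowed, so that corners are allowed too. -/
structure IsCurveFrom (D : Set ℂ) (A : ℂ) (c : ℝ → ℂ) (z : ℂ) : Prop where
  contDiff : ContDiff ℝ 1 c
  source : c 0 = A
  target : c 1 = z
  mem : ∀ u ∈ Ioc (0 : ℝ) 1, c u ∈ D

/-! ### The contours, the `h`-function, and `Φ` -/

/-- `w` is a positive real number. -/
def IsPos (w : ℂ) : Prop := 0 < w.re ∧ w.im = 0

/-- `w` is a negative real number. -/
def IsNeg (w : ℂ) : Prop := w.re < 0 ∧ w.im = 0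

/-- The point `ξ`, the contours `Γ₁ = openArc c₁` and `Γ₂ = openArc c₂`, and the function `h`
with its boundary values `h₊(c₁ u) = hp u` and `h₋(c₁ u) = hm u` on `Γ₁`. -/
structure IsContourData (t γ a : ℝ) (ξ : ℂ) (c₁ c₂ : ℝ → ℂ) (h : ℂ → ℂ) (hp hm : ℝ → ℂ) :
    Prop where
  im_pos : 0 < ξ.im
  /-- `Γ₁` goes from `conj ξ` to `ξ`. -/
  arc₁ : IsSimpleArc c₁ (conj ξ) ξ
  avoid₁ : Disjoint (openArc c₁) (leftRay 0)
  symm₁ : (fun z : ℂ => conj z) '' openArc c₁ = openArc c₁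
  /-- `Γ₂` goes from `ξ` to `conj ξ`. -/
  arc₂ : IsSimpleArc c₂ ξ (conj ξ)
  avoid₂ : ∀ x : ℝ, (x ≤ -t⁻¹ ∨ -t ≤ x) → (x : ℂ) ∉ openArc c₂
  symm₂ : (fun z : ℂ => conj z) '' openArc c₂ = openArc c₂
  disj : Disjoint (openArc c₁) (openArc c₂)
  /-- `h` is analytic off the closed curve `Γ₁`, and continuous up to the boundary. -/
  analytic : AnalyticOnNhd ℂ h (closedArc c₁)ᶜ
  bdry_plus : ∀ u ∈ Ioo (0 : ℝ) 1, Tendsto h (plusSide c₁ u) (𝓝 (hp u))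
  bdry_minus : ∀ u ∈ Ioo (0 : ℝ) 1, Tendsto h (minusSide c₁ u) (𝓝 (hm u))
  bdry_ξ : ∃ w, Tendsto h (𝓝[(closedArc c₁)ᶜ] ξ) (𝓝 w)
  bdry_conj : ∃ w, Tendsto h (𝓝[(closedArc c₁)ᶜ] (conj ξ)) (𝓝 w)
  /-- `h₊ + h₋ = W'` on `Γ₁`. -/
  sum : ∀ u ∈ Ioo (0 : ℝ) 1, hp u + hm u = W' t γ a (c₁ u)
  /-- `h(z) = 1/z + O(z⁻²)` as `z → ∞`. -/
  infty : (fun z => h z - 1 / z) =O[cobounded ℂ] (fun z => 1 / z ^ 2)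
  /-- `i (h₊ - h₋) dz > 0` on `Γ₁`. -/
  pos₁ : ∀ u ∈ Ioo (0 : ℝ) 1, IsPos (I * (hp u - hm u) * deriv c₁ u)
  /-- `(2h - W') dz < 0` on `Γ₂ ∩ ℂ₊`. -/
  neg₂ : ∀ u ∈ Ioo (0 : ℝ) 1, 0 < (c₂ u).im →
    IsNeg ((2 * h (c₂ u) - W' t γ a (c₂ u)) * deriv c₂ u)
  /-- `(2h - W') dz > 0` on `Γ₂ ∩ ℂ₋`. -/
  pos₂ : ∀ u ∈ Ioo (0 : ℝ) 1, (c₂ u).im < 0 →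
    IsPos ((2 * h (c₂ u) - W' t γ a (c₂ u)) * deriv c₂ u)

/-- `R` is the branch of `√((z - ξ)(z - conj ξ))` that is analytic off `K`, with `R(z) ~ z` as
`z → ∞`. -/
structure IsSqrtBranch (ξ : ℂ) (K : Set ℂ) (R : ℂ → ℂ) : Prop where
  analytic : AnalyticOnNhd ℂ R Kᶜ
  sq : ∀ z ∈ Kᶜ, R z ^ 2 = (z - ξ) * (z - conj ξ)
  infty : Tendsto (fun z => R z / z) (cobounded ℂ) (𝓝 1)

/-- `z₀ = (a + 1) / (-R(0) (1 + γ a))`. -/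
def z0 (γ a : ℝ) (R : ℂ → ℂ) : ℂ := (a + 1) / (-R 0 * (1 + γ * a))

/-- `Φ(z) = (1 + γ a) R(z) (z + z₀) / (z (z + t) (z + 1/t))`. -/
def Φ (t γ a : ℝ) (R : ℂ → ℂ) (z : ℂ) : ℂ :=
  (1 + γ * a) * (R z * (z + z0 γ a R) / (z * (z + t) * (z + (t : ℂ)⁻¹)))

end

end GFun

/-! The conditions on `h` determine it algebraically. Let `R` be the root. Across `Γ₁` both `2h -
W'` and `R` change sign, so the product `(2h - W') R`, multiplied by `z (z + t) (z + 1/t)`, has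
equal boundary values and extends to an entire function: regular `C¹` arcs are removable for
continuous functions (`analyticAt_of_analytic_off_curve`). The extension vanishes at `ξ` and `conj
ξ` and grows like `(1 + γ a) z³`, so Liouville leaves one constant, which regularity of `h` at `0`
fixes. The result is `2h = W' + Φ` (`IsContourData.two_mul_h_mul_den`).

Instead of integrating `h`, the proof writes `exp g` explicitly. The Joukowski coordinate `w = z -
Re ξ + R(z)` satisfies `dw/dz = w / R`, and it never vanishes, since changing the sign of `R` gives
a second coordinate with product `-(Im ξ)²`. Put `ν_p = p - Re ξ - R(p) > 0`, the coordinate of `p`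
for the other sign. Then `exp g = (w/2) (1 - ν_0/w)^(a+1) (1 - ν_{-t}/w)^(-a) (1 -
ν_{-1/t}/w)^(-γa)`. Each `1 - ν/w` avoids the negative axis, on the arc too
(`one_sub_div_mem_slitPlane`), so principal logarithms make the formula analytic off `Γ₁`, and its
boundary values come from inserting `±r`, the boundary values of `R`. Regularity of `h` at the three
poles of `W'`, together with Lagrange interpolation, shows that the logarithmic derivative is `h`
(`dlogG_mul`, `IsSetup.dlogG_outer`); the behaviour at infinity fixes the constant. This gives (1)
and (2).

For (3), the product of the two boundary values of `exp g` with `exp (-W)` has zero derivative along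
`Γ₁`, and its limit at `ξ` is `exp ℓ` (`IsSetup.expG_mul_expG`). For (4) and (5), `exp (2g - W - ℓ)`
solves `y' = Φ y` with limit `1` at `ξ`, hence is the exponential of the integral of `Φ`
(`IsSetup.exp_contourIntegral`). Then (4) follows with (3), and (5) holds because `exp (-W)` is
analytic across `(-1/t, -t)`, the only place where `Γ₂` can meet the real axis.

The single crossing point comes from reflection, which reverses the parameter of `Γ₁`. The domains
are connected because a simple arc ending inside a half plane does not separate it. -/

namespace GFun

/-! ### Local geometry of a regular curve -/

/-- The normal coordinates along the curve `c`. -/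
noncomputable def normalMap (c : ℝ → ℂ) (q : ℝ × ℝ) : ℂ := c q.1 + q.2 * I * deriv c q.1

theorem continuous_normalMap {c : ℝ → ℂ} (hc : ContDiff ℝ 1 c) : Continuous (normalMap c) := by
  have h1 : Continuous (deriv c) := hc.continuous_deriv le_rfl
  have h2 := hc.continuous
  unfold normalMap
  fun_prop

theorem normalMap_zero (c : ℝ → ℂ) (u : ℝ) : normalMap c (u, 0) = c u := by simp [normalMap]

/-- Strict differentiability of a `C¹` map: both ends of the chord vary, which the derivative at `u`
alone would not allow. -/
theorem eventually_norm_sub_le {c : ℝ → ℂ} (hc : ContDiff ℝ 1 c) (u : ℝ) {η : ℝ} (hη : 0 < η) :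
    ∀ᶠ p : ℝ × ℝ in 𝓝 (u, u), ‖c p.1 - c p.2 - (p.1 - p.2 : ℝ) * deriv c u‖ ≤ η * |p.1 - p.2| := by
  have h := (hc.contDiffAt (x := u)).hasStrictDerivAt (by simp)
  have h2 := (hasStrictDerivAt_iff_hasStrictFDerivAt.1 h).isLittleO.def hη
  filter_upwards [h2] with p hp
  simpa using hp

/-- Near a regular point of the curve, the normal coordinates reach all points. -/
theorem nhds_le_map_normalMap {c : ℝ → ℂ} (hc : ContDiff ℝ 1 c) {u : ℝ} (hu : deriv c u ≠ 0) :
    𝓝 (c u) ≤ Filter.map (normalMap c) (𝓝 (u, (0 : ℝ))) := by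
  set k := ‖deriv c u‖ with hk
  have kpos : 0 < k := norm_pos_iff.2 hu
  intro s hs
  rw [mem_map, Metric.mem_nhds_iff] at hs
  obtain ⟨δ, δpos, hδ⟩ := hs
  obtain ⟨δ₁, δ₁pos, hδ₁⟩ := Metric.eventually_nhds_iff.1
    (eventually_norm_sub_le hc u (half_pos kpos))
  have hcont : ContinuousAt (deriv c) u := (hc.continuous_deriv le_rfl).continuousAt
  obtain ⟨δ₂, δ₂pos, hδ₂⟩ := Metric.eventually_nhds_iff.1
    (hcont.norm.eventually (lt_mem_nhds (half_lt_self kpos)))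
  set d := min δ (min δ₁ δ₂) / 2 with hd
  have dpos : 0 < d := by positivity
  have d0 : d < δ := by have := min_le_left δ (min δ₁ δ₂); linarith
  have d1 : d < δ₁ := by
    have := (min_le_right δ (min δ₁ δ₂)).trans (min_le_left _ _); linarith
  have d2 : d < δ₂ := by
    have := (min_le_right δ (min δ₁ δ₂)).trans (min_le_right _ _); linarith
  rw [Metric.mem_nhds_iff]
  -- With this radius the minimiser below stays off the ends of the interval: at an end `‖c v - c
  -- u‖` would be at least `k * d / 2`, yet it is at most `2 * ‖z - c u‖`.
  refine ⟨k * d / 4, by positivity, fun z hz => ?_⟩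
  -- `normalMap c` is only continuous, so the inverse function theorem does not apply to it. A
  -- nearest point `c v` of the curve serves instead: there `z - c v` is orthogonal to `deriv c v`.
  obtain ⟨v, hv, hmin⟩ := (isCompact_Icc (a := u - d) (b := u + d)).exists_isMinOn
    ⟨u, by constructor <;> linarith⟩ (f := fun v => ‖z - c v‖ ^ 2)
    (by have := hc.continuous; fun_prop)
  have hzu : ‖z - c u‖ < k * d / 4 := by simpa [dist_eq_norm] using hz
  have hzv : ‖z - c v‖ ≤ ‖z - c u‖ := by
    have := hmin (show u ∈ Icc (u - d) (u + d) by constructor <;> linarith)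
    exact (sq_le_sq₀ (norm_nonneg _) (norm_nonneg _)).1 this
  have hvu : |v - u| ≤ d := abs_le.2 ⟨by linarith [hv.1], by linarith [hv.2]⟩
  have hcv : k / 2 * |v - u| ≤ ‖c v - c u‖ := by
    have h1 := hδ₁ (y := (v, u)) (by
      simp only [Prod.dist_eq, dist_self, Real.dist_eq]
      exact max_lt (by linarith) δ₁pos)
    simp only at h1
    have h2 := norm_sub_norm_le (((v - u : ℝ) : ℂ) * deriv c u) (c v - c u)
    rw [norm_sub_rev (((v - u : ℝ) : ℂ) * deriv c u), norm_mul, norm_real, Real.norm_eq_abs, ← hk] at h2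
    linarith
  have hcv2 : ‖c v - c u‖ ≤ ‖z - c u‖ + ‖z - c v‖ := by
    have : c v - c u = (z - c u) - (z - c v) := by ring
    rw [this]; exact norm_sub_le _ _
  have hvu' : |v - u| < d := by
    by_contra! h
    have : k / 2 * d ≤ k / 2 * |v - u| := by gcongr
    linarith
  have hvI : v ∈ Ioo (u - d) (u + d) := by
    obtain ⟨h1, h2⟩ := abs_lt.1 hvu'
    constructor <;> linarith
  have hloc : IsLocalMin (fun v => ‖z - c v‖ ^ 2) v :=
    hmin.isLocalMin (Icc_mem_nhds hvI.1 hvI.2)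
  have hder : HasDerivAt c (deriv c v) v := (hc.differentiable (by simp) v).hasDerivAt
  have hder2 : HasDerivAt (fun v => ‖z - c v‖ ^ 2) (2 * inner ℝ (z - c v) (-deriv c v)) v := by
    simpa using (hder.const_sub z).norm_sq
  have horth := hloc.hasDerivAt_eq_zero hder2
  have hk2 : k / 2 < ‖deriv c v‖ := hδ₂ (by rw [Real.dist_eq]; linarith)
  have hne : deriv c v ≠ 0 := by
    rw [← norm_pos_iff]; linarith
  set w := (z - c v) / deriv c v with hw
  have hzw : z - c v = w * deriv c v := by rw [hw]; field_simp
  have hre : w.re = 0 := by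
    have h1 : inner ℝ (z - c v) (-deriv c v) = 0 := by linarith
    rw [Complex.inner, hzw, neg_mul, neg_re, neg_eq_zero] at h1
    have h2 : deriv c v * (starRingEnd ℂ) (w * deriv c v)
        = (normSq (deriv c v) : ℂ) * conj w := by
      rw [map_mul, normSq_eq_conj_mul_self]; ring
    rw [h2, re_ofReal_mul, conj_re] at h1
    exact (mul_eq_zero.1 h1).resolve_left (normSq_pos.2 hne).ne'
  have hwI : w = w.im * I := by
    apply Complex.ext <;> simp [hre]
  have him : |w.im| < δ := by
    have h1 : ‖z - c v‖ = |w.im| * ‖deriv c v‖ := by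
      rw [hzw, norm_mul]; congr 1; rw [hwI]; simp
    have h3 : |w.im| * (k / 2) ≤ |w.im| * ‖deriv c v‖ := by gcongr
    have : |w.im| * (k / 2) < d * (k / 2) := by nlinarith
    have := lt_of_mul_lt_mul_right this (by positivity)
    linarith
  have : (v, w.im) ∈ Metric.ball (u, (0 : ℝ)) δ := by
    rw [Metric.mem_ball, Prod.dist_eq, Real.dist_eq, Real.dist_eq, sub_zero]
    exact max_lt (by linarith) him
  have h5 := hδ this
  have h6 : normalMap c (v, w.im) = z := by
    simp only [normalMap]
    rw [← hwI, ← hzw]; ring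
  rwa [mem_preimage, h6] at h5

/-- The inverse of the parametrization of a simple arc is continuous. -/
theorem IsSimpleArc.eventually_param {c : ℝ → ℂ} {A B : ℂ} (hc : IsSimpleArc c A B) {u : ℝ}
    (hu : u ∈ Icc (0 : ℝ) 1) {s : Set ℝ} (hs : s ∈ 𝓝 u) :
    ∀ᶠ z in 𝓝 (c u), ∀ v ∈ Icc (0 : ℝ) 1, c v = z → v ∈ s := by
  obtain ⟨o, hos, ho, huo⟩ := mem_nhds_iff.1 hs
  -- By injectivity, the compact part of the arc with parameters outside `o` misses `c u`.
  have hcomp : IsCompact (c '' (Icc 0 1 \ o)) :=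
    (isCompact_Icc.diff ho).image hc.contDiff.continuous
  have hmem : (c '' (Icc 0 1 \ o))ᶜ ∈ 𝓝 (c u) := by
    refine hcomp.isClosed.isOpen_compl.mem_nhds ?_
    rintro ⟨v, ⟨hv, hvo⟩, hvu⟩
    exact hvo (hc.inj hv hu hvu ▸ huo)
  filter_upwards [hmem] with z hz v hv hvz
  by_contra hvs
  exact hz ⟨v, ⟨hv, fun h => hvs (hos h)⟩, hvz⟩

/-- Transversal coordinates near a point of a simple arc meet the arc only where the transversal
coordinate vanishes. -/
theorem IsSimpleArc.eventually_notMem {c : ℝ → ℂ} {A B : ℂ} (hc : IsSimpleArc c A B) {u : ℝ}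
    (hu : u ∈ Icc (0 : ℝ) 1) {d : ℝ → ℂ} (hd : ContinuousAt d u) (hdu : d u = deriv c u) :
    ∀ᶠ q : ℝ × ℝ in 𝓝 (u, (0 : ℝ)), c q.1 + q.2 * I * d q.1 ∈ closedArc c →
      q.2 = 0 ∧ q.1 ∈ Icc (0 : ℝ) 1 := by
  set k := ‖deriv c u‖ with hk
  have kpos : 0 < k := norm_pos_iff.2 (hc.regular u hu)
  have h1 := eventually_norm_sub_le hc.contDiff u (η := k / 4) (by positivity)
  rw [nhds_prod_eq] at h1
  obtain ⟨s, hs, hs2⟩ := Filter.mem_prod_self_iff.1 h1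
  have hcc : Tendsto (fun q : ℝ × ℝ => c q.1 + q.2 * I * d q.1) (𝓝 (u, 0)) (𝓝 (c u)) := by
    have e1 : Tendsto (fun q : ℝ × ℝ => q.1) (𝓝 (u, (0 : ℝ))) (𝓝 u) := continuousAt_fst
    have e2 : Tendsto (fun q : ℝ × ℝ => (q.2 : ℂ)) (𝓝 (u, (0 : ℝ))) (𝓝 ((0 : ℝ) : ℂ)) :=
      (continuous_ofReal.comp continuous_snd).continuousAt
    have := (hc.contDiff.continuous.continuousAt.tendsto.comp e1).add
      ((e2.mul_const I).mul (hd.tendsto.comp e1))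
    simpa using this
  have h2 := hcc.eventually (hc.eventually_param hu hs)
  have h3 : ∀ᶠ q : ℝ × ℝ in 𝓝 (u, (0 : ℝ)), q.1 ∈ s := continuousAt_fst hs
  have h4 : ∀ᶠ q : ℝ × ℝ in 𝓝 (u, (0 : ℝ)), ‖d q.1 - deriv c u‖ < k / 4 := by
    have : Tendsto (fun q : ℝ × ℝ => ‖d q.1 - deriv c u‖) (𝓝 (u, (0 : ℝ))) (𝓝 0) := by
      have e1 : Tendsto (fun q : ℝ × ℝ => q.1) (𝓝 (u, (0 : ℝ))) (𝓝 u) := continuousAt_fst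
      simpa [hdu] using ((hd.tendsto.comp e1).sub_const (deriv c u)).norm
    exact this.eventually (gt_mem_nhds (by positivity))
  filter_upwards [h2, h3, h4] with ⟨v, ε⟩ hq2 hq3 hq4 hmem
  obtain ⟨v', hv', hcv'⟩ := hmem
  simp only at hq2 hq3 hq4 hcv' ⊢
  have hv's := hq2 v' hv' hcv'
  have h5 : ‖c v' - c v - (v' - v : ℝ) * deriv c u‖ ≤ k / 4 * |v' - v| :=
    hs2 (show (v', v) ∈ s ×ˢ s from ⟨hv's, hq3⟩)
  have h6 : c v' - c v = ε * I * d v := by rw [hcv']; ring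
  -- A second point of the arc at the same place makes `((v' - v) - ε I) * deriv c u` small compared
  -- with `|v' - v| + |ε|`. The modulus of the first factor bounds both terms, so both vanish.
  have h7 : (((v' - v : ℝ) : ℂ) - ε * I) * deriv c u
      = -(c v' - c v - (v' - v : ℝ) * deriv c u) + ε * I * (d v - deriv c u) := by
    rw [h6]; ring
  have h8 : ‖((v' - v : ℝ) : ℂ) - ε * I‖ * k ≤ k / 4 * |v' - v| + |ε| * (k / 4) := by
    rw [hk, ← norm_mul, h7]
    refine (norm_add_le _ _).trans (add_le_add (by rwa [norm_neg]) ?_)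
    rw [norm_mul, norm_mul, norm_I, norm_real, Real.norm_eq_abs, mul_one]
    gcongr
  have h9 : |v' - v| ≤ ‖((v' - v : ℝ) : ℂ) - ε * I‖ := by
    simpa using abs_re_le_norm (((v' - v : ℝ) : ℂ) - ε * I)
  have h10 : |ε| ≤ ‖((v' - v : ℝ) : ℂ) - ε * I‖ := by
    simpa using abs_im_le_norm (((v' - v : ℝ) : ℂ) - ε * I)
  set n := ‖((v' - v : ℝ) : ℂ) - ε * I‖
  have h11 : n * k ≤ k / 4 * n + n * (k / 4) := by
    refine h8.trans ?_
    gcongr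
  have h12 : n ≤ 0 := by
    by_contra! hn
    nlinarith [mul_pos hn kpos]
  have hε : ε = 0 := abs_eq_zero.1 (le_antisymm (h10.trans h12) (abs_nonneg _))
  have hv0 : v' - v = 0 := abs_eq_zero.1 (le_antisymm (h9.trans h12) (abs_nonneg _))
  refine ⟨hε, ?_⟩
  have : v = v' := by linarith
  rwa [this]

theorem IsSimpleArc.eventually_normalMap_notMem {c : ℝ → ℂ} {A B : ℂ} (hc : IsSimpleArc c A B)
    {u : ℝ} (hu : u ∈ Icc (0 : ℝ) 1) :
    ∀ᶠ q : ℝ × ℝ in 𝓝 (u, (0 : ℝ)), normalMap c q ∈ closedArc c →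
      q.2 = 0 ∧ q.1 ∈ Icc (0 : ℝ) 1 :=
  hc.eventually_notMem hu (hc.contDiff.continuous_deriv le_rfl).continuousAt rfl

theorem plusSide_eq (c : ℝ → ℂ) (u : ℝ) :
    plusSide c u = Filter.map (normalMap c) (𝓝 u ×ˢ 𝓝[>] (0 : ℝ)) := rfl

theorem minusSide_eq (c : ℝ → ℂ) (u : ℝ) :
    minusSide c u = Filter.map (normalMap c) (𝓝 u ×ˢ 𝓝[<] (0 : ℝ)) := rfl

instance (c : ℝ → ℂ) (u : ℝ) : (plusSide c u).NeBot := by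
  rw [plusSide_eq]; infer_instance

instance (c : ℝ → ℂ) (u : ℝ) : (minusSide c u).NeBot := by
  rw [minusSide_eq]; infer_instance

/-- Treats both sides at once: `s` is the positive or the negative half-line, and a non-zero
transversal coordinate keeps the point off the arc. -/
theorem IsSimpleArc.map_normalMap_le {c : ℝ → ℂ} {A B : ℂ} (hc : IsSimpleArc c A B)
    {u : ℝ} (hu : u ∈ Icc (0 : ℝ) 1) {s : Set ℝ} (hs : (0 : ℝ) ∉ s) :
    Filter.map (normalMap c) (𝓝 u ×ˢ 𝓝[s] (0 : ℝ)) ≤ 𝓝[(closedArc c)ᶜ] (c u) := by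
  have hle : 𝓝 u ×ˢ 𝓝[s] (0 : ℝ) ≤ 𝓝 (u, (0 : ℝ)) := by
    rw [nhds_prod_eq]; exact Filter.prod_mono le_rfl nhdsWithin_le_nhds
  refine le_inf ?_ ?_
  · have := (continuous_normalMap hc.contDiff).tendsto (u, 0)
    rw [normalMap_zero] at this
    exact (Filter.map_mono hle).trans this
  · rw [le_principal_iff, mem_map]
    have h1 := (hc.eventually_normalMap_notMem hu).filter_mono hle
    have h2 : ∀ᶠ q : ℝ × ℝ in 𝓝 u ×ˢ 𝓝[s] (0 : ℝ), q.2 ∈ s :=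
      (tendsto_snd (f := 𝓝 u) (g := 𝓝[s] (0 : ℝ))).eventually self_mem_nhdsWithin
    filter_upwards [h1, h2] with q hq hq2 hmem
    exact hs ((hq hmem).1 ▸ hq2)

theorem IsSimpleArc.plusSide_le {c : ℝ → ℂ} {A B : ℂ} (hc : IsSimpleArc c A B)
    {u : ℝ} (hu : u ∈ Icc (0 : ℝ) 1) : plusSide c u ≤ 𝓝[(closedArc c)ᶜ] (c u) :=
  hc.map_normalMap_le hu (s := Ioi 0) (by simp)

theorem IsSimpleArc.minusSide_le {c : ℝ → ℂ} {A B : ℂ} (hc : IsSimpleArc c A B)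
    {u : ℝ} (hu : u ∈ Icc (0 : ℝ) 1) : minusSide c u ≤ 𝓝[(closedArc c)ᶜ] (c u) :=
  hc.map_normalMap_le hu (s := Iio 0) (by simp)

/-- The complement of the arc near an inner point of the arc consists of the two sides. -/
theorem IsSimpleArc.nhdsWithin_le {c : ℝ → ℂ} {A B : ℂ} (hc : IsSimpleArc c A B)
    {u : ℝ} (hu : u ∈ Ioo (0 : ℝ) 1) :
    𝓝[(closedArc c)ᶜ] (c u) ≤ plusSide c u ⊔ minusSide c u := by
  have huI : u ∈ Icc (0 : ℝ) 1 := Ioo_subset_Icc_self hu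
  rw [plusSide_eq, minusSide_eq, ← Filter.map_sup, ← Filter.prod_sup, ← nhdsWithin_union,
    union_comm, Iio_union_Ioi]
  intro s hs
  have h0 : ∀ᶠ q : ℝ × ℝ in 𝓝 (u, (0 : ℝ)), q.2 ≠ 0 → normalMap c q ∈ s := by
    rw [mem_map, show 𝓝 u ×ˢ 𝓝[{(0 : ℝ)}ᶜ] (0 : ℝ)
      = 𝓝[univ ×ˢ {(0 : ℝ)}ᶜ] (u, (0 : ℝ)) by rw [nhdsWithin_prod_eq, nhdsWithin_univ]] at hs
    filter_upwards [eventually_nhdsWithin_iff.1 hs] with q hq hq2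
    exact hq ⟨mem_univ _, hq2⟩
  have h1 : ∀ᶠ q : ℝ × ℝ in 𝓝 (u, (0 : ℝ)), q.1 ∈ Icc (0 : ℝ) 1 :=
    continuousAt_fst (Icc_mem_nhds hu.1 hu.2)
  have h2 : {q : ℂ | q ∉ closedArc c → q ∈ s} ∈ Filter.map (normalMap c) (𝓝 (u, (0 : ℝ))) := by
    rw [mem_map]
    filter_upwards [h0, h1] with ⟨v, ε⟩ hq0 hq1 hq
    refine hq0 fun hε => hq ?_
    simp only at hε
    rw [hε, normalMap_zero]
    exact ⟨v, hq1, rfl⟩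
  filter_upwards [mem_nhdsWithin_of_mem_nhds (nhds_le_map_normalMap hc.contDiff
    (hc.regular u huI) h2), self_mem_nhdsWithin] with z hz hz2
  exact hz hz2

/-- One-sided boundary values of a function depend continuously on the boundary point. -/
theorem continuousOn_of_tendsto_map {f c : ℝ → ℂ} {F : ℂ → ℂ} {U s : Set ℝ}
    [NeBot (𝓝[s] (0 : ℝ))] (hU : IsOpen U)
    (h : ∀ u ∈ U, Tendsto F (Filter.map (normalMap c) (𝓝 u ×ˢ 𝓝[s] (0 : ℝ))) (𝓝 (f u))) :
    ContinuousOn f U := by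
  intro u hu
  refine ContinuousAt.continuousWithinAt ?_
  refine (closed_nhds_basis (f u)).ge_iff.2 fun V hV => ?_
  have h1 := (h u hu).eventually hV.1
  rw [eventually_map] at h1
  obtain ⟨pa, hpa, pb, hpb, hab⟩ := Filter.eventually_prod_iff.1 h1
  rw [mem_map]
  -- The filter at `u` lets the base point move, so it controls the one-sided filters at nearby `v`;
  -- the boundary value there is a limit of points of the closed set `V`.
  filter_upwards [eventually_eventually_nhds.2 hpa, hU.mem_nhds hu] with v hv hvU
  refine hV.2.mem_of_tendsto (h v hvU) ?_
  rw [eventually_map]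
  exact Filter.eventually_prod_iff.2 ⟨pa, hv, pb, hpb, hab⟩

theorem closedArc_isCompact {c : ℝ → ℂ} (hc : Continuous c) : IsCompact (closedArc c) :=
  isCompact_Icc.image hc

/-- The complement of a simple arc is dense. -/
theorem IsSimpleArc.dense_compl {c : ℝ → ℂ} {A B : ℂ} (hc : IsSimpleArc c A B) :
    Dense (closedArc c)ᶜ := by
  intro z
  by_cases hz : z ∈ closedArc c
  · obtain ⟨u, hu, rfl⟩ := hz
    exact mem_closure_iff_nhdsWithin_neBot.2 (neBot_of_le (hc.plusSide_le hu))
  · exact subset_closure hz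

end GFun

namespace GFun

/-! ### Removability of regular arcs for continuous functions -/

/-- The derivative of `∫ f dz` along the translates `c + w e` of a curve. -/
theorem hasDerivAt_integral_translate {c : ℝ → ℂ} (hc : ContDiff ℝ 1 c) {f : ℂ → ℂ}
    (hf : Continuous f) {e : ℂ} {α β w r : ℝ} (hr : 0 < r)
    (han : ∀ s ∈ uIcc α β, ∀ x ∈ Metric.closedBall w r, AnalyticAt ℂ f (c s + x * e)) :
    HasDerivAt (fun x : ℝ => ∫ s in α..β, f (c s + x * e) * deriv c s)
      (e * (f (c β + w * e) - f (c α + w * e))) w := by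
  have hc0 := hc.continuous
  have hc1 : Continuous (deriv c) := hc.continuous_deriv le_rfl
  set F' : ℝ → ℝ → ℂ := fun x s => deriv f (c s + x * e) * e * deriv c s with hF'
  have hcontF' : ContinuousOn (fun p : ℝ × ℝ => F' p.2 p.1)
      (uIcc α β ×ˢ Metric.closedBall w r) := by
    intro p hp
    have h1 : ContinuousAt (deriv f) (c p.1 + p.2 * e) := (han p.1 hp.1 p.2 hp.2).deriv.continuousAt
    have h2 : ContinuousAt (fun p : ℝ × ℝ => c p.1 + p.2 * e) p := by fun_prop
    have h3 : ContinuousAt (fun p : ℝ × ℝ => deriv f (c p.1 + p.2 * e)) p :=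
      ContinuousAt.comp (f := fun p : ℝ × ℝ => c p.1 + p.2 * e) h1 h2
    have h4 : ContinuousAt (fun p : ℝ × ℝ => deriv c p.1) p := by fun_prop
    exact ((h3.mul continuousAt_const).mul h4).continuousWithinAt
  obtain ⟨C, hC⟩ := ((isCompact_uIcc (a := α) (b := β)).prod
    (isCompact_closedBall w r)).exists_bound_of_continuousOn hcontF'
  have key := intervalIntegral.hasDerivAt_integral_of_dominated_loc_of_deriv_le (μ := volume)
    (𝕜 := ℝ) (a := α) (b := β) (F := fun x s => f (c s + x * e) * deriv c s) (F' := F') (x₀ := w)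
    (s := Metric.closedBall w r) (bound := fun _ => C) (Metric.closedBall_mem_nhds w hr)
    (Eventually.of_forall fun x => by
      have : Continuous (fun s => f (c s + x * e) * deriv c s) := by fun_prop
      exact this.aestronglyMeasurable)
    (by
      have : Continuous (fun s => f (c s + w * e) * deriv c s) := by fun_prop
      exact this.intervalIntegrable _ _)
    (by
      have h1 : ContinuousOn (F' w) (uIcc α β) := by
        have : F' w = (fun p : ℝ × ℝ => F' p.2 p.1) ∘ (fun s => (s, w)) := rfl
        rw [this]
        exact hcontF'.comp (by fun_prop) fun s hs => ⟨hs, Metric.mem_closedBall_self hr.le⟩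
      exact (h1.mono uIoc_subset_uIcc).aestronglyMeasurable measurableSet_uIoc)
    (Eventually.of_forall fun s hs x hx => hC (s, x) ⟨uIoc_subset_uIcc hs, hx⟩)
    (by simp)
    (Eventually.of_forall fun s hs x hx => by
      have h1 := (han s (uIoc_subset_uIcc hs) x hx).differentiableAt.hasDerivAt
      have h2 : HasDerivAt (fun x : ℝ => c s + x * e) e x := by
        simpa using ((hasDerivAt_id x).ofReal_comp.mul_const e).const_add (c s)
      have h3 := (HasDerivAt.comp_of_eq x h1 h2 rfl).mul_const (deriv c s)
      exact h3)
  refine key.2.congr_deriv ?_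
  -- The differentiated integrand is itself an `s`-derivative, so only the two end values remain.
  have h4 : ∀ s ∈ uIcc α β, HasDerivAt (fun s => e * f (c s + w * e)) (F' w s) s := by
    intro s hs
    have h1 := (han s hs w (Metric.mem_closedBall_self hr.le)).differentiableAt.hasDerivAt
    have h2 : HasDerivAt (fun s : ℝ => c s + w * e) (deriv c s) s :=
      (hc.differentiable (by simp) s).hasDerivAt.add_const _
    refine ((HasDerivAt.comp_of_eq s h1 h2 rfl).const_mul e).congr_deriv ?_
    simp only [hF']; ring
  rw [intervalIntegral.integral_eq_sub_of_hasDerivAt h4 key.1]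
  ring

/-- A continuous function that is analytic off a regular `C¹` curve near a point of the curve is
analytic at that point. -/
theorem analyticAt_of_analytic_off_curve {c : ℝ → ℂ} (hc : ContDiff ℝ 1 c) {u : ℝ}
    (hu : deriv c u ≠ 0) {f : ℂ → ℂ} (hf : Continuous f)
    (hoff : ∀ᶠ q : ℝ × ℝ in 𝓝 (u, (0 : ℝ)), q.2 ≠ 0 →
      AnalyticAt ℂ f (c q.1 + q.2 * (I * deriv c u))) :
    AnalyticAt ℂ f (c u) := by
  have hc0 := hc.continuous
  have hc1 : Continuous (deriv c) := hc.continuous_deriv le_rfl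
  set k := deriv c u with hk
  -- The transversal direction is frozen at `u`. All translates of the curve then have the same
  -- velocity, and the coordinates are `C¹`, whereas a moving normal would only be continuous.
  set e := I * k with he
  obtain ⟨δ', δ'pos, hδ'⟩ := Metric.eventually_nhds_iff.1 hoff
  set δ := δ' / 2 with hδd
  have δpos : 0 < δ := by positivity
  have han : ∀ v w : ℝ, |v - u| ≤ δ → |w| < δ → w ≠ 0 → AnalyticAt ℂ f (c v + w * e) := by
    intro v w hv hw hw0
    refine hδ' (y := (v, w)) ?_ hw0
    rw [Prod.dist_eq, Real.dist_eq, Real.dist_eq, sub_zero]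
    exact max_lt (by linarith) (by linarith)
  set v₁ := u - δ with hv₁
  -- The candidate for a primitive of `f`: the integral from `c v₁` transversally to height `w`,
  -- then along the translated curve.
  set G : ℝ → ℝ → ℂ := fun v w =>
    (∫ s in v₁..v, f (c s + w * e) * deriv c s) + ∫ s in (0 : ℝ)..w, f (c v₁ + s * e) * e with hG
  have hG1 : ∀ v w, HasDerivAt (G · w) (f (c v + w * e) * deriv c v) v := by
    intro v w
    have h1 : Continuous (fun s => f (c s + w * e) * deriv c s) := by fun_prop
    exact (intervalIntegral.integral_hasDerivAt_right (h1.intervalIntegrable _ _)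
      (h1.stronglyMeasurableAtFilter _ _) h1.continuousAt).add_const _
  -- The same value is obtained along the other two sides of the curved quadrilateral, a form in
  -- which the `w`-derivative can be read off.
  have hGeq : ∀ v w, |v - u| < δ → |w| < δ → G v w =
      (∫ s in v₁..v, f (c s + (0 : ℝ) * e) * deriv c s) + ∫ s in (0 : ℝ)..w, f (c v + s * e) * e := by
    intro v w hv hw
    have hseg : ∀ s ∈ uIcc v₁ v, |s - u| ≤ δ := by
      intro s hs
      obtain ⟨h1, h2⟩ := abs_lt.1 hv
      rw [uIcc_of_le (by linarith)] at hs
      exact abs_le.2 ⟨by linarith [hs.1], by linarith [hs.2]⟩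
    have hI : (∫ x in (0 : ℝ)..w, e * (f (c v + x * e) - f (c v₁ + x * e)))
        = (∫ s in v₁..v, f (c s + w * e) * deriv c s)
          - ∫ s in v₁..v, f (c s + (0 : ℝ) * e) * deriv c s := by
      -- Height `0`, where analyticity of `f` is not known, is a single exceptional value;
      -- continuity is enough there.
      refine integral_eq_of_hasDerivAt_off_countable
        (fun x : ℝ => ∫ s in v₁..v, f (c s + x * e) * deriv c s) _ (countable_singleton 0) ?_ ?_ ?_
      · refine Continuous.continuousOn ?_
        refine intervalIntegral.continuous_parametric_intervalIntegral_of_continuous' ?_ _ _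
        simp only [Function.uncurry_def]
        fun_prop
      · rintro x ⟨hx, hx0⟩
        have hx0 : x ≠ 0 := hx0
        have hxδ : |x| < δ := by
          obtain ⟨h1, h2⟩ := abs_lt.1 hw
          refine abs_lt.2 ⟨lt_of_le_of_lt ?_ hx.1, lt_of_lt_of_le hx.2 ?_⟩
          · exact le_min (by linarith) h1.le
          · exact max_le δpos.le h2.le
        have hxp : 0 < |x| := abs_pos.2 hx0
        set r := min (|x| / 2) ((δ - |x|) / 2) with hr
        have hrpos : 0 < r := lt_min (by positivity) (by linarith)
        have hr1 : r ≤ |x| / 2 := min_le_left _ _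
        have hr2 : r ≤ (δ - |x|) / 2 := min_le_right _ _
        refine hasDerivAt_integral_translate hc hf hrpos fun s hs y hy => ?_
        rw [Metric.mem_closedBall, Real.dist_eq] at hy
        have h1 := abs_sub_abs_le_abs_sub y x
        have h2 := abs_sub_abs_le_abs_sub x y
        rw [abs_sub_comm x y] at h2
        refine han s y (hseg s hs) (by linarith) ?_
        rw [← abs_pos]; linarith
      · refine Continuous.intervalIntegrable ?_ _ _
        fun_prop
    have h3 : (∫ x in (0 : ℝ)..w, e * (f (c v + x * e) - f (c v₁ + x * e)))
        = (∫ s in (0 : ℝ)..w, f (c v + s * e) * e) - ∫ s in (0 : ℝ)..w, f (c v₁ + s * e) * e := by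
      rw [← intervalIntegral.integral_sub]
      · congr 1; ext x; ring
      · exact Continuous.intervalIntegrable (by fun_prop) _ _
      · exact Continuous.intervalIntegrable (by fun_prop) _ _
    simp only [hG]
    linear_combination h3 - hI
  have hG2 : ∀ v w, |v - u| < δ → |w| < δ → HasDerivAt (G v ·) (f (c v + w * e) * e) w := by
    intro v w hv hw
    have h1 : Continuous (fun s : ℝ => f (c v + s * e) * e) := by fun_prop
    have h2 := (intervalIntegral.integral_hasDerivAt_right (h1.intervalIntegrable 0 w)
      (h1.stronglyMeasurableAtFilter _ _) h1.continuousAt).const_add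
      (∫ s in v₁..v, f (c s + (0 : ℝ) * e) * deriv c s)
    refine h2.congr_of_eventuallyEq ?_
    have : ∀ᶠ x : ℝ in 𝓝 w, |x| < δ := continuous_abs.continuousAt.eventually (gt_mem_nhds hw)
    filter_upwards [this] with x hx
    exact hGeq v x hv hx
  -- Division by `k` makes the derivative at `(u, 0)` the standard identification `(x, y) ↦ x + i
  -- y`.
  set Ψ : ℝ × ℝ → ℂ := fun q => (c q.1 + q.2 * e) / k with hΨ
  have hΨC : ContDiff ℝ 1 Ψ := by
    have h1 : ContDiff ℝ 1 (fun q : ℝ × ℝ => ((q.2 : ℝ) : ℂ)) :=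
      ofRealCLM.contDiff.comp contDiff_snd
    have h2 : ContDiff ℝ 1 (fun q : ℝ × ℝ => c q.1) := hc.comp contDiff_fst
    exact (h2.add (h1.mul contDiff_const)).div_const k
  set Ψ' : ℝ × ℝ → ℝ × ℝ →L[ℝ] ℂ := fun q =>
    (ContinuousLinearMap.toSpanSingleton ℝ (deriv c q.1 / k)).coprod
      (ContinuousLinearMap.toSpanSingleton ℝ I) with hΨ'
  have hΨd : ∀ q, HasFDerivAt Ψ (Ψ' q) q := by
    intro q
    have h1 : HasFDerivAt (fun q : ℝ × ℝ => c q.1)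
        ((ContinuousLinearMap.toSpanSingleton ℝ (deriv c q.1)).comp
          (ContinuousLinearMap.fst ℝ ℝ ℝ)) q :=
      (hc.differentiable (by simp) q.1).hasDerivAt.hasFDerivAt.comp q hasFDerivAt_fst
    have h2 : HasFDerivAt (fun q : ℝ × ℝ => ((q.2 : ℝ) : ℂ))
        (ofRealCLM.comp (ContinuousLinearMap.snd ℝ ℝ ℝ)) q :=
      ofRealCLM.hasFDerivAt.comp q hasFDerivAt_snd
    have h3 := (h1.add (h2.mul_const e)).mul_const k⁻¹
    refine (h3.congr_fderiv ?_).congr_of_eventuallyEq (Eventually.of_forall fun q => ?_)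
    · ext <;> simp [hΨ', he] <;> field_simp
    · simp [hΨ, div_eq_mul_inv]
  have hGd : ∀ q : ℝ × ℝ, |q.1 - u| < δ → |q.2| < δ →
      HasFDerivAt (↿G) ((f (c q.1 + q.2 * e) * k) • Ψ' q) q := by
    intro q hq1 hq2
    have hev : ∀ᶠ p : ℝ × ℝ in 𝓝 q, |p.1 - u| < δ ∧ |p.2| < δ := by
      refine Filter.Eventually.and ?_ ?_
      · exact (show ContinuousAt (fun p : ℝ × ℝ => |p.1 - u|) q by fun_prop).eventually
          (gt_mem_nhds hq1)
      · exact (show ContinuousAt (fun p : ℝ × ℝ => |p.2|) q by fun_prop).eventually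
          (gt_mem_nhds hq2)
    have hcl : Continuous fun x : ℂ => ContinuousLinearMap.toSpanSingleton ℝ x :=
      (ContinuousLinearMap.toSpanSingletonCLE (𝕜 := ℝ) (E := ℂ)).continuous
    have h := hasStrictFDerivAt_uncurry_coprod (𝕜 := ℝ) (u := q) (f := G)
      (f₁ := fun v w => ContinuousLinearMap.toSpanSingleton ℝ (f (c v + w * e) * deriv c v))
      (f₂ := fun v w => ContinuousLinearMap.toSpanSingleton ℝ (f (c v + w * e) * e))
      (Eventually.of_forall fun p => (hG1 p.1 p.2).hasFDerivAt)
      (hev.mono fun p hp => (hG2 p.1 p.2 hp.1 hp.2).hasFDerivAt)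
      (Continuous.continuousAt (hcl.comp
        (show Continuous fun p : ℝ × ℝ => f (c p.1 + p.2 * e) * deriv c p.1 by fun_prop)))
      (Continuous.continuousAt (hcl.comp
        (show Continuous fun p : ℝ × ℝ => f (c p.1 + p.2 * e) * e by fun_prop)))
    refine h.hasFDerivAt.congr_fderiv ?_
    ext <;> simp [hΨ', he, Function.HasUncurry.uncurry] <;> field_simp
  have hΨ0 : HasFDerivAt Ψ ((equivRealProdCLM.symm : (ℝ × ℝ) ≃L[ℝ] ℂ) : ℝ × ℝ →L[ℝ] ℂ) (u, 0) := by
    refine (hΨd (u, 0)).congr_fderiv ?_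
    ext <;> simp [hΨ', ← hk, hu, equivRealProdCLM_symm_apply]
  have hCA : ContDiffAt ℝ 1 Ψ (u, 0) := hΨC.contDiffAt
  set inv := hCA.localInverse hΨ0 one_ne_zero with hinv
  have hΨu : Ψ (u, 0) = c u / k := by simp [hΨ]
  have hinvC : ContDiffAt ℝ 1 inv (c u / k) := hΨu ▸ hCA.to_localInverse hΨ0 one_ne_zero
  have hinvu : inv (c u / k) = (u, 0) := by
    rw [← hΨu]; exact hCA.localInverse_apply_image hΨ0 one_ne_zero
  have hright : ∀ᶠ y in 𝓝 (c u / k), Ψ (inv y) = y := by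
    rw [← hΨu]
    exact (hCA.hasStrictFDerivAt' hΨ0 one_ne_zero).eventually_right_inverse
  have hinvD : ∀ᶠ y in 𝓝 (c u / k), DifferentiableAt ℝ inv y :=
    (hinvC.eventually (by simp)).mono fun y hy => hy.differentiableAt (by simp)
  have hball : ∀ᶠ y in 𝓝 (c u / k), |(inv y).1 - u| < δ ∧ |(inv y).2| < δ := by
    have hcont : ContinuousAt inv (c u / k) := hinvC.continuousAt
    refine Filter.Eventually.and ?_ ?_
    · refine (show ContinuousAt (fun y => |(inv y).1 - u|) (c u / k) by fun_prop).eventually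
        (gt_mem_nhds ?_)
      simp [hinvu, δpos]
    · refine (show ContinuousAt (fun y => |(inv y).2|) (c u / k) by fun_prop).eventually
        (gt_mem_nhds ?_)
      simp [hinvu, δpos]
  -- `G` read in the complex variable. Its real derivative is multiplication by `f z`, so `F` is
  -- holomorphic and `f = F'` is analytic.
  set F : ℂ → ℂ := fun z => ↿G (inv (z / k)) with hF
  have hFd : ∀ᶠ z in 𝓝 (c u), HasDerivAt F (f z) z := by
    have hdiv : Tendsto (fun z => z / k) (𝓝 (c u)) (𝓝 (c u / k)) :=
      (continuous_id.div_const k).continuousAt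
    have hright2 := hright.eventually_nhds
    filter_upwards [hdiv.eventually hright2, hdiv.eventually hinvD, hdiv.eventually hball]
      with z hz1 hz2 hz3
    have h1 := hz2.hasFDerivAt
    have h2 : HasFDerivAt (Ψ ∘ inv) ((Ψ' (inv (z / k))).comp (fderiv ℝ inv (z / k))) (z / k) :=
      (hΨd _).comp _ h1
    have h3 : HasFDerivAt (Ψ ∘ inv) (ContinuousLinearMap.id ℝ ℂ) (z / k) :=
      (hasFDerivAt_id _).congr_of_eventuallyEq hz1
    have h4 := h2.unique h3
    have h5 : HasFDerivAt (↿G ∘ inv) _ (z / k) := (hGd _ hz3.1 hz3.2).comp _ h1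
    have h6 : HasFDerivAt (fun z : ℂ => z / k)
        ((ContinuousLinearMap.mul ℝ ℂ k⁻¹ : ℂ →L[ℝ] ℂ)) z := by
      have := (ContinuousLinearMap.mul ℝ ℂ k⁻¹).hasFDerivAt (x := z)
      refine this.congr_of_eventuallyEq (Eventually.of_forall fun y => ?_)
      simp [div_eq_inv_mul]
    have h7 : HasFDerivAt F _ z := HasFDerivAt.comp (g := ↿G ∘ inv) (f := fun z => z / k) z h5 h6
    have hfz : f (c (inv (z / k)).1 + (inv (z / k)).2 * e) = f z := by
      congr 1
      have := hz1.self_of_nhds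
      simp only [hΨ] at this
      exact (div_left_inj' hu).1 this
    rw [hasDerivAt_iff_hasFDerivAt]
    refine hasFDerivAt_of_restrictScalars ℝ h7 ?_
    rw [ContinuousLinearMap.smul_comp, h4, hfz]
    ext
    simp
    field_simp
  have hFan : AnalyticAt ℂ F (c u) :=
    analyticAt_iff_eventually_differentiableAt.2 (hFd.mono fun z hz => hz.differentiableAt)
  refine hFan.deriv.congr ?_
  exact hFd.mono fun z hz => hz.deriv

/-- Simple arcs are removable for continuous functions. -/
theorem IsSimpleArc.differentiable_of_compl {c : ℝ → ℂ} {A B : ℂ} (hc : IsSimpleArc c A B)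
    {f : ℂ → ℂ} (hf : Continuous f) (hoff : DifferentiableOn ℂ f (closedArc c)ᶜ) :
    Differentiable ℂ f := by
  have hopen : IsOpen (closedArc c)ᶜ :=
    (closedArc_isCompact hc.contDiff.continuous).isClosed.isOpen_compl
  -- The end points are isolated exceptions, removed afterwards one at a time.
  have hin : ∀ z, z ≠ A → z ≠ B → DifferentiableAt ℂ f z := by
    intro z hA hB
    by_cases hz : z ∈ closedArc c
    · obtain ⟨u, hu, rfl⟩ := hz
      refine (analyticAt_of_analytic_off_curve hc.contDiff (hc.regular u hu) hf ?_).differentiableAt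
      filter_upwards [hc.eventually_notMem hu (d := fun _ => deriv c u) continuousAt_const rfl]
        with q hq hq2
      refine hoff.analyticAt (hopen.mem_nhds fun hmem => hq2 (hq ?_).1)
      rwa [mul_assoc]
    · exact hoff.differentiableAt (hopen.mem_nhds hz)
  have hinB : ∀ z, z ≠ A → DifferentiableAt ℂ f z := by
    intro z hA
    by_cases hB : z = B
    · subst hB
      have hs : ({A}ᶜ : Set ℂ) ∈ 𝓝 z := isOpen_compl_singleton.mem_nhds hA
      refine ((differentiableOn_compl_singleton_and_continuousAt_iff hs).1
        ⟨fun w hw => (hin w hw.1 hw.2).differentiableWithinAt, hf.continuousAt⟩).differentiableAt hs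
    · exact hin z hA hB
  have := (differentiableOn_compl_singleton_and_continuousAt_iff (f := f) (c := A)
    (s := univ) univ_mem).1
    ⟨fun w hw => (hinB w hw.2).differentiableWithinAt, hf.continuousAt⟩
  exact differentiableOn_univ.1 this

end GFun

namespace GFun

/-! ### The square root `R` -/

theorem IsSimpleArc.isOpen_compl {c : ℝ → ℂ} {A B : ℂ} (hc : IsSimpleArc c A B) :
    IsOpen (closedArc c)ᶜ :=
  (closedArc_isCompact hc.contDiff.continuous).isClosed.isOpen_compl

theorem IsSimpleArc.source_mem {c : ℝ → ℂ} {A B : ℂ} (hc : IsSimpleArc c A B) : A ∈ closedArc c :=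
  ⟨0, by simp, hc.source⟩

theorem IsSimpleArc.target_mem {c : ℝ → ℂ} {A B : ℂ} (hc : IsSimpleArc c A B) : B ∈ closedArc c :=
  ⟨1, by simp, hc.target⟩

/-- The integral of `1 / (z - s)` along the arc is an analytic logarithm of
`(z - A) / (z - B)`. -/
theorem IsSimpleArc.sub_mul_exp_integral {c : ℝ → ℂ} {A B : ℂ} (hc : IsSimpleArc c A B) {z : ℂ}
    (hz : z ∈ (closedArc c)ᶜ) :
    (z - B) * exp (∫ s in (0 : ℝ)..1, deriv c s / (z - c s)) = z - A := by
  have hc0 := hc.contDiff.continuous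
  have hc1 : Continuous (deriv c) := hc.contDiff.continuous_deriv le_rfl
  have hne : ∀ s ∈ Icc (0 : ℝ) 1, z - c s ≠ 0 := fun s hs h => hz ⟨s, hs, (sub_eq_zero.1 h).symm⟩
  have hcont : ContinuousOn (fun s => deriv c s / (z - c s)) (Icc 0 1) :=
    ContinuousOn.div (by fun_prop) (by fun_prop) hne
  have hmeas : StronglyMeasurable (fun s => deriv c s / (z - c s)) :=
    (hc1.measurable.div (measurable_const.sub hc0.measurable)).stronglyMeasurable
  -- The two factors have opposite logarithmic derivatives, so the product keeps its initial value
  -- `z - A`.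
  have hd : ∀ u ∈ Icc (0 : ℝ) 1, HasDerivAt
      (fun u => (z - c u) * exp (∫ s in (0 : ℝ)..u, deriv c s / (z - c s))) 0 u := by
    intro u hu
    have hint : IntervalIntegrable (fun s => deriv c s / (z - c s)) volume 0 u := by
      refine ContinuousOn.intervalIntegrable (hcont.mono ?_)
      rw [uIcc_of_le hu.1]
      exact Icc_subset_Icc_right hu.2
    have h1 := intervalIntegral.integral_hasDerivAt_right hint
      hmeas.stronglyMeasurableAtFilter
      (ContinuousAt.div (by fun_prop) (by fun_prop) (hne u hu))
    have h2 : HasDerivAt (fun u => z - c u) (-deriv c u) u :=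
      (hc.contDiff.differentiable (by simp) u).hasDerivAt.const_sub z
    refine (h2.mul h1.cexp).congr_deriv ?_
    have := hne u hu
    field_simp
    ring
  have h := constant_of_has_deriv_right_zero
    (fun u hu => (hd u hu).continuousAt.continuousWithinAt)
    (fun u hu => (hd u (Ico_subset_Icc_self hu)).hasDerivWithinAt) 1 (by simp)
  simpa [hc.source, hc.target] using h

theorem IsSimpleArc.differentiableOn_integral {c : ℝ → ℂ} {A B : ℂ} (hc : IsSimpleArc c A B) :
    DifferentiableOn ℂ (fun z => ∫ s in (0 : ℝ)..1, deriv c s / (z - c s)) (closedArc c)ᶜ := by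
  have hc0 := hc.contDiff.continuous
  have hc1 : Continuous (deriv c) := hc.contDiff.continuous_deriv le_rfl
  intro z₀ hz₀
  obtain ⟨r, hr, hball⟩ := Metric.nhds_basis_closedBall.mem_iff.1 (hc.isOpen_compl.mem_nhds hz₀)
  have hne : ∀ s ∈ uIcc (0 : ℝ) 1, ∀ z ∈ Metric.closedBall z₀ r, z - c s ≠ 0 := by
    intro s hs z hz h
    rw [uIcc_of_le zero_le_one] at hs
    exact hball hz ⟨s, hs, (sub_eq_zero.1 h).symm⟩
  set F' : ℂ → ℝ → ℂ := fun z s => -deriv c s / (z - c s) ^ 2 with hF'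
  have hcont' : ContinuousOn (fun p : ℝ × ℂ => F' p.2 p.1)
      (uIcc (0 : ℝ) 1 ×ˢ Metric.closedBall z₀ r) :=
    ContinuousOn.div (by fun_prop) (by fun_prop) fun p hp => pow_ne_zero _ (hne p.1 hp.1 p.2 hp.2)
  obtain ⟨C, hC⟩ := ((isCompact_uIcc (a := (0 : ℝ)) (b := 1)).prod
    (isCompact_closedBall z₀ r)).exists_bound_of_continuousOn hcont'
  have hmeas : ∀ z, Measurable (fun s => deriv c s / (z - c s)) := fun z =>
    hc1.measurable.div (measurable_const.sub hc0.measurable)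
  have key := intervalIntegral.hasDerivAt_integral_of_dominated_loc_of_deriv_le (μ := volume)
    (𝕜 := ℂ) (a := 0) (b := 1) (F := fun z s => deriv c s / (z - c s)) (F' := F') (x₀ := z₀)
    (s := Metric.closedBall z₀ r) (bound := fun _ => C) (Metric.closedBall_mem_nhds z₀ hr)
    (Eventually.of_forall fun z => (hmeas z).aestronglyMeasurable)
    (ContinuousOn.intervalIntegrable (ContinuousOn.div (by fun_prop) (by fun_prop)
      fun s hs => hne s hs z₀ (Metric.mem_closedBall_self hr.le)))
    (Measurable.aestronglyMeasurable
      (hc1.measurable.neg.div ((measurable_const.sub hc0.measurable).pow_const 2)))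
    (Eventually.of_forall fun s hs z hz => hC (s, z) ⟨uIoc_subset_uIcc hs, hz⟩)
    (by simp)
    (Eventually.of_forall fun s hs z hz => by
      have h1 := ((hasDerivAt_id z).sub_const (c s)).inv (hne s (uIoc_subset_uIcc hs) z hz)
      refine ((h1.const_mul (deriv c s)).congr_deriv ?_).congr_of_eventuallyEq
        (Eventually.of_forall fun w => ?_)
      · simp only [hF', id]; ring
      · simp [div_eq_mul_inv])
  exact key.2.differentiableAt.differentiableWithinAt

theorem IsSimpleArc.tendsto_integral_cobounded {c : ℝ → ℂ} {A B : ℂ} (hc : IsSimpleArc c A B) :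
    Tendsto (fun z => ∫ s in (0 : ℝ)..1, deriv c s / (z - c s)) (cobounded ℂ) (𝓝 0) := by
  have hc0 := hc.contDiff.continuous
  have hc1 : Continuous (deriv c) := hc.contDiff.continuous_deriv le_rfl
  obtain ⟨C, hC⟩ := (isCompact_uIcc (a := (0 : ℝ)) (b := 1)).exists_bound_of_continuousOn
    hc0.continuousOn
  obtain ⟨C', hC'⟩ := (isCompact_uIcc (a := (0 : ℝ)) (b := 1)).exists_bound_of_continuousOn
    hc1.continuousOn
  have hC'0 : 0 ≤ C' := (norm_nonneg _).trans (hC' 0 (by simp))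
  have h1 : Tendsto (fun z : ℂ => C' / (‖z‖ - C)) (cobounded ℂ) (𝓝 0) :=
    (tendsto_atTop_add_const_right _ (-C) tendsto_norm_cobounded_atTop).const_div_atTop C'
  refine squeeze_zero_norm' ?_ h1
  filter_upwards [tendsto_norm_cobounded_atTop.eventually_gt_atTop C] with z hz
  have := intervalIntegral.norm_integral_le_of_norm_le_const (a := (0 : ℝ)) (b := 1)
    (C := C' / (‖z‖ - C)) (f := fun s => deriv c s / (z - c s)) (fun s hs => by
      have hs' := uIoc_subset_uIcc hs
      rw [norm_div]
      have h2 : ‖z‖ - C ≤ ‖z - c s‖ :=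
        (sub_le_sub_left (hC s hs') _).trans (norm_sub_norm_le _ _)
      exact div_le_div₀ hC'0 (hC' s hs') (by linarith) h2)
  simpa using this

/-- The square root `R` exists. -/
theorem IsSimpleArc.exists_isSqrtBranch {c : ℝ → ℂ} {ξ : ℂ} (hc : IsSimpleArc c (conj ξ) ξ) :
    ∃ R, IsSqrtBranch ξ (closedArc c) R := by
  -- Half of the integral is a logarithm of a square root of `(z - conj ξ) / (z - ξ)`.
  refine ⟨fun z => (z - ξ) * exp ((∫ s in (0 : ℝ)..1, deriv c s / (z - c s)) / 2), ?_, ?_, ?_⟩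
  · refine DifferentiableOn.analyticOnNhd ?_ hc.isOpen_compl
    exact (differentiableOn_id.sub_const ξ).mul (hc.differentiableOn_integral.div_const 2).cexp
  · intro z hz
    rw [mul_pow, ← exp_nat_mul, ← hc.sub_mul_exp_integral hz]
    push_cast
    rw [mul_div_cancel₀ _ (two_ne_zero)]
    ring
  · have h1 : Tendsto (fun z : ℂ => (z - ξ) / z) (cobounded ℂ) (𝓝 1) := by
      have h2 : Tendsto (fun z : ℂ => 1 - ξ * z⁻¹) (cobounded ℂ) (𝓝 1) := by
        simpa using (tendsto_inv₀_cobounded.const_mul ξ).const_sub 1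
      refine h2.congr' ?_
      filter_upwards [eventually_ne_cobounded (0 : ℂ)] with z hz
      field_simp
    have h2 := ((continuous_exp.tendsto 0).comp
      (by simpa using hc.tendsto_integral_cobounded.div_const 2))
    have h3 := h1.mul h2
    simp only [exp_zero, mul_one] at h3
    refine h3.congr fun z => ?_
    simp only [Function.comp]
    ring

/-! ### Boundary values on the arc. -/

/-- A continuous square root has one-sided limits where its square is non-zero. -/
theorem IsSimpleArc.exists_tendsto_of_sq {c : ℝ → ℂ} {A B : ℂ} (hc : IsSimpleArc c A B)
    {F Q : ℂ → ℂ} (hF : ContinuousOn F (closedArc c)ᶜ) (hQ : Continuous Q)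
    (hFQ : ∀ z ∈ (closedArc c)ᶜ, F z ^ 2 = Q z) {u : ℝ} (hu : u ∈ Icc (0 : ℝ) 1)
    (hQu : Q (c u) ≠ 0) {s : Set ℝ} [NeBot (𝓝[s] (0 : ℝ))] (hs : s.OrdConnected)
    (hs0 : (0 : ℝ) ∉ s) :
    ∃ r, Tendsto F (Filter.map (normalMap c) (𝓝 u ×ˢ 𝓝[s] (0 : ℝ))) (𝓝 r) := by
  have hcont := continuous_normalMap hc.contDiff
  obtain ⟨σ, hσ⟩ : ∃ σ, Q (c u) = σ ^ 2 :=
    (IsAlgClosed.exists_pow_nat_eq (Q (c u)) two_pos).imp fun _ h => h.symm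
  have hσ0 : σ ≠ 0 := by rintro rfl; simp at hσ; exact hQu hσ
  set q₀ : ℝ × ℝ := (u, 0) with hq₀
  have hratio : ContinuousAt (fun q => Q (normalMap c q) / Q (c u)) q₀ := by fun_prop
  have h1 : ∀ᶠ q in 𝓝 q₀, Q (normalMap c q) / Q (c u) ∈ slitPlane := by
    refine hratio.eventually (isOpen_slitPlane.mem_nhds ?_)
    simp [hq₀, normalMap_zero, hQu]
  have h2 := hc.eventually_normalMap_notMem hu
  obtain ⟨δ, hδ, hball⟩ := Metric.eventually_nhds_iff_ball.1 (h1.and h2)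
  set box : Set (ℝ × ℝ) := Metric.ball u δ ×ˢ (Metric.ball 0 δ ∩ s) with hbox
  have hbox_sub : box ⊆ Metric.ball q₀ δ := by
    rw [hq₀, ← ball_prod_same]
    exact prod_mono le_rfl inter_subset_left
  have hpre : IsPreconnected box := by
    refine (convex_ball u δ).isPreconnected.prod ?_
    rw [Real.ball_eq_Ioo]
    exact (ordConnected_Ioo.inter hs).isPreconnected
  have hbox_mem : box ∈ 𝓝 u ×ˢ 𝓝[s] (0 : ℝ) :=
    prod_mem_prod (Metric.ball_mem_nhds u hδ)
      (inter_mem (mem_nhdsWithin_of_mem_nhds (Metric.ball_mem_nhds 0 hδ)) self_mem_nhdsWithin)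
  -- A square root of `Q` that is continuous up to the curve, built from the principal logarithm of
  -- `Q / Q (c u)`. On the connected box `F` agrees with it up to one sign.
  set S : ℝ × ℝ → ℂ := fun q => σ * exp (log (Q (normalMap c q) / Q (c u)) / 2) with hS
  have hmaps : MapsTo (normalMap c) box (closedArc c)ᶜ := fun q hq hmem =>
    hs0 (((hball q (hbox_sub hq)).2 hmem).1 ▸ hq.2.2)
  have hScont : ContinuousAt S q₀ := by
    have : ContinuousAt (fun q => log (Q (normalMap c q) / Q (c u))) q₀ :=
      hratio.clog h1.self_of_nhds
    fun_prop
  have hS0 : S q₀ = σ := by simp [hS, hq₀, normalMap_zero, hQu]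
  have hSc : ContinuousOn S box := by
    have : ContinuousOn (fun q => log (Q (normalMap c q) / Q (c u))) box :=
      ContinuousOn.clog (by fun_prop) fun q hq => (hball q (hbox_sub hq)).1
    fun_prop
  have hle : 𝓝 u ×ˢ 𝓝[s] (0 : ℝ) ≤ 𝓝 q₀ := by
    rw [hq₀, nhds_prod_eq]; exact Filter.prod_mono le_rfl nhdsWithin_le_nhds
  have hSlim : Tendsto S (𝓝 u ×ˢ 𝓝[s] (0 : ℝ)) (𝓝 σ) := by
    rw [← hS0]; exact hScont.tendsto.mono_left hle
  have hFc : ContinuousOn (F ∘ normalMap c) box := hF.comp hcont.continuousOn hmaps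
  have hsq : EqOn ((F ∘ normalMap c) ^ 2) (S ^ 2) box := by
    intro q hq
    have hne : Q (normalMap c q) / Q (c u) ≠ 0 := slitPlane_ne_zero (hball q (hbox_sub hq)).1
    simp only [Pi.pow_apply, Function.comp, hS]
    rw [hFQ _ (hmaps hq), mul_pow, ← exp_nat_mul]
    push_cast
    rw [mul_div_cancel₀ _ (two_ne_zero), exp_log hne, ← hσ]
    field_simp
  rcases hpre.eq_or_eq_neg_of_sq_eq hFc hSc hsq
    (fun _ => mul_ne_zero hσ0 (exp_ne_zero _)) with h | h
  · refine ⟨σ, tendsto_map'_iff.2 (hSlim.congr' ?_)⟩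
    filter_upwards [hbox_mem] with q hq using (h hq).symm
  · refine ⟨-σ, tendsto_map'_iff.2 (hSlim.neg.congr' ?_)⟩
    filter_upwards [hbox_mem] with q hq using (h hq).symm

/-- A function off a simple arc whose two boundary values agree extends to an entire function. -/
theorem IsSimpleArc.exists_entire_extension {c : ℝ → ℂ} {A B : ℂ} (hc : IsSimpleArc c A B)
    {F : ℂ → ℂ} (hF : DifferentiableOn ℂ F (closedArc c)ᶜ)
    (hside : ∀ u ∈ Ioo (0 : ℝ) 1, ∃ w, Tendsto F (plusSide c u) (𝓝 w) ∧
      Tendsto F (minusSide c u) (𝓝 w))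
    (hA : ∃ w, Tendsto F (𝓝[(closedArc c)ᶜ] A) (𝓝 w))
    (hB : ∃ w, Tendsto F (𝓝[(closedArc c)ᶜ] B) (𝓝 w)) :
    ∃ f : ℂ → ℂ, Differentiable ℂ f ∧ EqOn f F (closedArc c)ᶜ ∧
      ∀ z, Tendsto F (𝓝[(closedArc c)ᶜ] z) (𝓝 (f z)) := by
  have hlim : ∀ z, ∃ y, Tendsto F (𝓝[(closedArc c)ᶜ] z) (𝓝 y) := by
    intro z
    by_cases hz : z ∈ closedArc c
    · obtain ⟨u, hu, rfl⟩ := hz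
      rcases eq_or_lt_of_le hu.1 with h0 | h0
      · rw [← h0, hc.source]; exact hA
      rcases eq_or_lt_of_le hu.2 with h1 | h1
      · rw [h1, hc.target]; exact hB
      obtain ⟨w, hw1, hw2⟩ := hside u ⟨h0, h1⟩
      exact ⟨w, (hw1.sup hw2).mono_left (hc.nhdsWithin_le ⟨h0, h1⟩)⟩
    · exact ⟨F z, hF.continuousOn z hz⟩
  have hcont : Continuous (extendFrom (closedArc c)ᶜ F) := by
    rw [← continuousOn_univ]
    exact continuousOn_extendFrom (fun z _ => hc.dense_compl z) fun z _ => hlim z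
  have heq : EqOn (extendFrom (closedArc c)ᶜ F) F (closedArc c)ᶜ :=
    extendFrom_extends hF.continuousOn
  exact ⟨_, hc.differentiable_of_compl hcont (hF.congr heq), heq, fun z =>
    tendsto_extendFrom (hlim z)⟩

variable {c : ℝ → ℂ} {ξ : ℂ} {R : ℂ → ℂ}

theorem IsSqrtBranch.tendsto_zero {K : Set ℂ} (hR : IsSqrtBranch ξ K R) {z : ℂ}
    (hz : (z - ξ) * (z - conj ξ) = 0) : Tendsto R (𝓝[Kᶜ] z) (𝓝 0) := by
  have h1 : Tendsto (fun w => ‖(w - ξ) * (w - conj ξ)‖) (𝓝[Kᶜ] z) (𝓝 0) := by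
    have : Continuous (fun w => ‖(w - ξ) * (w - conj ξ)‖) := by fun_prop
    have h2 := this.tendsto z
    rw [hz, norm_zero] at h2
    exact h2.mono_left nhdsWithin_le_nhds
  have h2 : Tendsto (fun w => √(‖R w‖ ^ 2)) (𝓝[Kᶜ] z) (𝓝 0) := by
    rw [← Real.sqrt_zero]
    refine (Real.continuous_sqrt.tendsto 0).comp (h1.congr' ?_)
    filter_upwards [self_mem_nhdsWithin] with w hw
    rw [← hR.sq w hw, norm_pow]
  refine tendsto_zero_iff_norm_tendsto_zero.2 (h2.congr fun w => ?_)
  exact Real.sqrt_sq (norm_nonneg _)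

theorem quad_ne_zero (hc : IsSimpleArc c (conj ξ) ξ) {u : ℝ} (hu : u ∈ Ioo (0 : ℝ) 1) :
    (c u - ξ) * (c u - conj ξ) ≠ 0 := by
  have huI : u ∈ Icc (0 : ℝ) 1 := Ioo_subset_Icc_self hu
  refine mul_ne_zero (fun h => ?_) (fun h => ?_)
  · have := hc.inj huI (by simp) ((sub_eq_zero.1 h).trans hc.target.symm)
    linarith [hu.2]
  · have := hc.inj huI (by simp) ((sub_eq_zero.1 h).trans hc.source.symm)
    linarith [hu.1]

/-- The boundary values of the square root `R` on the two sides of the arc are opposite. -/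
theorem IsSqrtBranch.exists_boundary (hc : IsSimpleArc c (conj ξ) ξ) (hξ : 0 < ξ.im)
    (hR : IsSqrtBranch ξ (closedArc c) R) :
    ∃ r : ℝ → ℂ, ContinuousOn r (Ioo 0 1) ∧ ∀ u ∈ Ioo (0 : ℝ) 1,
      r u ^ 2 = (c u - ξ) * (c u - conj ξ) ∧
      Tendsto R (plusSide c u) (𝓝 (r u)) ∧ Tendsto R (minusSide c u) (𝓝 (-r u)) := by
  have hRc : ContinuousOn R (closedArc c)ᶜ := hR.analytic.continuousOn
  have hQ : Continuous (fun z => (z - ξ) * (z - conj ξ)) := by fun_prop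
  have hp : ∀ u ∈ Ioo (0 : ℝ) 1, ∃ r, Tendsto R (plusSide c u) (𝓝 r) := fun u hu =>
    hc.exists_tendsto_of_sq hRc hQ hR.sq (Ioo_subset_Icc_self hu) (quad_ne_zero hc hu)
      (s := Ioi 0) ordConnected_Ioi (by simp)
  have hm : ∀ u ∈ Ioo (0 : ℝ) 1, ∃ r, Tendsto R (minusSide c u) (𝓝 r) := fun u hu =>
    hc.exists_tendsto_of_sq hRc hQ hR.sq (Ioo_subset_Icc_self hu) (quad_ne_zero hc hu)
      (s := Iio 0) ordConnected_Iio (by simp)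
  choose! rp hrp using hp
  choose! rm hrm using hm
  have hrpc : ContinuousOn rp (Ioo 0 1) := continuousOn_of_tendsto_map (s := Ioi 0) isOpen_Ioo hrp
  have hrmc : ContinuousOn rm (Ioo 0 1) := continuousOn_of_tendsto_map (s := Iio 0) isOpen_Ioo hrm
  have hsq : ∀ {l : Filter ℂ} [l.NeBot] {z w : ℂ}, l ≤ 𝓝[(closedArc c)ᶜ] z → Tendsto R l (𝓝 w) →
      w ^ 2 = (z - ξ) * (z - conj ξ) := by
    intro l _ z w hl hw
    have h1 : Tendsto (fun z => R z ^ 2) l (𝓝 ((z - ξ) * (z - conj ξ))) := by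
      refine ((hQ.tendsto z).mono_left (hl.trans nhdsWithin_le_nhds)).congr' ?_
      filter_upwards [hl self_mem_nhdsWithin] with w hw using (hR.sq w hw).symm
    exact tendsto_nhds_unique (hw.pow 2) h1
  have hrp2 : ∀ u ∈ Ioo (0 : ℝ) 1, rp u ^ 2 = (c u - ξ) * (c u - conj ξ) := fun u hu =>
    hsq (hc.plusSide_le (Ioo_subset_Icc_self hu)) (hrp u hu)
  have hrm2 : ∀ u ∈ Ioo (0 : ℝ) 1, rm u ^ 2 = (c u - ξ) * (c u - conj ξ) := fun u hu =>
    hsq (hc.minusSide_le (Ioo_subset_Icc_self hu)) (hrm u hu)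
  have hrp0 : ∀ {u : ℝ}, u ∈ Ioo (0 : ℝ) 1 → rp u ≠ 0 := by
    intro u hu h
    have := hrp2 u hu
    rw [h] at this
    exact quad_ne_zero hc hu (by simpa using this.symm)
  rcases isPreconnected_Ioo.eq_or_eq_neg_of_sq_eq hrmc hrpc
    (fun u hu => (hrm2 u hu).trans (hrp2 u hu).symm) hrp0 with h | h
  -- If the two boundary values agreed, `R` would extend to an entire square root of `(z - ξ)(z -
  -- conj ξ)`. It would vanish at `ξ`, so its square would have derivative `0` there instead of `ξ -
  -- conj ξ`.
  · exfalso
    have hside : ∀ u ∈ Ioo (0 : ℝ) 1, ∃ w, Tendsto R (plusSide c u) (𝓝 w) ∧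
        Tendsto R (minusSide c u) (𝓝 w) := fun u hu => ⟨rp u, hrp u hu, h hu ▸ hrm u hu⟩
    obtain ⟨f, hf, -, hfl⟩ := hc.exists_entire_extension hR.analytic.differentiableOn hside
      ⟨0, hR.tendsto_zero (by simp)⟩ ⟨0, hR.tendsto_zero (by simp)⟩
    have hf2 : ∀ z, f z ^ 2 = (z - ξ) * (z - conj ξ) := by
      intro z
      have := mem_closure_iff_nhdsWithin_neBot.1 (hc.dense_compl z)
      exact hsq le_rfl (hfl z)
    have h0 : f ξ = 0 := by
      have := hf2 ξ
      simpa using this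
    have hd1 : HasDerivAt (fun z => f z ^ 2) 0 ξ :=
      ((hf ξ).hasDerivAt.pow 2).congr_deriv (by simp [h0])
    have hd2 : HasDerivAt (fun z => f z ^ 2) (ξ - conj ξ) ξ := by
      simp_rw [hf2]
      exact (((hasDerivAt_id ξ).sub_const ξ).mul
        ((hasDerivAt_id ξ).sub_const (conj ξ))).congr_deriv (by simp)
    have h3 := congrArg Complex.im (hd1.unique hd2)
    simp at h3
    linarith
  · refine ⟨rp, hrpc, fun u hu => ⟨hrp2 u hu, hrp u hu, ?_⟩⟩
    have h1 := h hu
    simp only [Pi.neg_apply] at h1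
    rw [← h1]
    exact hrm u hu

/-! ### The root on the real axis. -/

theorem quad_eq (ξ z : ℂ) :
    (z - ξ) * (z - conj ξ) = (z - ξ.re) ^ 2 + (ξ.im : ℂ) ^ 2 := by
  have h1 : ξ = ξ.re + ξ.im * I := (re_add_im ξ).symm
  have h2 : conj ξ = ξ.re - ξ.im * I := by
    apply Complex.ext <;> simp
  rw [h2]
  nth_rw 1 [h1]
  linear_combination -(ξ.im : ℂ) ^ 2 * I_sq

theorem quad_ofReal (ξ : ℂ) (x : ℝ) :
    ((x : ℂ) - ξ) * (x - conj ξ) = (((x - ξ.re) ^ 2 + ξ.im ^ 2 : ℝ) : ℂ) := by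
  rw [quad_eq]; push_cast; rfl

/-- Real values of `R`. -/
theorem IsSqrtBranch.re_eq {K : Set ℂ} (hξ : 0 < ξ.im) (hR : IsSqrtBranch ξ K R) {p : ℝ}
    (hK : ∀ x : ℝ, (x : ℂ) ∈ K ↔ x = p) :
    (∀ x : ℝ, x < p → R x = (-√((x - ξ.re) ^ 2 + ξ.im ^ 2) : ℝ)) ∧
      ∀ x : ℝ, p < x → R x = (√((x - ξ.re) ^ 2 + ξ.im ^ 2) : ℝ) := by
  set S : ℝ → ℂ := fun x => ((√((x - ξ.re) ^ 2 + ξ.im ^ 2) : ℝ) : ℂ) with hS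
  have hSc : Continuous S := by fun_prop
  have hpos : ∀ x : ℝ, 0 < (x - ξ.re) ^ 2 + ξ.im ^ 2 := fun x => by positivity
  have hS0 : ∀ x, 0 < √((x - ξ.re) ^ 2 + ξ.im ^ 2) := fun x => Real.sqrt_pos.2 (hpos x)
  have hSne : ∀ x, S x ≠ 0 := fun x => ofReal_ne_zero.2 (hS0 x).ne'
  have hmem : ∀ x : ℝ, x ≠ p → (x : ℂ) ∈ Kᶜ := fun x hx h => hx ((hK x).1 h)
  have hsq : ∀ x : ℝ, x ≠ p → R x ^ 2 = S x ^ 2 := by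
    intro x hx
    rw [hR.sq _ (hmem x hx), quad_ofReal, hS, ← ofReal_pow, Real.sq_sqrt (hpos x).le]
  have hcont : ∀ {s : Set ℝ}, (∀ x ∈ s, x ≠ p) → ContinuousOn (fun x : ℝ => R x) s := fun hs =>
    hR.analytic.continuousOn.comp continuous_ofReal.continuousOn fun x hx => hmem x (hs x hx)
  -- The sign is constant on each of the two half-lines, and the behaviour at infinity selects it.
  have hlim : ∀ᶠ z in cobounded ℂ, 0 < (R z / z).re :=
    (continuous_re.tendsto 1).comp hR.infty |>.eventually (lt_mem_nhds (by simp))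
  constructor
  · intro x hx
    rcases isPreconnected_Iio.eq_or_eq_neg_of_sq_eq (S := Iio p)
      (hcont fun x hx => (ne_of_lt hx)) hSc.continuousOn (fun x hx => hsq x (ne_of_lt hx))
      (fun _ => hSne _) with h | h
    · exfalso
      have h1 : Tendsto (fun x : ℝ => (x : ℂ)) atBot (cobounded ℂ) := by
        rw [← tendsto_norm_atTop_iff_cobounded]
        simpa using tendsto_abs_atBot_atTop
      obtain ⟨y, hy, hyp, hy0⟩ := ((h1.eventually hlim).and
        ((eventually_lt_atBot p).and (eventually_lt_atBot 0))).exists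
      have h2 : R y = S y := h hyp
      rw [h2, hS, ← ofReal_div, ofReal_re] at hy
      exact absurd hy (not_lt.2 (div_nonpos_of_nonneg_of_nonpos (hS0 y).le hy0.le))
    · have := h hx
      simpa [hS] using this
  · intro x hx
    rcases isPreconnected_Ioi.eq_or_eq_neg_of_sq_eq (S := Ioi p)
      (hcont fun x hx => (ne_of_gt hx)) hSc.continuousOn (fun x hx => hsq x (ne_of_gt hx))
      (fun _ => hSne _) with h | h
    · exact h hx
    · exfalso
      have h1 : Tendsto (fun x : ℝ => (x : ℂ)) atTop (cobounded ℂ) := by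
        rw [← tendsto_norm_atTop_iff_cobounded]
        simpa using tendsto_abs_atTop_atTop
      obtain ⟨y, hy, hyp, hy0⟩ := ((h1.eventually hlim).and
        ((eventually_gt_atTop p).and (eventually_gt_atTop 0))).exists
      have h2 : R y = -S y := h hyp
      rw [h2, hS, ← ofReal_neg, ← ofReal_div, ofReal_re] at hy
      exact absurd hy (not_lt.2 (div_nonpos_of_nonpos_of_nonneg (by linarith [hS0 y]) hy0.le))

end GFun

namespace GFun

/-! ### Topology of the complement of the arc -/

theorem IsSimpleArc.reverse {c : ℝ → ℂ} {A B : ℂ} (hc : IsSimpleArc c A B) :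
    IsSimpleArc (fun u => c (1 - u)) B A where
  contDiff := hc.contDiff.comp (contDiff_const.sub contDiff_id)
  regular u hu := by
    rw [deriv_comp_const_sub, neg_ne_zero]
    exact hc.regular _ ⟨by linarith [hu.2], by linarith [hu.1]⟩
  inj u hu v hv h := by
    have := hc.inj (x₁ := 1 - u) (x₂ := 1 - v) ⟨by linarith [hu.2], by linarith [hu.1]⟩
      ⟨by linarith [hv.2], by linarith [hv.1]⟩ h
    linarith
  source := by simpa using hc.target
  target := by simpa using hc.source

theorem closedArc_reverse (c : ℝ → ℂ) : closedArc (fun u => c (1 - u)) = closedArc c := by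
  have h : (fun u : ℝ => 1 - u) '' Icc 0 1 = Icc 0 1 := by simp
  rw [closedArc, closedArc, ← h, image_image, h]
  simp

/-- A simple arc that is symmetric about the real axis crosses it exactly once. -/
theorem IsSimpleArc.exists_crossing {c : ℝ → ℂ} {ξ : ℂ} (hc : IsSimpleArc c (conj ξ) ξ)
    (hξ : 0 < ξ.im) (hsym : (fun z : ℂ => conj z) '' openArc c = openArc c) :
    ∃ u₀ ∈ Ioo (0 : ℝ) 1, (c u₀).im = 0 ∧ (∀ u ∈ Icc (0 : ℝ) 1, u < u₀ → (c u).im < 0) ∧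
      ∀ u ∈ Icc (0 : ℝ) 1, u₀ < u → 0 < (c u).im := by
  have hc0 := hc.contDiff.continuous
  have hex : ∀ u ∈ Icc (0 : ℝ) 1, ∃ v ∈ Icc (0 : ℝ) 1, c v = conj (c u) := by
    intro u hu
    rcases eq_or_lt_of_le hu.1 with h0 | h0
    · exact ⟨1, by simp, by rw [← h0, hc.source, hc.target]; simp⟩
    rcases eq_or_lt_of_le hu.2 with h1 | h1
    · exact ⟨0, by simp, by rw [h1, hc.source, hc.target]⟩
    have : conj (c u) ∈ openArc c := by
      rw [← hsym]
      exact ⟨c u, ⟨u, ⟨h0, h1⟩, rfl⟩, rfl⟩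
    obtain ⟨v, hv, hvu⟩ := this
    exact ⟨v, Ioo_subset_Icc_self hv, hvu⟩
  -- Reflection acts on the parameters as a continuous injection that exchanges `0` and `1`. It is
  -- therefore strictly decreasing, and its unique fixed point is the parameter of the crossing.
  choose! σ hσI hσ using hex
  have hσc : ContinuousOn σ (Icc 0 1) := by
    intro u hu s hs
    have h1 := hc.eventually_param (hσI u hu) hs
    rw [hσ u hu] at h1
    have h2 : Tendsto (fun u => conj (c u)) (𝓝[Icc 0 1] u) (𝓝 (conj (c u))) :=
      (continuous_conj.comp hc0).continuousAt.mono_left nhdsWithin_le_nhds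
    rw [mem_map]
    filter_upwards [h2.eventually h1, self_mem_nhdsWithin] with u' hu' hu'I
    exact hu' _ (hσI u' hu'I) (hσ u' hu'I)
  have hσi : InjOn σ (Icc 0 1) := by
    intro u hu v hv huv
    refine hc.inj hu hv ((starRingEnd ℂ).injective ?_)
    rw [← hσ u hu, ← hσ v hv, huv]
  have hσ0 : σ 0 = 1 := hc.inj (hσI 0 (by simp)) (by simp) (by
    rw [hσ 0 (by simp), hc.source, hc.target]; simp)
  have hσ1 : σ 1 = 0 := hc.inj (hσI 1 (by simp)) (by simp) (by
    rw [hσ 1 (by simp), hc.source, hc.target])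
  have hanti : StrictAntiOn σ (Icc 0 1) :=
    hσc.strictAntiOn_of_injOn_Icc zero_le_one (by rw [hσ0, hσ1]; simp) hσi
  obtain ⟨u₀, hu₀, hfix⟩ : ∃ u₀ ∈ Icc (0 : ℝ) 1, σ u₀ - u₀ = 0 := by
    have h := intermediate_value_Icc' (f := fun u => σ u - u) zero_le_one
      (hσc.sub continuousOn_id)
    obtain ⟨u₀, h1, h2⟩ := h (show (0 : ℝ) ∈ _ by simp [hσ0, hσ1])
    exact ⟨u₀, h1, h2⟩
  have hfix : σ u₀ = u₀ := by linarith
  have hne0 : u₀ ≠ 0 := by rintro rfl; rw [hσ0] at hfix; norm_num at hfix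
  have hne1 : u₀ ≠ 1 := by rintro rfl; rw [hσ1] at hfix; norm_num at hfix
  have huniq : ∀ u ∈ Icc (0 : ℝ) 1, (c u).im = 0 → u = u₀ := by
    intro u hu him
    have h1 : σ u = u := hc.inj (hσI u hu) hu (by rw [hσ u hu, conj_eq_iff_im.2 him])
    rcases lt_trichotomy u u₀ with h | h | h
    · have := hanti hu hu₀ h; linarith
    · exact h
    · have := hanti hu₀ hu h; linarith
  have himc : Continuous fun u => (c u).im := continuous_im.comp hc0
  refine ⟨u₀, ⟨lt_of_le_of_ne hu₀.1 hne0.symm, lt_of_le_of_ne hu₀.2 hne1⟩, ?_, ?_, ?_⟩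
  · have := hσ u₀ hu₀
    rw [hfix] at this
    exact conj_eq_iff_im.1 this.symm
  · intro u hu hlt
    by_contra! h
    obtain ⟨v, hv, hv0⟩ := intermediate_value_Icc hu.1 himc.continuousOn
      (show (0 : ℝ) ∈ Icc (c 0).im (c u).im by rw [hc.source, conj_im]; exact ⟨by linarith, h⟩)
    have := huniq v ⟨hv.1, hv.2.trans hu.2⟩ hv0
    linarith [hv.2]
  · intro u hu hlt
    by_contra! h
    obtain ⟨v, hv, hv0⟩ := intermediate_value_Icc hu.2 himc.continuousOn
      (show (0 : ℝ) ∈ Icc (c u).im (c 1).im by rw [hc.target]; exact ⟨h, hξ.le⟩)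
    have := huniq v ⟨hu.1.trans hv.1, hv.2⟩ hv0
    linarith [hv.1]

/-- A convex open set remains connected when the end piece of a simple arc inside it is removed. -/
theorem IsSimpleArc.isPreconnected_diff {c : ℝ → ℂ} {A B : ℂ} (hc : IsSimpleArc c A B)
    {H : Set ℂ} (hHo : IsOpen H) (hHc : Convex ℝ H) {α : ℝ} (hα : α ∈ Ico (0 : ℝ) 1)
    (hmem : ∀ u ∈ Icc (0 : ℝ) 1, c u ∈ H ↔ α < u) : IsPreconnected (H \ closedArc c) := by
  set Ω := H \ closedArc c with hΩ
  have hcont := continuous_normalMap hc.contDiff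
  have hIcc : ∀ {u}, u ∈ Ioc α 1 → u ∈ Icc (0 : ℝ) 1 := fun hu => ⟨hα.1.trans hu.1.le, hu.2⟩
  -- Connectedness is tested on a continuous Boolean function `χ`. It is constant along each side of
  -- the arc, and the two constants agree because the sides meet beyond the tip `c 1`.
  refine isPreconnected_of_forall_constant fun χ hχ => ?_
  have hloc : ∀ C : Set (ℝ × ℝ), Convex ℝ C → (∀ q ∈ C, ¬ (q.2 = 0 ∧ q.1 ∈ Icc (0 : ℝ) 1)) →
      ∀ u ∈ Ioc α 1, ∃ b, ∀ᶠ q in 𝓝 (u, (0 : ℝ)), q ∈ C → χ (normalMap c q) = b := by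
    intro C hC hCK u hu
    have h1 := hc.eventually_normalMap_notMem (hIcc hu)
    have h2 : ∀ᶠ q in 𝓝 (u, (0 : ℝ)), normalMap c q ∈ H := by
      refine hcont.continuousAt.eventually (hHo.mem_nhds ?_)
      rw [normalMap_zero]
      exact (hmem u (hIcc hu)).2 hu.1
    obtain ⟨δ, hδ, hball⟩ := Metric.eventually_nhds_iff_ball.1 (h1.and h2)
    have hpre : IsPreconnected (Metric.ball (u, (0 : ℝ)) δ ∩ C) :=
      ((convex_ball _ _).inter hC).isPreconnected
    have hmaps : MapsTo (normalMap c) (Metric.ball (u, (0 : ℝ)) δ ∩ C) Ω := fun q hq =>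
      ⟨(hball q hq.1).2, fun h => hCK q hq.2 ((hball q hq.1).1 h)⟩
    have hχc : ContinuousOn (χ ∘ normalMap c) (Metric.ball (u, (0 : ℝ)) δ ∩ C) :=
      hχ.comp hcont.continuousOn hmaps
    by_cases hne : (Metric.ball (u, (0 : ℝ)) δ ∩ C).Nonempty
    · obtain ⟨q₀, hq₀⟩ := hne
      refine ⟨χ (normalMap c q₀), ?_⟩
      filter_upwards [Metric.ball_mem_nhds _ hδ] with q hq hqC
      exact hpre.constant hχc ⟨hq, hqC⟩ hq₀
    · refine ⟨true, ?_⟩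
      filter_upwards [Metric.ball_mem_nhds _ hδ] with q hq hqC
      exact absurd ⟨q, hq, hqC⟩ hne
  have hside : ∀ s : Set ℝ, Convex ℝ s → (0 : ℝ) ∉ s → (𝓝[s] (0 : ℝ)).NeBot →
      ∃ b, ∀ u ∈ Ioc α 1, ∀ᶠ q in 𝓝 (u, (0 : ℝ)), q.2 ∈ s → χ (normalMap c q) = b := by
    intro s hs hs0 hne
    have hfreq : ∀ u : ℝ, ∃ᶠ q in 𝓝 (u, (0 : ℝ)), q.2 ∈ s := by
      intro u
      have h1 : ∃ᶠ x in 𝓝 (0 : ℝ), x ∈ s := by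
        rw [frequently_iff_neBot]; exact hne
      have h2 : Tendsto (fun x : ℝ => (u, x)) (𝓝 0) (𝓝 (u, 0)) :=
        (Continuous.prodMk_right u).tendsto 0
      exact h2.frequently h1
    have h := hloc (Prod.snd ⁻¹' s) (hs.linear_preimage (LinearMap.snd ℝ ℝ ℝ))
      (fun q hq hq0 => hs0 (hq0.1 ▸ hq))
    choose! β hβ using h
    have hβc : ContinuousOn β (Ioc α 1) := by
      intro u hu
      refine tendsto_nhds_of_eventually_eq ?_
      have h1 : Tendsto (fun v : ℝ => (v, (0 : ℝ))) (𝓝[Ioc α 1] u) (𝓝 (u, 0)) :=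
        ((Continuous.prodMk_left (0 : ℝ)).tendsto u).mono_left nhdsWithin_le_nhds
      filter_upwards [h1.eventually (hβ u hu).eventually_nhds, self_mem_nhdsWithin] with v hv hvI
      obtain ⟨q, hq, hq1, hq2⟩ := ((hfreq v).and_eventually (hv.and (hβ v hvI))).exists
      rw [← hq1 hq, ← hq2 hq]
    refine ⟨β 1, fun u hu => ?_⟩
    rw [isPreconnected_Ioc.constant hβc (show (1 : ℝ) ∈ Ioc α 1 from ⟨hα.2, le_rfl⟩) hu]
    exact hβ u hu
  obtain ⟨bp, hbp⟩ := hside (Ioi 0) (convex_Ioi 0) (by simp) inferInstance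
  obtain ⟨bm, hbm⟩ := hside (Iio 0) (convex_Iio 0) (by simp) inferInstance
  have h1mem : (1 : ℝ) ∈ Ioc α 1 := ⟨hα.2, le_rfl⟩
  -- Parameters larger than `1` continue the curve past its tip, where the transversal coordinate
  -- may have either sign.
  obtain ⟨be, hbe⟩ := hloc (Prod.fst ⁻¹' Ioi 1)
    ((convex_Ioi (1 : ℝ)).linear_preimage (LinearMap.fst ℝ ℝ ℝ))
    (fun q hq hq0 => not_lt.2 hq0.2.2 hq) 1 h1mem
  have hpick : ∀ s : Set ℝ, (𝓝[s] (0 : ℝ)).NeBot → ∀ {P : ℝ × ℝ → Prop},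
      (∀ᶠ q in 𝓝 ((1 : ℝ), (0 : ℝ)), P q) → ∃ q, P q ∧ 1 < q.1 ∧ q.2 ∈ s := by
    intro s hs P hP
    rw [nhds_prod_eq] at hP
    have hle : 𝓝[>] (1 : ℝ) ×ˢ 𝓝[s] (0 : ℝ) ≤ 𝓝 (1 : ℝ) ×ˢ 𝓝 (0 : ℝ) :=
      Filter.prod_mono nhdsWithin_le_nhds nhdsWithin_le_nhds
    have h2 : ∀ᶠ q in 𝓝[>] (1 : ℝ) ×ˢ 𝓝[s] (0 : ℝ), q ∈ Ioi (1 : ℝ) ×ˢ s :=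
      prod_mem_prod self_mem_nhdsWithin self_mem_nhdsWithin
    obtain ⟨q, hq1, hq2⟩ := ((hP.filter_mono hle).and h2).exists
    exact ⟨q, hq1, hq2.1, hq2.2⟩
  have hpe : bp = be := by
    obtain ⟨q, ⟨h1, h2⟩, h3, h4⟩ := hpick (Ioi 0) inferInstance ((hbp 1 h1mem).and hbe)
    rw [← h1 h4, h2 h3]
  have hme : bm = be := by
    obtain ⟨q, ⟨h1, h2⟩, h3, h4⟩ := hpick (Iio 0) inferInstance ((hbm 1 h1mem).and hbe)
    rw [← h1 h4, h2 h3]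
  have hnear : ∀ u ∈ Ioc α 1, ∀ᶠ z in 𝓝 (c u), z ∈ Ω → χ z = be := by
    intro u hu
    refine nhds_le_map_normalMap hc.contDiff (hc.regular u (hIcc hu)) ?_
    rw [mem_map]
    have hpos : ∀ᶠ q : ℝ × ℝ in 𝓝 (u, (0 : ℝ)), 0 ≤ q.1 :=
      continuousAt_fst (Ici_mem_nhds (hα.1.trans_lt hu.1))
    have hend : ∀ᶠ q in 𝓝 (u, (0 : ℝ)), 1 < q.1 → χ (normalMap c q) = be := by
      rcases eq_or_lt_of_le hu.2 with h | h
      · rw [h]; exact hbe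
      · have : ∀ᶠ q : ℝ × ℝ in 𝓝 (u, (0 : ℝ)), q.1 < 1 := continuousAt_fst (Iio_mem_nhds h)
        exact this.mono fun q hq hq1 => absurd hq (not_lt.2 hq1.le)
    filter_upwards [hbp u hu, hbm u hu, hend, hpos] with q h1 h2 h3 h4 hq
    rcases lt_trichotomy q.2 0 with h | h | h
    · exact (h2 h).trans hme
    · refine h3 ?_
      by_contra! hle
      refine hq.2 ⟨q.1, ⟨h4, hle⟩, ?_⟩
      rw [← normalMap_zero c, ← h]
    · exact (h1 h).trans hpe
  suffices h : ∀ z ∈ Ω, χ z = be from fun x hx y hy => (h x hx).trans (h y hy).symm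
  intro z hz
  -- The segment from `z` to the tip stays off the arc until it first hits it, and near that hit `χ`
  -- already has the value `be`.
  set s : ℝ → ℂ := fun τ => AffineMap.lineMap z (c 1) τ with hs
  have hsc : Continuous s := AffineMap.lineMap_continuous
  have hsH : ∀ τ ∈ Icc (0 : ℝ) 1, s τ ∈ H := fun τ hτ =>
    hHc.lineMap_mem hz.1 ((hmem 1 (by simp)).2 hα.2) hτ
  set T := Icc (0 : ℝ) 1 ∩ s ⁻¹' closedArc c with hT
  have hTcl : IsClosed T :=
    isClosed_Icc.inter ((closedArc_isCompact hc.contDiff.continuous).isClosed.preimage hsc)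
  have hTne : T.Nonempty := ⟨1, by simp, by simp only [mem_preimage, hs]; simp [hc.target_mem, hc.target]⟩
  have hTbdd : BddBelow T := ⟨0, fun τ hτ => hτ.1.1⟩
  set τ₀ := sInf T with hτ₀
  have hτ₀T : τ₀ ∈ T := hTcl.csInf_mem hTne hTbdd
  have hτ₀pos : 0 < τ₀ := by
    refine lt_of_le_of_ne hτ₀T.1.1 fun h => hz.2 ?_
    have := hτ₀T.2
    rw [← h] at this
    simpa [hs] using this
  have hbefore : MapsTo s (Ico 0 τ₀) Ω := by
    intro τ hτ
    have hτI : τ ∈ Icc (0 : ℝ) 1 := ⟨hτ.1, hτ.2.le.trans hτ₀T.1.2⟩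
    exact ⟨hsH τ hτI, fun h => not_lt.2 (csInf_le hTbdd ⟨hτI, h⟩) hτ.2⟩
  obtain ⟨v, hv, hvs⟩ := hτ₀T.2
  have hvα : v ∈ Ioc α 1 := ⟨(hmem v hv).1 (hvs ▸ hsH τ₀ hτ₀T.1), hv.2⟩
  have h1 : ∀ᶠ τ in 𝓝[<] τ₀, s τ ∈ Ω → χ (s τ) = be := by
    have := hnear v hvα
    rw [hvs] at this
    exact nhdsWithin_le_nhds (hsc.continuousAt.eventually this)
  have h2 : ∀ᶠ τ in 𝓝[<] τ₀, τ ∈ Ico 0 τ₀ := by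
    filter_upwards [Ioo_mem_nhdsLT hτ₀pos] with τ hτ using Ioo_subset_Ico_self hτ
  obtain ⟨τ, hτ1, hτ2⟩ := (h1.and h2).exists
  rw [← hτ1 (hbefore hτ2)]
  have h3 : ContinuousOn (χ ∘ s) (Ico 0 τ₀) := hχ.comp hsc.continuousOn hbefore
  have h4 := isPreconnected_Ico.constant h3 (show (0 : ℝ) ∈ Ico 0 τ₀ from ⟨le_rfl, hτ₀pos⟩) hτ2
  simpa [hs] using h4

theorem mem_leftRay {x : ℝ} {z : ℂ} : z ∈ leftRay x ↔ z.im = 0 ∧ z.re ≤ x := by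
  constructor
  · rintro ⟨r, hr, rfl⟩
    exact ⟨ofReal_im r, hr⟩
  · rintro ⟨h1, h2⟩
    exact ⟨z.re, h2, by apply Complex.ext <;> simp [h1]⟩

theorem isClosed_leftRay (x : ℝ) : IsClosed (leftRay x) := by
  have : leftRay x = {z : ℂ | z.im = 0} ∩ {z | z.re ≤ x} := by
    ext z; exact mem_leftRay
  rw [this]
  exact (isClosed_eq continuous_im continuous_const).inter
    (isClosed_le continuous_re continuous_const)

/-- Points of an open set are limits of points of the set above or below the real axis. -/
theorem mem_closure_halfPlane {Ω : Set ℂ} (hΩ : IsOpen Ω) {x : ℝ} (hx : (x : ℂ) ∈ Ω) (σ : ℝ)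
    (hσ : σ ≠ 0) : (x : ℂ) ∈ closure ({z | 0 < σ * z.im} ∩ Ω) := by
  have h1 : Tendsto (fun ε : ℝ => (x : ℂ) + ε * σ * I) (𝓝[>] 0) (𝓝 x) := by
    have : Continuous (fun ε : ℝ => (x : ℂ) + ε * σ * I) := by fun_prop
    have h2 := this.tendsto 0
    simp only [ofReal_zero, zero_mul, add_zero] at h2
    exact h2.mono_left nhdsWithin_le_nhds
  refine mem_closure_of_tendsto h1 ?_
  filter_upwards [h1.eventually (hΩ.mem_nhds hx), self_mem_nhdsWithin] with ε hε hε0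
  refine ⟨?_, hε⟩
  have hε0 : 0 < ε := hε0
  have : σ * (ε * σ) = ε * σ ^ 2 := by ring
  simp only [mem_ofPred_eq, add_im, ofReal_im, mul_im, ofReal_re, I_re, I_im, mul_zero, mul_one,
    zero_add, add_zero, zero_mul, sub_zero, mul_re]
  rw [this]
  positivity

/-- The domain of `g` is connected. -/
theorem IsSimpleArc.isPreconnected_compl_union_leftRay {c : ℝ → ℂ} {ξ : ℂ}
    (hc : IsSimpleArc c (conj ξ) ξ) {u₀ : ℝ} (hu₀ : u₀ ∈ Ioo (0 : ℝ) 1)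
    (him : (c u₀).im = 0)
    (hneg : ∀ u ∈ Icc (0 : ℝ) 1, u < u₀ → (c u).im < 0)
    (hpos : ∀ u ∈ Icc (0 : ℝ) 1, u₀ < u → 0 < (c u).im) :
    IsPreconnected (closedArc c ∪ leftRay (c u₀).re)ᶜ := by
  set p := (c u₀).re
  have hcu : c u₀ = p := by apply Complex.ext <;> simp [p, him]
  have hconv : ∀ σ : ℝ, Convex ℝ {z : ℂ | 0 < σ * z.im} ∧ IsOpen {z : ℂ | 0 < σ * z.im} := by
    intro σ
    refine ⟨?_, isOpen_lt continuous_const (by fun_prop)⟩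
    exact convex_halfSpace_gt (f := fun z : ℂ => σ * z.im)
      ⟨fun x y => by simp [mul_add], fun r x => by simp; ring⟩ 0
  have hup : IsPreconnected ({z : ℂ | 0 < (1 : ℝ) * z.im} \ closedArc c) := by
    refine hc.isPreconnected_diff (hconv 1).2 (hconv 1).1 (α := u₀) ⟨hu₀.1.le, hu₀.2⟩ ?_
    intro u hu
    simp only [mem_ofPred_eq, one_mul]
    refine ⟨fun h => ?_, hpos u hu⟩
    by_contra! hle
    rcases hle.eq_or_lt with h1 | h1
    · rw [h1, him] at h; exact lt_irrefl _ h
    · linarith [hneg u hu h1]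
  have hdown : IsPreconnected ({z : ℂ | 0 < (-1 : ℝ) * z.im} \ closedArc c) := by
    rw [← closedArc_reverse]
    refine hc.reverse.isPreconnected_diff (hconv (-1)).2 (hconv (-1)).1 (α := 1 - u₀)
      ⟨by linarith [hu₀.2], by linarith [hu₀.1]⟩ ?_
    intro u hu
    have hu' : 1 - u ∈ Icc (0 : ℝ) 1 := ⟨by linarith [hu.2], by linarith [hu.1]⟩
    simp only [mem_ofPred_eq, neg_mul, one_mul, neg_pos]
    refine ⟨fun h => ?_, fun h => hneg _ hu' (by linarith)⟩
    by_contra! hle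
    rcases hle.eq_or_lt with h1 | h1
    · rw [show 1 - u = u₀ by linarith, him] at h; exact lt_irrefl _ h
    · linarith [hpos _ hu' (show u₀ < 1 - u by linarith)]
  set P : Set ℂ := (fun r : ℝ => (r : ℂ)) '' Ioi p with hP
  have hreal : ∀ x : ℝ, (x : ℂ) ∈ closedArc c → x = p := by
    rintro x ⟨u, hu, hux⟩
    have h1 : (c u).im = 0 := by rw [hux]; simp
    have : u = u₀ := by
      rcases lt_trichotomy u u₀ with h | h | h
      · linarith [hneg u hu h]
      · exact h
      · linarith [hpos u hu h]
    rw [this, hcu] at hux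
    exact (ofReal_injective hux).symm
  have hPK : ∀ z ∈ P, z ∈ (closedArc c)ᶜ := by
    rintro z ⟨x, hx, rfl⟩ h
    exact (ne_of_gt hx) (hreal x h)
  have hadd : ∀ σ : ℝ, σ ≠ 0 → IsPreconnected ({z : ℂ | 0 < σ * z.im} \ closedArc c) →
      IsPreconnected (({z : ℂ | 0 < σ * z.im} \ closedArc c) ∪ P) := by
    intro σ hσ h
    refine h.subset_closure subset_union_left (union_subset subset_closure ?_)
    rintro z ⟨x, hx, rfl⟩
    exact mem_closure_halfPlane hc.isOpen_compl (hPK _ ⟨x, hx, rfl⟩) σ hσ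
  have hx : ((p + 1 : ℝ) : ℂ) ∈ P := ⟨p + 1, by simp, rfl⟩
  -- The two slit half planes are glued along the real half-line to the right of `p`, which lies in
  -- the closure of both.
  have := IsPreconnected.union _ (mem_union_right _ hx) (mem_union_right _ hx)
    (hadd 1 one_ne_zero hup) (hadd (-1) (by norm_num) hdown)
  convert this using 1
  ext z
  simp only [mem_compl_iff, mem_union, Set.mem_sdiff, mem_ofPred_eq, mem_leftRay, not_or, one_mul,
    neg_mul, neg_pos]
  constructor
  · rintro ⟨h1, h2⟩
    rcases lt_trichotomy z.im 0 with h | h | h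
    · exact Or.inr (Or.inl ⟨h, h1⟩)
    · refine Or.inl (Or.inr ⟨z.re, ?_, ?_⟩)
      · rw [mem_Ioi]; by_contra! h3; exact h2 ⟨h, h3⟩
      · apply Complex.ext <;> simp [h]
    · exact Or.inl (Or.inl ⟨h, h1⟩)
  · have hPc : z ∈ P → z ∉ closedArc c ∧ ¬(z.im = 0 ∧ z.re ≤ p) := by
      intro hz
      refine ⟨hPK z hz, ?_⟩
      obtain ⟨x, hx, rfl⟩ := hz
      simpa using hx
    rintro ((⟨h1, h2⟩ | h) | (⟨h1, h2⟩ | h))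
    · exact ⟨h2, fun h => h1.ne' h.1⟩
    · exact hPc h
    · exact ⟨h2, fun h => h1.ne h.1⟩
    · exact hPc h

/-! ### Joining points by curves -/

/-- `x` and `y` are joined in `Ω` by a `C¹` curve that is constant outside `[0, 1]`. -/
def SmoothJoined (Ω : Set ℂ) (x y : ℂ) : Prop :=
  ∃ γ : ℝ → ℂ, ContDiff ℝ 1 γ ∧ (∀ u ≤ 0, γ u = x) ∧ (∀ u, 1 ≤ u → γ u = y) ∧ ∀ u, γ u ∈ Ω

theorem SmoothJoined.trans {Ω : Set ℂ} {x y z : ℂ} (h₁ : SmoothJoined Ω x y)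
    (h₂ : SmoothJoined Ω y z) : SmoothJoined Ω x z := by
  obtain ⟨γ₁, hC₁, hl₁, hr₁, hm₁⟩ := h₁
  obtain ⟨γ₂, hC₂, hl₂, hr₂, hm₂⟩ := h₂
  have hfst : ∀ u : ℝ, u ≤ 1 / 2 → γ₁ (2 * u) + γ₂ (2 * u - 1) - y = γ₁ (2 * u) := by
    intro u hu; rw [hl₂ (2 * u - 1) (by linarith)]; ring
  have hsnd : ∀ u : ℝ, 1 / 2 ≤ u → γ₁ (2 * u) + γ₂ (2 * u - 1) - y = γ₂ (2 * u - 1) := by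
    intro u hu; rw [hr₁ (2 * u) (by linarith)]; ring
  -- Both curves are constant outside `[0, 1]`, so this sum runs through one and then the other and
  -- is visibly `C¹`.
  refine ⟨fun u => γ₁ (2 * u) + γ₂ (2 * u - 1) - y, ?_, ?_, ?_, ?_⟩
  · exact ((hC₁.comp (contDiff_const.mul contDiff_id)).add
      (hC₂.comp ((contDiff_const.mul contDiff_id).sub contDiff_const))).sub contDiff_const
  · intro u hu
    simp only
    rw [hfst u (by linarith), hl₁ _ (by linarith)]
  · intro u hu
    simp only
    rw [hsnd u (by linarith), hr₂ _ (by linarith)]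
  · intro u
    simp only
    rcases le_total u (1 / 2) with h | h
    · rw [hfst u h]; exact hm₁ _
    · rw [hsnd u h]; exact hm₂ _

theorem smoothJoined_of_convex {Ω : Set ℂ} (hΩ : Convex ℝ Ω) {x y : ℂ} (hx : x ∈ Ω) (hy : y ∈ Ω) :
    SmoothJoined Ω x y := by
  refine ⟨fun u => AffineMap.lineMap x y (Real.smoothTransition u), ?_, ?_, ?_, ?_⟩
  · simp only [AffineMap.lineMap_apply, vsub_eq_sub, vadd_eq_add]
    exact (Real.smoothTransition.contDiff.smul contDiff_const).add contDiff_const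
  · intro u hu; simp [Real.smoothTransition.zero_of_nonpos hu]
  · intro u hu; simp [Real.smoothTransition.one_of_one_le hu]
  · exact fun u => hΩ.lineMap_mem hx hy
      ⟨Real.smoothTransition.nonneg u, Real.smoothTransition.le_one u⟩

theorem SmoothJoined.mono {Ω Ω' : Set ℂ} (h : Ω ⊆ Ω') {x y : ℂ} (hj : SmoothJoined Ω x y) :
    SmoothJoined Ω' x y := by
  obtain ⟨γ, h1, h2, h3, h4⟩ := hj
  exact ⟨γ, h1, h2, h3, fun u => h (h4 u)⟩

/-- The set of points joined to `x` is open and relatively closed in `Ω`, because any two points of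
a ball are joined. -/
theorem smoothJoined_of_isPreconnected {Ω : Set ℂ} (hΩ : IsOpen Ω) (hpre : IsPreconnected Ω)
    {x y : ℂ} (hx : x ∈ Ω) (hy : y ∈ Ω) : SmoothJoined Ω x y := by
  set T := {y | y ∈ Ω ∧ SmoothJoined Ω x y} with hT
  have hball : ∀ z ∈ Ω, ∃ r > 0, Metric.ball z r ⊆ Ω ∧
      ∀ a ∈ Metric.ball z r, ∀ b ∈ Metric.ball z r, SmoothJoined Ω a b := by
    intro z hz
    obtain ⟨r, hr, hsub⟩ := Metric.isOpen_iff.1 hΩ z hz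
    exact ⟨r, hr, hsub, fun a ha b hb =>
      (smoothJoined_of_convex (convex_ball z r) ha hb).mono hsub⟩
  have hTo : IsOpen T := by
    rw [Metric.isOpen_iff]
    rintro z ⟨hz, hzT⟩
    obtain ⟨r, hr, hsub, hj⟩ := hball z hz
    exact ⟨r, hr, fun w hw => ⟨hsub hw, hzT.trans (hj z (Metric.mem_ball_self hr) w hw)⟩⟩
  refine (hpre.subset_of_closure_inter_subset hTo ⟨x, hx, hx, ?_⟩ ?_ hy).2
  · obtain ⟨r, hr, hsub, hj⟩ := hball x hx
    exact hj x (Metric.mem_ball_self hr) x (Metric.mem_ball_self hr)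
  · rintro z ⟨hzc, hz⟩
    obtain ⟨r, hr, hsub, hj⟩ := hball z hz
    obtain ⟨w, hw, hwT⟩ := mem_closure_iff_nhds.1 hzc _ (Metric.ball_mem_nhds z hr)
    exact ⟨hz, hwT.2.trans (hj w hw z (Metric.mem_ball_self hr))⟩

/-- The curve joins `z` to the real point `x₀` and then leaves along the real axis. -/
theorem exists_isCurveFromInfty {D : Set ℂ} (hD : IsOpen D) (hpre : IsPreconnected D) {x₀ : ℝ}
    (hx₀ : ∀ x : ℝ, x₀ ≤ x → (x : ℂ) ∈ D) {z : ℂ} (hz : z ∈ D) :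
    ∃ c, IsCurveFromInfty D c z := by
  obtain ⟨γ, h1, h2, h3, h4⟩ := smoothJoined_of_isPreconnected hD hpre hz (hx₀ x₀ le_rfl)
  -- Zero up to `1` and equal to `u - 1` from `2` on, so the two pieces join in a `C¹` way.
  set f : ℝ → ℝ := fun u => Real.smoothTransition (u - 1) * (u - 1) with hf
  have hfC : ContDiff ℝ 1 f :=
    (Real.smoothTransition.contDiff.comp (contDiff_id.sub contDiff_const)).mul
      (contDiff_id.sub contDiff_const)
  have hf0 : ∀ u ≤ 1, f u = 0 := fun u hu => by
    simp [hf, Real.smoothTransition.zero_of_nonpos (sub_nonpos.2 hu)]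
  refine ⟨fun u => γ u + f u, ?_, ?_, ?_, ?_⟩
  · exact h1.add (ofRealCLM.contDiff.comp hfC)
  · simp [h2 0 le_rfl, hf0 0 zero_le_one]
  · intro u hu
    rcases le_total u 1 with h | h
    · rw [hf0 u h]; simpa using h4 u
    · rw [h3 u h, ← ofReal_add]
      refine hx₀ _ (le_add_of_nonneg_right ?_)
      exact mul_nonneg (Real.smoothTransition.nonneg _) (by linarith)
  · rw [← tendsto_norm_atTop_iff_cobounded]
    have h5 : Tendsto (fun u : ℝ => u - 1 - ‖(x₀ : ℂ)‖) atTop atTop := by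
      have := tendsto_atTop_add_const_right atTop (-(1 + ‖(x₀ : ℂ)‖)) (tendsto_id (α := ℝ))
      refine this.congr fun u => ?_
      simp only [id]; ring
    refine tendsto_atTop_mono' _ ?_ h5
    filter_upwards [eventually_ge_atTop 2] with u hu
    rw [h3 u (by linarith), hf]
    simp only
    rw [Real.smoothTransition.one_of_one_le (by linarith), one_mul]
    have h6 := norm_sub_norm_le (((u - 1 : ℝ) : ℂ)) (-(x₀ : ℂ))
    rw [sub_neg_eq_add, norm_neg, norm_real, Real.norm_eq_abs, abs_of_nonneg (by linarith),
      add_comm] at h6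
    exact h6

/-- The starting point `A` need not lie in `D`; the given segment is the way to leave it. -/
theorem exists_isCurveFrom {D : Set ℂ} (hD : IsOpen D) (hpre : IsPreconnected D) {A k : ℂ}
    {τ : ℝ} (hτ : 0 < τ) (hk : ∀ s ∈ Ioc (0 : ℝ) τ, A + s * k ∈ D) {z : ℂ} (hz : z ∈ D) :
    ∃ c, IsCurveFrom D A c z := by
  obtain ⟨γ, h1, h2, h3, h4⟩ := smoothJoined_of_isPreconnected hD hpre
    (hk τ ⟨hτ, le_rfl⟩) hz
  set f : ℝ → ℝ := fun u => τ * Real.smoothTransition (2 * u) with hf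
  have hfC : ContDiff ℝ 1 f := contDiff_const.mul
    (Real.smoothTransition.contDiff.comp (contDiff_const.mul contDiff_id))
  refine ⟨fun u => A + f u * k + γ (2 * u - 1) - (A + τ * k), ?_, ?_, ?_, ?_⟩
  · exact ((contDiff_const.add ((ofRealCLM.contDiff.comp hfC).mul contDiff_const)).add
      (h1.comp ((contDiff_const.mul contDiff_id).sub contDiff_const))).sub contDiff_const
  · simp [hf, h2 (-1) (by norm_num)]
  · have : Real.smoothTransition 2 = 1 := Real.smoothTransition.one_of_one_le (by norm_num)
    norm_num [hf, h3 1 le_rfl, this]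
  · intro u hu
    rcases le_total u (1 / 2) with h | h
    · rw [h2 _ (by linarith), add_sub_cancel_right]
      refine hk _ ⟨mul_pos hτ (Real.smoothTransition.pos_of_pos (by linarith [hu.1])), ?_⟩
      exact mul_le_of_le_one_right hτ.le (Real.smoothTransition.le_one _)
    · have : f u = τ := by simp [hf, Real.smoothTransition.one_of_one_le (by linarith : 1 ≤ 2 * u)]
      rw [this, add_sub_cancel_left]
      exact h4 _

end GFun

namespace GFun

/-! ### The algebraic equation for `h` -/

theorem tendsto_const_div_cobounded (α : ℂ) : Tendsto (fun z : ℂ => α / z) (cobounded ℂ) (𝓝 0) := by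
  simpa [div_eq_mul_inv] using tendsto_inv₀_cobounded.const_mul α

theorem differentiable_dslope {f : ℂ → ℂ} (hf : Differentiable ℂ f) (α : ℂ) :
    Differentiable ℂ (dslope f α) := by
  rw [← differentiableOn_univ] at hf ⊢
  exact (Complex.differentiableOn_dslope univ_mem).2 hf

/-- An entire function of cubic growth with two known zeros. -/
theorem eq_mul_of_cubic_growth {f : ℂ → ℂ} (hf : Differentiable ℂ f) {α β L : ℂ} (hαβ : β ≠ α)
    (hα : f α = 0) (hβ : f β = 0) (hL : Tendsto (fun z => f z / z ^ 3) (cobounded ℂ) (𝓝 L)) :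
    ∃ q₀, ∀ z, f z = (z - α) * (z - β) * (q₀ + L * z) := by
  -- Difference quotients split off the two zeros and then the constant term. The last quotient `s`
  -- is entire and tends to `L` at infinity, hence is constant by Liouville.
  set q₁ := dslope f α
  have h1 : ∀ z, f z = (z - α) * q₁ z := fun z => by
    have := sub_smul_dslope f α z
    rw [hα, sub_zero, smul_eq_mul] at this
    exact this.symm
  have hq₁β : q₁ β = 0 := by
    have := h1 β
    rw [hβ] at this
    exact (mul_eq_zero.1 this.symm).resolve_left (sub_ne_zero.2 hαβ)
  set q₂ := dslope q₁ β
  have h2 : ∀ z, q₁ z = (z - β) * q₂ z := fun z => by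
    have := sub_smul_dslope q₁ β z
    rw [hq₁β, sub_zero, smul_eq_mul] at this
    exact this.symm
  set s := dslope q₂ 0
  have h3 : ∀ z, q₂ z = q₂ 0 + z * s z := fun z => by
    have := sub_smul_dslope q₂ 0 z
    rw [sub_zero, smul_eq_mul] at this
    linear_combination -this
  have hs : Differentiable ℂ s :=
    differentiable_dslope (differentiable_dslope (differentiable_dslope hf α) β) 0
  have hlin : ∀ α : ℂ, Tendsto (fun z : ℂ => 1 - α / z) (cobounded ℂ) (𝓝 1) := fun α => by
    simpa using (tendsto_const_div_cobounded α).const_sub 1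
  have hsL : Tendsto s (cobounded ℂ) (𝓝 L) := by
    have h4 : Tendsto (fun z => f z / z ^ 3 / ((1 - α / z) * (1 - β / z)) - q₂ 0 / z)
        (cobounded ℂ) (𝓝 L) := by
      simpa using (hL.div ((hlin α).mul (hlin β)) (by simp)).sub
        (tendsto_const_div_cobounded (q₂ 0))
    refine h4.congr' ?_
    filter_upwards [eventually_ne_cobounded (0 : ℂ), eventually_ne_cobounded α,
      eventually_ne_cobounded β] with z hz hzα hzβ
    have e1 : z - α ≠ 0 := sub_ne_zero.2 hzα
    have e2 : z - β ≠ 0 := sub_ne_zero.2 hzβ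
    rw [h1 z, h2 z, h3 z]
    field_simp
    ring
  rw [Metric.cobounded_eq_cocompact] at hsL
  have hsc : ∀ z, s z = L := fun z => hs.apply_eq_of_tendsto_cocompact z hsL
  refine ⟨q₂ 0, fun z => ?_⟩
  rw [h1 z, h2 z, h3 z, hsc z]
  ring

/-- The common denominator `z (z + t) (z + 1/t)`. -/
noncomputable def den (t : ℝ) (z : ℂ) : ℂ := z * (z + t) * (z + (t : ℂ)⁻¹)

/-- The numerator of `W'`. -/
noncomputable def numW (t γ a : ℝ) (z : ℂ) : ℂ :=
  -(γ * a * (z * (z + t))) - a * (z * (z + (t : ℂ)⁻¹)) + (a + 1) * ((z + t) * (z + (t : ℂ)⁻¹))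

theorem W'_mul_den {t γ a : ℝ} {z : ℂ} (hz : den t z ≠ 0) : W' t γ a z * den t z = numW t γ a z := by
  unfold den at *
  have h1 := (mul_ne_zero_iff.1 hz).2
  have h2 := (mul_ne_zero_iff.1 (mul_ne_zero_iff.1 hz).1).2
  have h3 := (mul_ne_zero_iff.1 (mul_ne_zero_iff.1 hz).1).1
  unfold W' numW
  set i := (t : ℂ)⁻¹
  field_simp

theorem den_eq_zero_iff {t : ℝ} {z : ℂ} : den t z = 0 ↔ z = 0 ∨ z = -t ∨ z = -(t : ℂ)⁻¹ := by
  unfold den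
  rw [mul_eq_zero, mul_eq_zero, add_eq_zero_iff_eq_neg, add_eq_zero_iff_eq_neg, or_assoc]

theorem mem_leftRay_of_den_eq_zero {t : ℝ} (ht : 0 < t) {z : ℂ} (hz : den t z = 0) :
    z ∈ leftRay 0 := by
  rw [mem_leftRay]
  rcases den_eq_zero_iff.1 hz with rfl | rfl | rfl
  · simp
  · simp [ht.le]
  · rw [← ofReal_inv]; simp [ht.le]

variable {t γ a : ℝ} {ξ : ℂ} {c₁ c₂ : ℝ → ℂ} {h : ℂ → ℂ} {hp hm : ℝ → ℂ}

theorem IsContourData.notMem_leftRay (hd : IsContourData t γ a ξ c₁ c₂ h hp hm) {z : ℂ}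
    (hz : z ∈ closedArc c₁) : z ∉ leftRay 0 := by
  obtain ⟨u, hu, rfl⟩ := hz
  intro hmem
  have him := (mem_leftRay.1 hmem).1
  rcases eq_or_lt_of_le hu.1 with h0 | h0
  · rw [← h0, hd.arc₁.source, conj_im] at him
    linarith [hd.im_pos]
  rcases eq_or_lt_of_le hu.2 with h1 | h1
  · rw [h1, hd.arc₁.target] at him
    linarith [hd.im_pos]
  · exact disjoint_left.1 hd.avoid₁ ⟨u, ⟨h0, h1⟩, rfl⟩ hmem

theorem IsContourData.den_ne_zero (hd : IsContourData t γ a ξ c₁ c₂ h hp hm) (ht : 0 < t) {z : ℂ}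
    (hz : z ∈ closedArc c₁) : den t z ≠ 0 := fun h0 =>
  hd.notMem_leftRay hz (mem_leftRay_of_den_eq_zero ht h0)

theorem IsContourData.compl_mem_cobounded (hd : IsContourData t γ a ξ c₁ c₂ h hp hm) :
    (closedArc c₁)ᶜ ∈ cobounded ℂ :=
  isBounded_def.1 (closedArc_isCompact hd.arc₁.contDiff.continuous).isBounded

/-- The function `h` is `(W' + Φ) / 2`, with denominators cleared. -/
theorem IsContourData.two_mul_h_mul_den (hd : IsContourData t γ a ξ c₁ c₂ h hp hm) (ht : 0 < t)
    (hγa : (1 + γ * a : ℂ) ≠ 0) {R : ℂ → ℂ} (hR : IsSqrtBranch ξ (closedArc c₁) R) {z : ℂ}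
    (hz : z ∈ (closedArc c₁)ᶜ) :
    2 * h z * den t z - numW t γ a z = R z * ((1 + γ * a) * (z + z0 γ a R)) := by
  obtain ⟨r, -, hr⟩ := hR.exists_boundary hd.arc₁ hd.im_pos
  -- Across the arc both `2h - W'` and `R` change sign, so their product does not jump; `den`
  -- removes the poles of `W'`.
  set F : ℂ → ℂ := fun z => (2 * h z * den t z - numW t γ a z) * R z with hF
  have hdenC : Continuous (den t) := by unfold den; fun_prop
  have hnumC : Continuous (numW t γ a) := by unfold numW; fun_prop
  have hFd : DifferentiableOn ℂ F (closedArc c₁)ᶜ := by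
    have h1 : DifferentiableOn ℂ h (closedArc c₁)ᶜ := hd.analytic.differentiableOn
    have h2 : DifferentiableOn ℂ R (closedArc c₁)ᶜ := hR.analytic.differentiableOn
    have h3 : Differentiable ℂ (den t) := by unfold den; fun_prop
    have h4 : Differentiable ℂ (numW t γ a) := by unfold numW; fun_prop
    exact (((h1.const_mul 2).mul h3.differentiableOn).sub h4.differentiableOn).mul h2
  have hlim : ∀ {l : Filter ℂ} {p w ρ : ℂ}, l ≤ 𝓝 p → Tendsto h l (𝓝 w) → Tendsto R l (𝓝 ρ) →
      Tendsto F l (𝓝 ((2 * w * den t p - numW t γ a p) * ρ)) := by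
    intro l p w ρ hl hw hρ
    exact (((hw.const_mul 2).mul ((hdenC.tendsto p).mono_left hl)).sub
      ((hnumC.tendsto p).mono_left hl)).mul hρ
  have hside : ∀ u ∈ Ioo (0 : ℝ) 1, ∃ w, Tendsto F (plusSide c₁ u) (𝓝 w) ∧
      Tendsto F (minusSide c₁ u) (𝓝 w) := by
    intro u hu
    have huI : u ∈ Icc (0 : ℝ) 1 := Ioo_subset_Icc_self hu
    obtain ⟨-, hr1, hr2⟩ := hr u hu
    have e1 := hlim ((hd.arc₁.plusSide_le huI).trans nhdsWithin_le_nhds) (hd.bdry_plus u hu) hr1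
    have e2 := hlim ((hd.arc₁.minusSide_le huI).trans nhdsWithin_le_nhds) (hd.bdry_minus u hu) hr2
    refine ⟨_, e1, ?_⟩
    convert e2 using 2
    have h1 := hd.sum u hu
    have h2 := W'_mul_den (γ := γ) (a := a) (hd.den_ne_zero ht (z := c₁ u) ⟨u, huI, rfl⟩)
    linear_combination 2 * r u * den t (c₁ u) * h1 + 2 * r u * h2
  obtain ⟨w₁, hw₁⟩ := hd.bdry_ξ
  obtain ⟨w₂, hw₂⟩ := hd.bdry_conj
  have hξ1 := hlim nhdsWithin_le_nhds hw₁ (hR.tendsto_zero (z := ξ) (by simp))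
  have hξ2 := hlim nhdsWithin_le_nhds hw₂ (hR.tendsto_zero (z := conj ξ) (by simp))
  rw [mul_zero] at hξ1 hξ2
  obtain ⟨f, hf, hfF, hfl⟩ := hd.arc₁.exists_entire_extension hFd hside ⟨_, hξ2⟩ ⟨_, hξ1⟩
  have hzero : ∀ p, Tendsto F (𝓝[(closedArc c₁)ᶜ] p) (𝓝 0) → f p = 0 := by
    intro p hp
    have := mem_closure_iff_nhdsWithin_neBot.1 (hd.arc₁.dense_compl p)
    exact tendsto_nhds_unique (hfl p) hp
  have hne : conj ξ ≠ ξ := fun h => hd.im_pos.ne' (conj_eq_iff_im.1 h)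
  -- At infinity `2 z h` tends to `2` and `numW / z²` to `1 - γ a`, whence the leading coefficient
  -- `1 + γ a`.
  have hgrowth : Tendsto (fun z => f z / z ^ 3) (cobounded ℂ) (𝓝 (1 + γ * a)) := by
    have hzh : Tendsto (fun z => z * h z) (cobounded ℂ) (𝓝 1) := by
      have e1 : (fun z => z * (h z - 1 / z)) =O[cobounded ℂ] (fun z : ℂ => z * (1 / z ^ 2)) :=
        (isBigO_refl _ _).mul hd.infty
      have e2 : Tendsto (fun z : ℂ => z * (1 / z ^ 2)) (cobounded ℂ) (𝓝 0) := by
        refine (tendsto_const_div_cobounded 1).congr' ?_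
        filter_upwards [eventually_ne_cobounded (0 : ℂ)] with z hz
        field_simp
      have e3 := (e1.trans_tendsto e2).add_const 1
      rw [zero_add] at e3
      refine e3.congr' ?_
      filter_upwards [eventually_ne_cobounded (0 : ℂ)] with z hz
      field_simp
      ring
    have hlin : ∀ α : ℂ, Tendsto (fun z : ℂ => 1 + α / z) (cobounded ℂ) (𝓝 1) := fun α => by
      simpa using (tendsto_const_div_cobounded α).const_add 1
    have e4 := ((((hzh.const_mul 2).mul ((hlin t).mul (hlin (t : ℂ)⁻¹))).sub
      ((((hlin t).const_mul (γ * a : ℂ)).neg.sub ((hlin (t : ℂ)⁻¹).const_mul (a : ℂ))).add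
        (((hlin t).mul (hlin (t : ℂ)⁻¹)).const_mul (a + 1 : ℂ))))).mul hR.infty
    have e5 : (2 * 1 * (1 * 1) - (-(γ * a * 1) - a * 1 + (a + 1) * (1 * 1)) : ℂ) * 1
        = 1 + γ * a := by ring
    rw [e5] at e4
    refine e4.congr' ?_
    filter_upwards [eventually_ne_cobounded (0 : ℂ), hd.compl_mem_cobounded] with z hz hzK
    rw [hfF hzK, hF]
    simp only [den, numW]
    set i := (t : ℂ)⁻¹
    field_simp
  obtain ⟨q₀, hq₀⟩ := eq_mul_of_cubic_growth hf hne (hzero _ hξ1) (hzero _ hξ2) hgrowth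
  have key : ∀ z ∈ (closedArc c₁)ᶜ,
      2 * h z * den t z - numW t γ a z = R z * (q₀ + (1 + γ * a) * z) := by
    intro z hz
    have hz1 : z ≠ ξ := fun h => hz (h ▸ hd.arc₁.target_mem)
    have hz2 : z ≠ conj ξ := fun h => hz (h ▸ hd.arc₁.source_mem)
    have hR2 := hR.sq z hz
    have hR0 : R z ≠ 0 := by
      intro h0
      rw [h0] at hR2
      exact mul_ne_zero (sub_ne_zero.2 hz1) (sub_ne_zero.2 hz2) (by simpa using hR2.symm)
    have h1 := hq₀ z
    rw [hfF hz, ← hR2] at h1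
    refine mul_right_cancel₀ hR0 ?_
    simp only [hF] at h1
    rw [h1]
    ring
  have h0K : (0 : ℂ) ∈ (closedArc c₁)ᶜ := fun h => hd.notMem_leftRay h (mem_leftRay.2 (by simp))
  have hR00 : R 0 ≠ 0 := by
    intro h0
    have := hR.sq 0 h0K
    rw [h0] at this
    have h1 : ξ = 0 ∨ conj ξ = 0 := by simpa using this
    have h2 : ξ = 0 := by simpa using h1
    have := hd.im_pos
    rw [h2] at this
    simp at this
  -- At `0` the factor `den` vanishes while `h` stays finite, which determines the remaining
  -- constant.
  have hq : q₀ = (1 + γ * a) * z0 γ a R := by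
    have h1 := key 0 h0K
    have htt : (t : ℂ) * (t : ℂ)⁻¹ = 1 := mul_inv_cancel₀ (ofReal_ne_zero.2 ht.ne')
    simp only [den, numW, zero_mul, zero_add, mul_zero, sub_zero, neg_zero, zero_sub, add_zero]
      at h1
    rw [htt] at h1
    unfold z0
    field_simp
    linear_combination -h1
  rw [key z hz, hq]
  ring

end GFun

namespace GFun

/-! ### The explicit formula for `g` -/

noncomputable section

/-- The inner Joukowski image of the real point `p`. -/
def nu (ξ : ℂ) (p : ℝ) : ℝ := p - ξ.re + √((p - ξ.re) ^ 2 + ξ.im ^ 2)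

/-- The outer Joukowski coordinate. -/
def outer (ξ : ℂ) (R : ℂ → ℂ) (z : ℂ) : ℂ := z - ξ.re + R z

/-- `g - log` in the Joukowski coordinate. -/
def logS (t γ a : ℝ) (ξ w : ℂ) : ℂ :=
  (a + 1) * log (1 - nu ξ 0 / w) - a * log (1 - nu ξ (-t) / w)
    - γ * a * log (1 - nu ξ (-t⁻¹) / w)

/-- The domain of `logS`. -/
def logDom (t : ℝ) (ξ : ℂ) : Set ℂ :=
  {w | w ≠ 0 ∧ 1 - nu ξ 0 / w ∈ slitPlane ∧ 1 - nu ξ (-t) / w ∈ slitPlane ∧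
    1 - nu ξ (-t⁻¹) / w ∈ slitPlane}

/-- `exp g` in the Joukowski coordinate. -/
def expG (t γ a : ℝ) (ξ w : ℂ) : ℂ := w / 2 * exp (logS t γ a ξ w)

/-- The logarithmic derivative of `expG`. -/
def dlogG (t γ a : ℝ) (ξ w : ℂ) : ℂ :=
  1 / w + ((a + 1) * (nu ξ 0 / (w * (w - nu ξ 0))) - a * (nu ξ (-t) / (w * (w - nu ξ (-t))))
    - γ * a * (nu ξ (-t⁻¹) / (w * (w - nu ξ (-t⁻¹)))))

theorem nu_pos {ξ : ℂ} (hξ : 0 < ξ.im) (p : ℝ) : 0 < nu ξ p := by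
  have h1 : |p - ξ.re| < √((p - ξ.re) ^ 2 + ξ.im ^ 2) := by
    refine Real.lt_sqrt_of_sq_lt ?_
    rw [sq_abs]
    have : 0 < ξ.im ^ 2 := by positivity
    linarith
  have := neg_abs_le (p - ξ.re)
  unfold nu
  linarith

/-- The Joukowski equation `w² - (Im ξ)² = 2 (z - Re ξ) w` at `z = p`, of which `nu ξ p` is the
positive root. -/
theorem nu_quad (ξ : ℂ) (p : ℝ) : nu ξ p ^ 2 - ξ.im ^ 2 = 2 * (p - ξ.re) * nu ξ p := by
  have := Real.sq_sqrt (show 0 ≤ (p - ξ.re) ^ 2 + ξ.im ^ 2 by positivity)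
  unfold nu
  linear_combination this

theorem hasDerivAt_log_one_sub_div {v w : ℂ} (hw : w ≠ 0) (h : 1 - v / w ∈ slitPlane) :
    HasDerivAt (fun w => log (1 - v / w)) (v / (w * (w - v))) w := by
  have h1 : HasDerivAt (fun w : ℂ => 1 - v / w) (v / w ^ 2) w := by
    have := ((hasDerivAt_inv hw).const_mul v).const_sub 1
    exact this.congr_deriv (by ring)
  refine (h1.clog h).congr_deriv ?_
  have h2 := slitPlane_ne_zero h
  have h3 : w - v ≠ 0 := by
    intro h0; apply h2; rw [← sub_eq_zero.1 h0, div_self hw, sub_self]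
  field_simp

theorem hasDerivAt_logS {t γ a : ℝ} {ξ w : ℂ} (hw : w ∈ logDom t ξ) :
    HasDerivAt (logS t γ a ξ) (dlogG t γ a ξ w - 1 / w) w := by
  obtain ⟨h0, h1, h2, h3⟩ := hw
  have := (((hasDerivAt_log_one_sub_div h0 h1).const_mul (a + 1 : ℂ)).sub
    ((hasDerivAt_log_one_sub_div h0 h2).const_mul (a : ℂ))).sub
    ((hasDerivAt_log_one_sub_div h0 h3).const_mul (γ * a : ℂ))
  exact this.congr_deriv (by unfold dlogG; ring)

theorem hasDerivAt_expG {t γ a : ℝ} {ξ w : ℂ} (hw : w ∈ logDom t ξ) :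
    HasDerivAt (expG t γ a ξ) (expG t γ a ξ w * dlogG t γ a ξ w) w := by
  have h0 : w ≠ 0 := hw.1
  refine (((hasDerivAt_id w).div_const 2).mul (hasDerivAt_logS (γ := γ) (a := a) hw).cexp).congr_deriv ?_
  unfold expG
  simp only [id]
  field_simp
  ring

/-- The two Joukowski coordinates multiply to `-b²`. -/
theorem outer_ne_zero {ξ z ρ : ℂ} (hξ : 0 < ξ.im) (hρ : ρ ^ 2 = (z - ξ) * (z - conj ξ)) :
    z - ξ.re + ρ ≠ 0 := by
  intro h
  rw [quad_eq] at hρ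
  have h1 : (ξ.im : ℂ) ^ 2 = 0 := by linear_combination (ρ - z + ξ.re) * h - hρ
  have h2 : (ξ.im : ℂ) = 0 := by simpa using h1
  exact hξ.ne' (ofReal_eq_zero.1 h2)

/-- The inverse Joukowski map: `z - Re ξ` and `ρ` are half the difference and half the sum of `ω`
and `(Im ξ)² / ω`. -/
theorem real_of_outer_real {ξ z ρ : ℂ} (hρ : ρ ^ 2 = (z - ξ) * (z - conj ξ)) {ω : ℝ} (hω : ω ≠ 0)
    (h : z - ξ.re + ρ = ω) :
    z = (ξ.re + (ω ^ 2 - ξ.im ^ 2) / (2 * ω) : ℝ) ∧ ρ = ((ω ^ 2 + ξ.im ^ 2) / (2 * ω) : ℝ) := by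
  rw [quad_eq] at hρ
  have hω' : (ω : ℂ) ≠ 0 := ofReal_ne_zero.2 hω
  have h1 : ρ = ω - z + ξ.re := by linear_combination h
  have h2 : z = (ξ.re + (ω ^ 2 - ξ.im ^ 2) / (2 * ω) : ℝ) := by
    push_cast
    field_simp
    rw [h1] at hρ
    linear_combination -hρ
  refine ⟨h2, ?_⟩
  rw [h1, h2]
  push_cast
  field_simp
  ring

/-- The value is on the cut only if `w = z - Re ξ + ρ` is real with `0 < w ≤ nu ξ q`. The real point
with coordinate `w` increases with `w` and is `q` at `nu ξ q`. So `z` would be real and at most `q <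
p`, with `ρ` positive, against `hsign`. -/
theorem one_sub_div_mem_slitPlane {ξ z ρ : ℂ} (hξ : 0 < ξ.im)
    (hρ : ρ ^ 2 = (z - ξ) * (z - conj ξ)) {p q : ℝ} (hqp : q < p)
    (hsign : z.im = 0 → z.re < p → ρ.re < 0) :
    1 - nu ξ q / (z - ξ.re + ρ) ∈ slitPlane := by
  by_contra hns
  rw [mem_slitPlane_iff, not_or, not_lt, not_not] at hns
  set w := z - ξ.re + ρ with hw
  have hw0 : w ≠ 0 := outer_ne_zero hξ hρ
  set s := (1 - nu ξ q / w).re with hs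
  have h1 : (1 - nu ξ q / w : ℂ) = s := by
    apply Complex.ext <;> simp [hs, hns.2]
  have hk : 0 < 1 - s := by linarith [hns.1]
  have hk' : (1 - s : ℂ) ≠ 0 := by exact_mod_cast hk.ne'
  have h2 : w = (nu ξ q / (1 - s) : ℝ) := by
    push_cast
    rw [eq_div_iff hk', ← h1]
    field_simp
    ring
  have hv := nu_pos hξ q
  set ω := nu ξ q / (1 - s) with hω
  have hω0 : 0 < ω := div_pos hv hk
  have hωv : ω ≤ nu ξ q := div_le_self hv.le (by linarith [hns.1])
  obtain ⟨e1, e2⟩ := real_of_outer_real hρ hω0.ne' h2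
  have hz : z.im = 0 := by rw [e1, ofReal_im]
  have hzq : z.re ≤ q := by
    rw [e1, ofReal_re]
    have h3 := nu_quad ξ q
    have h4 : (ω ^ 2 - ξ.im ^ 2) / (2 * ω) ≤ q - ξ.re := by
      rw [div_le_iff₀ (by positivity)]
      have h5 : 0 ≤ (nu ξ q - ω) * (ω * nu ξ q + ξ.im ^ 2) :=
        mul_nonneg (sub_nonneg.2 hωv) (by positivity)
      have h6 : 0 ≤ ((q - ξ.re) * (2 * ω) - (ω ^ 2 - ξ.im ^ 2)) * nu ξ q := by
        have : ((q - ξ.re) * (2 * ω) - (ω ^ 2 - ξ.im ^ 2)) * nu ξ q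
          = (nu ξ q - ω) * (ω * nu ξ q + ξ.im ^ 2) := by
          linear_combination (-ω) * h3
        rw [this]; exact h5
      have := nonneg_of_mul_nonneg_left h6 hv
      linarith
    linarith
  have h7 := hsign hz (by linarith)
  rw [e2, ofReal_re] at h7
  have : 0 < (ω ^ 2 + ξ.im ^ 2) / (2 * ω) := by positivity
  linarith

/-- A negative coordinate would force `z` to be real and `ρ` to be negative. -/
theorem outer_half_mem_slitPlane {ξ z ρ : ℂ} (hξ : 0 < ξ.im)
    (hρ : ρ ^ 2 = (z - ξ) * (z - conj ξ)) (hsign : z.im = 0 → 0 < ρ.re) :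
    (z - ξ.re + ρ) / 2 ∈ slitPlane := by
  by_contra hns
  rw [mem_slitPlane_iff, not_or, not_lt, not_not] at hns
  set w := z - ξ.re + ρ with hw
  have hw0 : w ≠ 0 := outer_ne_zero hξ hρ
  set s := (w / 2).re with hs
  have h1 : w / 2 = s := by apply Complex.ext <;> simp only [hs, hns.2, ofReal_re, ofReal_im]
  have h2 : w = (2 * s : ℝ) := by push_cast; rw [← h1]; ring
  have hs0 : 2 * s ≠ 0 := by
    intro h; rw [h] at h2; exact hw0 (by simpa using h2)
  have hneg : 2 * s < 0 := lt_of_le_of_ne (by linarith [hns.1]) hs0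
  obtain ⟨e1, e2⟩ := real_of_outer_real hρ hs0 h2
  have h7 := hsign (by rw [e1, ofReal_im])
  rw [e2, ofReal_re] at h7
  have : ((2 * s) ^ 2 + ξ.im ^ 2) / (2 * (2 * s)) < 0 :=
    div_neg_of_pos_of_neg (by positivity) (by linarith)
  linarith

theorem mem_logDom {t : ℝ} (ht : 0 < t) {ξ z ρ : ℂ} (hξ : 0 < ξ.im)
    (hρ : ρ ^ 2 = (z - ξ) * (z - conj ξ)) {p : ℝ} (hp : 0 < p)
    (hsign : z.im = 0 → z.re < p → ρ.re < 0) : z - ξ.re + ρ ∈ logDom t ξ := by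
  have hti : 0 < t⁻¹ := inv_pos.2 ht
  exact ⟨outer_ne_zero hξ hρ, one_sub_div_mem_slitPlane hξ hρ hp hsign,
    one_sub_div_mem_slitPlane hξ hρ (by linarith) hsign,
    one_sub_div_mem_slitPlane hξ hρ (by linarith) hsign⟩

/-! ### The logarithmic derivative of `exp g` as a function of `z` and the root. -/

/-- Lagrange interpolation of a cubic with prescribed residues. -/
theorem cubic_interpolation {A p₁ p₂ p₃ s₁ s₂ s₃ r₁ r₂ r₃ ζ m b : ℂ} (h12 : p₁ ≠ p₂) (h13 : p₁ ≠ p₃)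
    (h23 : p₂ ≠ p₃) (hr₁ : r₁ ^ 2 = (p₁ - m) ^ 2 + b) (hr₂ : r₂ ^ 2 = (p₂ - m) ^ 2 + b)
    (hr₃ : r₃ ^ 2 = (p₃ - m) ^ 2 + b)
    (h₁ : -(s₁ * ((p₁ - p₂) * (p₁ - p₃))) = r₁ * (A * (p₁ + ζ)))
    (h₂ : -(s₂ * ((p₂ - p₁) * (p₂ - p₃))) = r₂ * (A * (p₂ + ζ)))
    (h₃ : -(s₃ * ((p₃ - p₁) * (p₃ - p₂))) = r₃ * (A * (p₃ + ζ))) (z : ℂ) :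
    A * ((z - p₁) * (z - p₂) * (z - p₃)) - s₁ * r₁ * ((z - p₂) * (z - p₃))
      - s₂ * r₂ * ((z - p₁) * (z - p₃)) - s₃ * r₃ * ((z - p₁) * (z - p₂))
      = A * ((z - m) ^ 2 + b) * (z + ζ) := by
  have hD : (p₁ - p₂) * (p₁ - p₃) * (p₂ - p₃) ≠ 0 :=
    mul_ne_zero (mul_ne_zero (sub_ne_zero.2 h12) (sub_ne_zero.2 h13)) (sub_ne_zero.2 h23)
  -- Both sides are cubics with leading coefficient `A` that agree at the three nodes. The
  -- multipliers below are the Lagrange basis polynomials, cleared of denominators by `hD`.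
  refine mul_left_cancel₀ hD ?_
  linear_combination (p₂ - p₃) * (z - p₂) * (z - p₃) * (r₁ * h₁ + A * (p₁ + ζ) * hr₁)
    - (p₁ - p₃) * (z - p₁) * (z - p₃) * (r₂ * h₂ + A * (p₂ + ζ) * hr₂)
    + (p₁ - p₂) * (z - p₁) * (z - p₂) * (r₃ * h₃ + A * (p₃ + ζ) * hr₃)

/-- Turns a simple fraction in the Joukowski coordinate into one with denominator `2 (z - p)`, at
the price of a numerator that is linear in the root. -/
theorem inner_div_eq {m b z ρ p r : ℂ} (hρ : ρ ^ 2 = (z - m) ^ 2 + b) (hr : r ^ 2 = (p - m) ^ 2 + b)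
    (hz : z - p ≠ 0) (hw : z - m + ρ - (p - m - r) ≠ 0) :
    (p - m - r) / (z - m + ρ - (p - m - r)) = (ρ - r - (z - p)) / (2 * (z - p)) := by
  rw [div_eq_div_iff hw (mul_ne_zero two_ne_zero hz)]
  linear_combination -hρ + hr

/-- Relations between the constants that make `h` regular at the poles of `W'`. -/
structure ResidueRelations (t γ a : ℝ) (ξ ζ : ℂ) : Prop where
  at_zero : -numW t γ a 0 = (0 - ξ.re - nu ξ 0) * ((1 + γ * a) * (0 + ζ))
  at_neg : -numW t γ a (-t) = (-t - ξ.re - nu ξ (-t)) * ((1 + γ * a) * (-t + ζ))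
  at_neg_inv : -numW t γ a (-(t : ℂ)⁻¹)
    = (-(t : ℂ)⁻¹ - ξ.re - nu ξ (-t⁻¹)) * ((1 + γ * a) * (-(t : ℂ)⁻¹ + ζ))

/-- `p - Re ξ - nu ξ p` is minus the square root in `nu`, that is, the value of the branch at real
points left of the crossing. -/
theorem nu_root (ξ : ℂ) (p : ℝ) :
    ((p : ℂ) - ξ.re - nu ξ p) ^ 2 = (p - ξ.re) ^ 2 + (ξ.im : ℂ) ^ 2 := by
  have h : ((nu ξ p : ℝ) : ℂ) ^ 2 - (ξ.im : ℂ) ^ 2 = 2 * (p - ξ.re) * nu ξ p := by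
    exact_mod_cast congrArg (fun x : ℝ => (x : ℂ)) (nu_quad ξ p)
  linear_combination h

/-- The derivative of `log expG` with respect to `z`. -/
theorem dlogG_mul {t γ a : ℝ} (ht : 0 < t) (ht1 : t < 1) {ξ ζ : ℂ}
    (hres : ResidueRelations t γ a ξ ζ) {z ρ : ℂ} (hρ : ρ ^ 2 = (z - ξ) * (z - conj ξ))
    (hρ0 : ρ ≠ 0) (hden : den t z ≠ 0) (hw : z - ξ.re + ρ ∈ logDom t ξ) :
    2 * (dlogG t γ a ξ (z - ξ.re + ρ) * ((z - ξ.re + ρ) / ρ)) * den t z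
      = numW t γ a z + ρ * ((1 + γ * a) * (z + ζ)) := by
  -- Here `ρ` is either square root, so the identity serves for `R` off the arc and for both
  -- boundary values on it.
  rw [quad_eq] at hρ
  set m : ℂ := (ξ.re : ℂ)
  set b : ℂ := (ξ.im : ℂ) ^ 2
  set w := z - m + ρ with hwdef
  have hsub : ∀ {v : ℂ}, w ≠ 0 → 1 - v / w ∈ slitPlane → w - v ≠ 0 := by
    intro v h0 h h1
    apply slitPlane_ne_zero h
    rw [← sub_eq_zero.1 h1, div_self h0, sub_self]
  obtain ⟨hw0, hw1, hw2, hw3⟩ := hw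
  have n1 := hsub hw0 hw1
  have n2 := hsub hw0 hw2
  have n3 := hsub hw0 hw3
  have htc : (t : ℂ) ≠ 0 := ofReal_ne_zero.2 ht.ne'
  have d1 : z - 0 ≠ 0 := by
    intro h; exact hden (den_eq_zero_iff.2 (Or.inl (by simpa using h)))
  have d2 : z - -(t : ℂ) ≠ 0 := fun h => hden (den_eq_zero_iff.2 (Or.inr (Or.inl (sub_eq_zero.1 h))))
  have d3 : z - -(t : ℂ)⁻¹ ≠ 0 := fun h =>
    hden (den_eq_zero_iff.2 (Or.inr (Or.inr (sub_eq_zero.1 h))))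
  have r1 := nu_root ξ 0
  have r2 := nu_root ξ (-t)
  have r3 := nu_root ξ (-t⁻¹)
  push_cast at r1 r2 r3
  set v1 : ℂ := (nu ξ 0 : ℂ)
  set v2 : ℂ := (nu ξ (-t) : ℂ)
  set v3 : ℂ := (nu ξ (-t⁻¹) : ℂ)
  have e1 := inner_div_eq hρ r1 d1 (by convert n1 using 1; ring)
  have e2 := inner_div_eq hρ r2 d2 (by convert n2 using 1; ring)
  have e3 := inner_div_eq hρ r3 d3 (by convert n3 using 1; ring)
  rw [sub_sub_cancel, ← hwdef] at e1 e2 e3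
  have hti : (t : ℂ) * (t : ℂ)⁻¹ = 1 := mul_inv_cancel₀ htc
  have hne : (t : ℂ) ≠ (t : ℂ)⁻¹ := by
    intro h
    have h1 : (t : ℂ) * t = 1 := by nth_rw 2 [h]; exact hti
    have h2 : t * t = 1 := by exact_mod_cast h1
    nlinarith
  have hres1 := hres.at_zero
  have hres2 := hres.at_neg
  have hres3 := hres.at_neg_inv
  simp only [numW] at hres1 hres2 hres3
  set i := (t : ℂ)⁻¹ with hi
  have hi0 : i ≠ 0 := inv_ne_zero htc
  -- The nodes are the poles of `W'`, and `s₁`, `s₂`, `s₃` are its residues there.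
  have hint := cubic_interpolation (A := 1 + γ * a) (p₁ := 0) (p₂ := -t) (p₃ := -i)
    (s₁ := a + 1) (s₂ := -a) (s₃ := -(γ * a)) (ζ := ζ) (m := m) (b := b)
    (by simpa using htc) (by simpa using hi0)
    (by simpa using hne) r1 r2 r3 (by linear_combination hres1)
    (by linear_combination hres2) (by linear_combination hres3) z
  have hsplit : dlogG t γ a ξ w * (w / ρ) = (1 + ((a + 1) * (v1 / (w - v1)) - a * (v2 / (w - v2))
      - γ * a * (v3 / (w - v3)))) / ρ := by
    change (1 / w + ((a + 1) * (v1 / (w * (w - v1))) - a * (v2 / (w * (w - v2)))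
      - γ * a * (v3 / (w * (w - v3))))) * (w / ρ) = _
    field_simp
  rw [hsplit, e1, e2, e3]
  simp only [den, numW]
  rw [← hi]
  rw [sub_zero] at d1
  rw [sub_neg_eq_add] at d2 d3
  rw [← hρ] at hint
  simp only [sub_zero, sub_neg_eq_add] at hint ⊢
  field_simp
  linear_combination hint

end

end GFun

namespace GFun

/-! ### Analytic properties of `exp g` and `g` -/

/-- The hypotheses on the crossing point and on the root. -/
structure IsSetup (t γ a : ℝ) (ξ : ℂ) (c₁ c₂ : ℝ → ℂ) (h : ℂ → ℂ) (hp hm : ℝ → ℂ) (R : ℂ → ℂ)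
    (p : ℝ) : Prop where
  data : IsContourData t γ a ξ c₁ c₂ h hp hm
  t_pos : 0 < t
  t_lt : t < 1
  coeff : (1 + γ * a : ℂ) ≠ 0
  branch : IsSqrtBranch ξ (closedArc c₁) R
  p_pos : 0 < p
  crossing : ∀ x : ℝ, (x : ℂ) ∈ closedArc c₁ ↔ x = p

variable {t γ a : ℝ} {ξ : ℂ} {c₁ c₂ : ℝ → ℂ} {h : ℂ → ℂ} {hp hm : ℝ → ℂ} {R : ℂ → ℂ} {p : ℝ}

theorem IsSetup.root_eq (hs : IsSetup t γ a ξ c₁ c₂ h hp hm R p) {x : ℝ} (hx : x < p) :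
    R x = x - ξ.re - nu ξ x := by
  rw [(hs.branch.re_eq hs.data.im_pos hs.crossing).1 x hx]
  unfold nu
  push_cast
  ring

/-- All three poles of `W'` lie left of the crossing, where `h` is analytic; the term with `den`
therefore drops out of `IsContourData.two_mul_h_mul_den`. -/
theorem IsSetup.residueRelations (hs : IsSetup t γ a ξ c₁ c₂ h hp hm R p) :
    ResidueRelations t γ a ξ (z0 γ a R) := by
  have key : ∀ x : ℝ, x ≤ 0 → den t x = 0 →
      -numW t γ a x = (x - ξ.re - nu ξ x) * ((1 + γ * a) * (x + z0 γ a R)) := by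
    intro x hx hden
    have hxp : x < p := hx.trans_lt hs.p_pos
    have h1 := hs.data.two_mul_h_mul_den hs.t_pos hs.coeff hs.branch (z := x)
      fun hmem => hxp.ne ((hs.crossing x).1 hmem)
    rw [hden, hs.root_eq hxp, mul_zero, zero_sub] at h1
    exact h1
  have hti : 0 < t⁻¹ := inv_pos.2 hs.t_pos
  refine ⟨?_, ?_, ?_⟩
  · have := key 0 le_rfl (den_eq_zero_iff.2 (by simp))
    simpa using this
  · have := key (-t) (by linarith [hs.t_pos]) (den_eq_zero_iff.2 (by simp))
    simpa using this
  · have := key (-t⁻¹) (by linarith) (den_eq_zero_iff.2 (by simp))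
    simpa using this

theorem IsSetup.outer_mem (hs : IsSetup t γ a ξ c₁ c₂ h hp hm R p) {z : ℂ}
    (hz : z ∈ (closedArc c₁)ᶜ) : outer ξ R z ∈ logDom t ξ := by
  refine mem_logDom hs.t_pos hs.data.im_pos (hs.branch.sq z hz) hs.p_pos fun him hre => ?_
  have hzr : z = z.re := by apply Complex.ext <;> simp [him]
  rw [hzr, (hs.branch.re_eq hs.data.im_pos hs.crossing).1 _ hre, ofReal_re, neg_lt_zero]
  have := hs.data.im_pos
  exact Real.sqrt_pos.2 (by positivity)

theorem IsSetup.quad_ne_zero (hs : IsSetup t γ a ξ c₁ c₂ h hp hm R p) {z : ℂ}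
    (hz : z ∈ (closedArc c₁)ᶜ) : (z - ξ) * (z - conj ξ) ≠ 0 :=
  mul_ne_zero (sub_ne_zero.2 fun h => hz (h ▸ hs.data.arc₁.target_mem))
    (sub_ne_zero.2 fun h => hz (h ▸ hs.data.arc₁.source_mem))

theorem IsSetup.root_ne_zero (hs : IsSetup t γ a ξ c₁ c₂ h hp hm R p) {z : ℂ}
    (hz : z ∈ (closedArc c₁)ᶜ) : R z ≠ 0 := by
  intro h0
  have := hs.branch.sq z hz
  rw [h0] at this
  exact hs.quad_ne_zero hz (by simpa using this.symm)

/-- Differentiating `R² = (z - Re ξ)² + (Im ξ)²` gives `R' = (z - Re ξ) / R`, and adding `1` gives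
`outer / R`. -/
theorem IsSetup.hasDerivAt_outer (hs : IsSetup t γ a ξ c₁ c₂ h hp hm R p) {z : ℂ}
    (hz : z ∈ (closedArc c₁)ᶜ) : HasDerivAt (outer ξ R) (outer ξ R z / R z) z := by
  have hR0 := hs.root_ne_zero hz
  have hRd := (hs.branch.analytic z hz).differentiableAt.hasDerivAt
  have h1 : HasDerivAt (fun z => R z ^ 2) (2 * R z * deriv R z) z :=
    (hRd.pow 2).congr_deriv (by simp)
  have h2 : HasDerivAt (fun z => (z - ξ.re) ^ 2 + (ξ.im : ℂ) ^ 2) (2 * (z - ξ.re)) z :=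
    ((((hasDerivAt_id z).sub_const (ξ.re : ℂ)).pow 2).add_const _).congr_deriv (by simp)
  have h3 : (fun z => R z ^ 2) =ᶠ[𝓝 z] fun z => (z - ξ.re) ^ 2 + (ξ.im : ℂ) ^ 2 := by
    filter_upwards [hs.data.arc₁.isOpen_compl.mem_nhds hz] with w hw
    rw [hs.branch.sq w hw, quad_eq]
  have h4 := h1.unique (h2.congr_of_eventuallyEq h3)
  refine (((hasDerivAt_id z).sub_const (ξ.re : ℂ)).add hRd).congr_deriv ?_
  unfold outer
  field_simp
  linear_combination h4 / 2

/-- The link between the explicit formula and the data: the logarithmic derivative of the candidate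
for `exp g` is `h`. -/
theorem IsSetup.dlogG_outer (hs : IsSetup t γ a ξ c₁ c₂ h hp hm R p) {z : ℂ}
    (hz : z ∈ (closedArc c₁)ᶜ) (hden : den t z ≠ 0) :
    dlogG t γ a ξ (outer ξ R z) * (outer ξ R z / R z) = h z := by
  have h1 := dlogG_mul hs.t_pos hs.t_lt hs.residueRelations (hs.branch.sq z hz)
    (hs.root_ne_zero hz) hden (hs.outer_mem hz)
  have h2 := hs.data.two_mul_h_mul_den hs.t_pos hs.coeff hs.branch hz
  change 2 * (dlogG t γ a ξ (outer ξ R z) * (outer ξ R z / R z)) * den t z = _ at h1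
  refine mul_right_cancel₀ hden (mul_left_cancel₀ (two_ne_zero (α := ℂ)) ?_)
  linear_combination h1 - h2

theorem IsSetup.differentiableAt_expG (hs : IsSetup t γ a ξ c₁ c₂ h hp hm R p) {z : ℂ}
    (hz : z ∈ (closedArc c₁)ᶜ) : DifferentiableAt ℂ (fun z => expG t γ a ξ (outer ξ R z)) z :=
  (HasDerivAt.comp z (hasDerivAt_expG (hs.outer_mem hz)) (hs.hasDerivAt_outer hz)).differentiableAt

theorem IsSetup.hasDerivAt_expG (hs : IsSetup t γ a ξ c₁ c₂ h hp hm R p) {z : ℂ}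
    (hz : z ∈ (closedArc c₁)ᶜ) (hden : den t z ≠ 0) :
    HasDerivAt (fun z => expG t γ a ξ (outer ξ R z)) (expG t γ a ξ (outer ξ R z) * h z) z := by
  refine (HasDerivAt.comp z (GFun.hasDerivAt_expG (hs.outer_mem hz))
    (hs.hasDerivAt_outer hz)).congr_deriv ?_
  rw [mul_assoc, hs.dlogG_outer hz hden]

/-- The function `g`. -/
noncomputable def gFun (t γ a : ℝ) (ξ : ℂ) (R : ℂ → ℂ) (z : ℂ) : ℂ :=
  log (outer ξ R z / 2) + logS t γ a ξ (outer ξ R z)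

theorem exp_log_add_logS {w : ℂ} (hw : w ≠ 0) :
    exp (log (w / 2) + logS t γ a ξ w) = expG t γ a ξ w := by
  rw [exp_add, exp_log (div_ne_zero hw two_ne_zero)]
  rfl

theorem IsSetup.outer_half_mem (hs : IsSetup t γ a ξ c₁ c₂ h hp hm R p) {z : ℂ}
    (hz : z ∈ (closedArc c₁ ∪ leftRay p)ᶜ) : outer ξ R z / 2 ∈ slitPlane := by
  rw [mem_compl_iff, mem_union, not_or, mem_leftRay] at hz
  refine outer_half_mem_slitPlane hs.data.im_pos (hs.branch.sq z hz.1) fun him => ?_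
  have hre : p < z.re := by
    by_contra! hle; exact hz.2 ⟨him, hle⟩
  have hzr : z = z.re := by apply Complex.ext <;> simp [him]
  rw [hzr, (hs.branch.re_eq hs.data.im_pos hs.crossing).2 _ hre, ofReal_re]
  have := hs.data.im_pos
  exact Real.sqrt_pos.2 (by positivity)

theorem IsSetup.mem_slitPlane (hs : IsSetup t γ a ξ c₁ c₂ h hp hm R p) {z : ℂ}
    (hz : z ∈ (closedArc c₁ ∪ leftRay p)ᶜ) : z ∈ slitPlane := by
  rw [mem_compl_iff, mem_union, not_or, mem_leftRay] at hz
  rw [mem_slitPlane_iff]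
  by_contra! hcon
  exact hz.2 ⟨hcon.2, hcon.1.trans hs.p_pos.le⟩

theorem den_ne_zero_of_mem_slitPlane (ht : 0 < t) {z : ℂ} (hz : z ∈ slitPlane) :
    den t z ≠ 0 := by
  intro h0
  obtain ⟨h1, h2⟩ := mem_leftRay.1 (mem_leftRay_of_den_eq_zero ht h0)
  rcases mem_slitPlane_iff.1 hz with h | h
  · linarith
  · exact h h1

theorem IsSetup.hasDerivAt_gFun (hs : IsSetup t γ a ξ c₁ c₂ h hp hm R p) {z : ℂ}
    (hz : z ∈ (closedArc c₁ ∪ leftRay p)ᶜ) : HasDerivAt (gFun t γ a ξ R) (h z) z := by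
  have hzK : z ∈ (closedArc c₁)ᶜ := fun h => hz (Or.inl h)
  have h1 := hs.hasDerivAt_outer hzK
  have h2 := (h1.div_const 2).clog (hs.outer_half_mem hz)
  have h3 := HasDerivAt.comp z (hasDerivAt_logS (γ := γ) (a := a) (hs.outer_mem hzK)) h1
  refine (h2.add h3).congr_deriv ?_
  rw [← hs.dlogG_outer hzK (den_ne_zero_of_mem_slitPlane hs.t_pos (hs.mem_slitPlane hz))]
  have h4 := hs.root_ne_zero hzK
  have h5 := (hs.outer_mem hzK).1
  field_simp
  ring

/-! ### Behaviour at infinity -/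

theorem IsSetup.tendsto_outer_div (hs : IsSetup t γ a ξ c₁ c₂ h hp hm R p) :
    Tendsto (fun z => outer ξ R z / 2 / z) (cobounded ℂ) (𝓝 1) := by
  have h1 := (((tendsto_const_div_cobounded (ξ.re : ℂ)).const_sub 1).add hs.branch.infty).div_const 2
  norm_num at h1
  refine h1.congr' ?_
  filter_upwards [eventually_ne_cobounded (0 : ℂ)] with z hz
  unfold outer
  field_simp

theorem IsSetup.tendsto_outer (hs : IsSetup t γ a ξ c₁ c₂ h hp hm R p) :
    Tendsto (outer ξ R) (cobounded ℂ) (cobounded ℂ) := by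
  rw [← tendsto_norm_atTop_iff_cobounded]
  have h1 := (hs.tendsto_outer_div.norm).const_mul 2
  have h2 := h1.pos_mul_atTop (by simp) tendsto_norm_cobounded_atTop
  refine h2.congr' ?_
  filter_upwards [eventually_ne_cobounded (0 : ℂ)] with z hz
  have hz' : ‖z‖ ≠ 0 := norm_ne_zero_iff.2 hz
  rw [norm_div, norm_div, norm_ofNat]
  field_simp

theorem tendsto_logS_cobounded : Tendsto (logS t γ a ξ) (cobounded ℂ) (𝓝 0) := by
  have h1 : ∀ v : ℂ, Tendsto (fun w => log (1 - v / w)) (cobounded ℂ) (𝓝 0) := fun v => by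
    have h2 : Tendsto (fun w : ℂ => 1 - v / w) (cobounded ℂ) (𝓝 1) := by
      simpa using (tendsto_const_div_cobounded v).const_sub 1
    have h3 := h2.clog one_mem_slitPlane
    rwa [log_one] at h3
  have := (((h1 (nu ξ 0)).const_mul (a + 1 : ℂ)).sub ((h1 (nu ξ (-t))).const_mul (a : ℂ))).sub
    ((h1 (nu ξ (-t⁻¹))).const_mul (γ * a : ℂ))
  simp only [mul_zero, sub_zero] at this
  exact this

theorem IsSetup.tendsto_expG_div (hs : IsSetup t γ a ξ c₁ c₂ h hp hm R p) :
    Tendsto (fun z => expG t γ a ξ (outer ξ R z) / z) (cobounded ℂ) (𝓝 1) := by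
  have h1 := (continuous_exp.tendsto 0).comp
    ((tendsto_logS_cobounded (t := t) (γ := γ) (a := a) (ξ := ξ)).comp hs.tendsto_outer)
  have h2 := hs.tendsto_outer_div.mul h1
  rw [exp_zero, mul_one] at h2
  refine h2.congr fun z => ?_
  simp only [Function.comp, expG]
  ring

/-- A function that is analytic near `∞` with value `1` there is `1 + O(1/z)`. -/
theorem isBigO_inv_of_tendsto_one {f : ℂ → ℂ} (hd : ∀ᶠ z in cobounded ℂ, DifferentiableAt ℂ f z)
    (hf : Tendsto f (cobounded ℂ) (𝓝 1)) :
    (fun z => f z - 1) =O[cobounded ℂ] (fun z => 1 / z) := by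
  -- In the variable `1/z` the point at infinity becomes a removable singularity, and
  -- differentiability there is the required bound.
  set F : ℂ → ℂ := Function.update (fun w => f w⁻¹) 0 1 with hF
  have h1 : Tendsto (fun w : ℂ => w⁻¹) (𝓝[≠] 0) (cobounded ℂ) := tendsto_inv₀_nhdsNE_zero
  have hFd : ∀ᶠ w in 𝓝[≠] (0 : ℂ), DifferentiableAt ℂ F w := by
    filter_upwards [h1.eventually hd, self_mem_nhdsWithin] with w hw hw0
    have hw0 : w ≠ 0 := hw0
    have h2 : DifferentiableAt ℂ (fun w => f w⁻¹) w := DifferentiableAt.comp w hw (differentiableAt_inv hw0)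
    refine h2.congr_of_eventuallyEq ?_
    filter_upwards [isOpen_ne.mem_nhds hw0] with v hv
    rw [hF, Function.update_of_ne hv]
  have hFc : ContinuousAt F 0 := by
    rw [hF, continuousAt_update_same]
    exact hf.comp h1
  have hF0 := (analyticAt_of_differentiable_on_punctured_nhds_of_continuousAt hFd hFc).differentiableAt
  have h3 := hF0.isBigO_sub
  have h4 : Tendsto (fun z : ℂ => z⁻¹) (cobounded ℂ) (𝓝 0) := tendsto_inv₀_cobounded
  refine (h3.comp_tendsto h4).congr' ?_ ?_
  · filter_upwards [eventually_ne_cobounded (0 : ℂ)] with z hz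
    simp [hF, Function.update_of_ne (inv_ne_zero hz)]
  · exact Eventually.of_forall fun z => by simp

/-- Take imaginary parts in `|w|² w - (Im ξ)² conj w = 2 |w|² (z - Re ξ)`. The coordinate thus
preserves the sign of the imaginary part, which rules out a `2πi` when logarithms of `w / 2` and `z`
are compared. -/
theorem outer_im {z ρ : ℂ} (hξ : 0 < ξ.im) (hρ : ρ ^ 2 = (z - ξ) * (z - conj ξ)) :
    ∃ k : ℝ, 0 < k ∧ (z - ξ.re + ρ).im = k * z.im := by
  have hw := outer_ne_zero hξ hρ
  rw [quad_eq] at hρ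
  set w := z - ξ.re + ρ with hwd
  have h1 : w ^ 2 - (ξ.im : ℂ) ^ 2 = 2 * (z - ξ.re) * w := by
    rw [hwd]; linear_combination hρ
  have hn : 0 < normSq w := normSq_pos.2 hw
  have h2 : (normSq w : ℂ) * w - ((ξ.im ^ 2 : ℝ) : ℂ) * conj w
      = ((2 * normSq w : ℝ) : ℂ) * (z - (ξ.re : ℝ)) := by
    push_cast
    rw [normSq_eq_conj_mul_self]
    linear_combination conj w * h1
  have h3 := congrArg Complex.im h2
  rw [sub_im, im_ofReal_mul, im_ofReal_mul, im_ofReal_mul, conj_im, sub_im, ofReal_im] at h3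
  refine ⟨2 * normSq w / (normSq w + ξ.im ^ 2), by positivity, ?_⟩
  field_simp
  linear_combination h3

/-- Both arguments lie in `[0, π)` or both in `(-π, 0)`, so their difference stays in the principal
range. -/
theorem log_sub_log_of_im {x y : ℂ} (hx : x ∈ slitPlane) (hy : y ∈ slitPlane) {k : ℝ} (hk : 0 < k)
    (hxy : x.im = k * y.im) : log x - log y = log (x / y) := by
  have hx0 := slitPlane_ne_zero hx
  have hy0 := slitPlane_ne_zero hy
  have hxπ := (mem_slitPlane_iff_arg.1 hx).1
  have hyπ := (mem_slitPlane_iff_arg.1 hy).1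
  rw [div_eq_mul_inv, (log_mul_eq_add_log_iff hx0 (inv_ne_zero hy0)).2 ?_, log_inv _ hyπ,
    sub_eq_add_neg]
  rw [arg_inv, if_neg hyπ]
  have bx := arg_le_pi x
  have hyu := arg_le_pi y
  have cx := neg_pi_lt_arg x
  have cy := neg_pi_lt_arg y
  have bx' := lt_of_le_of_ne bx hxπ
  have hyl' := lt_of_le_of_ne hyu hyπ
  rcases le_or_gt 0 y.im with h0 | h0
  · have h1 : 0 ≤ x.im := by rw [hxy]; positivity
    have h2 := arg_nonneg_iff.2 h0
    have h3 := arg_nonneg_iff.2 h1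
    constructor <;> linarith
  · have h1 : x.im < 0 := by rw [hxy]; exact mul_neg_of_pos_of_neg hk h0
    have h2 := arg_neg_iff.2 h0
    have h3 := arg_neg_iff.2 h1
    constructor <;> linarith

/-- This normalisation fixes the constant of integration when `gFun - log` is compared with the
integral from infinity. -/
theorem IsSetup.tendsto_gFun_sub_log (hs : IsSetup t γ a ξ c₁ c₂ h hp hm R p) :
    Tendsto (fun z => gFun t γ a ξ R z - log z)
      (cobounded ℂ ⊓ 𝓟 (closedArc c₁ ∪ leftRay p)ᶜ) (𝓝 0) := by
  have h1 := (hs.tendsto_outer_div.clog one_mem_slitPlane).add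
    ((tendsto_logS_cobounded (t := t) (γ := γ) (a := a) (ξ := ξ)).comp hs.tendsto_outer)
  rw [log_one, add_zero] at h1
  refine (h1.mono_left inf_le_left).congr' ?_
  filter_upwards [mem_inf_of_right (mem_principal_self _)] with z hz
  have hzK : z ∈ (closedArc c₁)ᶜ := fun h => hz (Or.inl h)
  obtain ⟨k, hk, him⟩ := outer_im hs.data.im_pos (hs.branch.sq z hzK)
  have h2 : (outer ξ R z / 2).im = k / 2 * z.im := by
    rw [show outer ξ R z / 2 = ((1 / 2 : ℝ) : ℂ) * outer ξ R z by push_cast; ring, im_ofReal_mul,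
      show (outer ξ R z).im = _ from him]
    ring
  rw [← log_sub_log_of_im (hs.outer_half_mem hz) (hs.mem_slitPlane hz) (half_pos hk) h2]
  simp only [Function.comp, gFun]
  ring

/-- `g - log` is the integral of `h - 1/z` from infinity. -/
theorem IsSetup.tendsto_contourIntegral (hs : IsSetup t γ a ξ c₁ c₂ h hp hm R p) {z : ℂ}
    {c : ℝ → ℂ} (hc : IsCurveFromInfty (closedArc c₁ ∪ leftRay p)ᶜ c z) :
    Tendsto (fun T : ℝ => contourIntegral (fun s => h s - 1 / s) c T 0) atTop
      (𝓝 (gFun t γ a ξ R z - log z)) := by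
  set D := (closedArc c₁ ∪ leftRay p)ᶜ
  have h1 : Tendsto c atTop (cobounded ℂ ⊓ 𝓟 D) := by
    refine tendsto_inf.2 ⟨hc.infty, tendsto_principal.2 ?_⟩
    filter_upwards [eventually_ge_atTop 0] with u hu using hc.mem u hu
  have h2 := (hs.tendsto_gFun_sub_log.comp h1).const_sub (gFun t γ a ξ R z - log z)
  rw [sub_zero] at h2
  refine h2.congr' ?_
  filter_upwards [eventually_ge_atTop 0] with T hT
  have hsub : ∀ u ∈ uIcc T 0, 0 ≤ u := fun u hu => by
    rw [uIcc_of_ge hT] at hu; exact hu.1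
  have hd : ∀ u ∈ uIcc T 0, HasDerivAt (fun u => gFun t γ a ξ R (c u) - log (c u))
      ((h (c u) - 1 / c u) * deriv c u) u := by
    intro u hu
    have hm := hc.mem u (hsub u hu)
    have h3 := (hs.hasDerivAt_gFun hm).sub (hasDerivAt_log (hs.mem_slitPlane hm))
    have h4 := (hc.contDiff.differentiable (by simp) u).hasDerivAt
    refine (HasDerivAt.comp_of_eq u h3 h4 rfl).congr_deriv ?_
    rw [one_div]
  have hcont : ContinuousOn (fun u => (h (c u) - 1 / c u) * deriv c u) (uIcc T 0) := by
    have hc0 := hc.contDiff.continuous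
    have hc1 : Continuous (deriv c) := hc.contDiff.continuous_deriv le_rfl
    have h5 : ContinuousOn (fun u => h (c u)) (uIcc T 0) :=
      hs.data.analytic.continuousOn.comp hc0.continuousOn fun u hu hmem =>
        hc.mem u (hsub u hu) (Or.inl hmem)
    refine (h5.sub (continuousOn_const.div hc0.continuousOn fun u hu => ?_)).mul hc1.continuousOn
    exact slitPlane_ne_zero (hs.mem_slitPlane (hc.mem u (hsub u hu)))
  rw [contourIntegral, intervalIntegral.integral_eq_sub_of_hasDerivAt hd hcont.intervalIntegrable,
    hc.target]
  rfl

/-! ### Boundary values -/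

/-- On the arc the sign condition of `mem_logDom` is vacuous, since the only real point is `p`
itself; hence both roots are admissible. -/
theorem IsSetup.boundary_mem (hs : IsSetup t γ a ξ c₁ c₂ h hp hm R p) {z ρ : ℂ}
    (hz : z ∈ closedArc c₁) (hρ : ρ ^ 2 = (z - ξ) * (z - conj ξ)) :
    z - ξ.re + ρ ∈ logDom t ξ := by
  refine mem_logDom hs.t_pos hs.data.im_pos hρ hs.p_pos fun him hre => ?_
  have hzr : z = z.re := by apply Complex.ext <;> simp [him]
  rw [hzr] at hz
  exact absurd ((hs.crossing _).1 hz) hre.ne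

theorem boundary_half_mem {z ρ : ℂ} (hξ : 0 < ξ.im) (hz : z.im ≠ 0)
    (hρ : ρ ^ 2 = (z - ξ) * (z - conj ξ)) : (z - ξ.re + ρ) / 2 ∈ slitPlane :=
  outer_half_mem_slitPlane hξ hρ fun him => absurd him hz

theorem tendsto_outer_of_tendsto {l : Filter ℂ} {z ρ : ℂ} (hl : l ≤ 𝓝 z) (hR : Tendsto R l (𝓝 ρ)) :
    Tendsto (outer ξ R) l (𝓝 (z - ξ.re + ρ)) :=
  (Tendsto.sub_const hl _).add hR

theorem tendsto_expG {l : Filter ℂ} {w : ℂ} (hw : w ∈ logDom t ξ)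
    (hl : Tendsto (outer ξ R) l (𝓝 w)) :
    Tendsto (fun z => expG t γ a ξ (outer ξ R z)) l (𝓝 (expG t γ a ξ w)) :=
  (hasDerivAt_expG hw).continuousAt.tendsto.comp hl

theorem tendsto_gFun {l : Filter ℂ} {w : ℂ} (hw : w ∈ logDom t ξ) (hw2 : w / 2 ∈ slitPlane)
    (hl : Tendsto (outer ξ R) l (𝓝 w)) :
    Tendsto (gFun t γ a ξ R) l (𝓝 (log (w / 2) + logS t γ a ξ w)) :=
  ((hl.div_const 2).clog hw2).add ((hasDerivAt_logS hw).continuousAt.tendsto.comp hl)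

/-- The derivative of a continuous square root. -/
theorem hasDerivAt_of_sq {f q : ℝ → ℂ} {q' : ℂ} {u : ℝ} (hf : ContinuousAt f u)
    (hfq : ∀ᶠ v in 𝓝 u, f v ^ 2 = q v) (hq : HasDerivAt q q' u) (hfu : f u ≠ 0) :
    HasDerivAt f (q' / (2 * f u)) u := by
  rw [hasDerivAt_iff_tendsto_slope] at hq ⊢
  have h1 : Tendsto (fun v => f v + f u) (𝓝[≠] u) (𝓝 (2 * f u)) := by
    have := (show Tendsto f (𝓝[≠] u) (𝓝 (f u)) from
      hf.tendsto.mono_left nhdsWithin_le_nhds).add_const (f u)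
    rwa [← two_mul] at this
  have h2 : 2 * f u ≠ 0 := mul_ne_zero two_ne_zero hfu
  refine (hq.div h1 h2).congr' ?_
  filter_upwards [nhdsWithin_le_nhds hfq, h1.eventually_ne h2] with v hv hv2
  simp only [Pi.div_apply]
  rw [slope_def_module, slope_def_module, ← hv, ← hfq.self_of_nhds, real_smul, real_smul]
  field_simp
  ring

/-- The product of the two boundary values of `exp g` is `exp (W + ℓ)`. -/
theorem IsSetup.expG_mul_expG (hs : IsSetup t γ a ξ c₁ c₂ h hp hm R p) {r : ℝ → ℂ}
    (hrc : ContinuousOn r (Ioo 0 1))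
    (hr2 : ∀ u ∈ Ioo (0 : ℝ) 1, r u ^ 2 = (c₁ u - ξ) * (c₁ u - conj ξ)) {u : ℝ}
    (hu : u ∈ Ioo (0 : ℝ) 1) :
    expG t γ a ξ (c₁ u - ξ.re + r u) * expG t γ a ξ (c₁ u - ξ.re + -r u)
      * exp (-W t γ a (c₁ u)) = expG t γ a ξ (ξ - ξ.re) ^ 2 * exp (-W t γ a ξ) := by
  set J : ℝ → ℂ := fun u => expG t γ a ξ (c₁ u - ξ.re + r u) *
    expG t γ a ξ (c₁ u - ξ.re + -r u) * exp (-W t γ a (c₁ u)) with hJ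
  have hc0 := hs.data.arc₁.contDiff.continuous
  have hslit : ∀ v ∈ Icc (0 : ℝ) 1, c₁ v ∈ slitPlane := by
    intro v hv
    rw [mem_slitPlane_iff]
    by_contra! hcon
    exact hs.data.notMem_leftRay ⟨v, hv, rfl⟩ (mem_leftRay.2 ⟨hcon.2, hcon.1⟩)
  -- The logarithmic derivatives belonging to `r` and `-r` add up to `W'`, because the terms
  -- containing the root cancel.
  have hder : ∀ v ∈ Ioo (0 : ℝ) 1, HasDerivAt J 0 v := by
    intro v hv
    have hvI := Ioo_subset_Icc_self hv
    have hmem : c₁ v ∈ closedArc c₁ := ⟨v, hvI, rfl⟩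
    have hden := hs.data.den_ne_zero hs.t_pos hmem
    have hrv := hr2 v hv
    have hr0 : r v ≠ 0 := by
      intro h0
      rw [h0] at hrv
      exact GFun.quad_ne_zero hs.data.arc₁ hv (by simpa using hrv.symm)
    have hrv' : (-r v) ^ 2 = (c₁ v - ξ) * (c₁ v - conj ξ) := by rw [neg_sq, hrv]
    have hcd := (hs.data.arc₁.contDiff.differentiable (by simp) v).hasDerivAt
    have hq : HasDerivAt (fun v => (c₁ v - ξ.re) ^ 2 + (ξ.im : ℂ) ^ 2)
        (2 * (c₁ v - ξ.re) * deriv c₁ v) v :=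
      (((hcd.sub_const (ξ.re : ℂ)).pow 2).add_const _).congr_deriv (by simp)
    have hrd := hasDerivAt_of_sq (hrc.continuousAt (isOpen_Ioo.mem_nhds hv))
      (Filter.Eventually.mono (isOpen_Ioo.mem_nhds hv) fun w (hw : w ∈ Ioo (0 : ℝ) 1) => by
        rw [hr2 w hw, quad_eq]) hq hr0
    have hwp := hs.boundary_mem hmem hrv
    have hwm := hs.boundary_mem hmem hrv'
    have hEp := HasDerivAt.comp_of_eq v (GFun.hasDerivAt_expG (γ := γ) (a := a) hwp)
      ((hcd.sub_const (ξ.re : ℂ)).add hrd) rfl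
    have hEm := HasDerivAt.comp_of_eq v (GFun.hasDerivAt_expG (γ := γ) (a := a) hwm)
      ((hcd.sub_const (ξ.re : ℂ)).add hrd.neg) rfl
    have hW := (HasDerivAt.comp_of_eq v (hasDerivAt_W (γ := γ) (a := a) hs.t_pos (hslit v hvI)) hcd
      rfl).neg.cexp
    have hfin := (hEp.mul hEm).mul hW
    refine hfin.congr_deriv ?_
    have e1 := dlogG_mul hs.t_pos hs.t_lt hs.residueRelations hrv hr0 hden hwp
    have e2 := dlogG_mul hs.t_pos hs.t_lt hs.residueRelations hrv' (neg_ne_zero.2 hr0) hden hwm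
    have e3 := W'_mul_den (γ := γ) (a := a) hden
    simp only [Function.comp, Pi.neg_apply, Pi.mul_apply, Pi.add_apply]
    set wp := c₁ v - ξ.re + r v with hwpd
    set wm := c₁ v - ξ.re + -r v with hwmd
    set dp := dlogG t γ a ξ wp
    set dm := dlogG t γ a ξ wm
    have hkey : dp * (wp / r v) + dm * (wm / -r v) = W' t γ a (c₁ v) := by
      refine mul_right_cancel₀ hden (mul_left_cancel₀ (two_ne_zero (α := ℂ)) ?_)
      linear_combination e1 + e2 - 2 * e3
    have hp' : deriv c₁ v + 2 * (c₁ v - ξ.re) * deriv c₁ v / (2 * r v)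
        = deriv c₁ v * (wp / r v) := by rw [hwpd]; field_simp; ring
    have hm' : deriv c₁ v + -(2 * (c₁ v - ξ.re) * deriv c₁ v / (2 * r v))
        = deriv c₁ v * (wm / -r v) := by rw [hwmd]; field_simp; ring
    rw [hp', hm']
    linear_combination expG t γ a ξ wp * expG t γ a ξ wm * exp (-W t γ a (c₁ v)) * deriv c₁ v * hkey
  have hconst : ∀ v ∈ Ioo (0 : ℝ) 1, J v = J u := fun v hv =>
    isOpen_Ioo.is_const_of_deriv_eq_zero isPreconnected_Ioo
      (fun w hw => (hder w hw).differentiableAt.differentiableWithinAt)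
      (fun w hw => (hder w hw).deriv) hv hu
  -- The constant is read off at `ξ`, where `r` tends to `0` and both coordinates tend to `ξ - Re
  -- ξ`.
  have hmem1 : ∀ᶠ v in 𝓝[<] (1 : ℝ), v ∈ Ioo (0 : ℝ) 1 := Ioo_mem_nhdsLT zero_lt_one
  have hc1 : Tendsto c₁ (𝓝[<] 1) (𝓝 ξ) := by
    have := hc0.tendsto 1
    rw [hs.data.arc₁.target] at this
    exact this.mono_left nhdsWithin_le_nhds
  have hr1 : Tendsto r (𝓝[<] 1) (𝓝 0) := by
    have h1 : Tendsto (fun v => ‖(c₁ v - ξ) * (c₁ v - conj ξ)‖) (𝓝[<] 1) (𝓝 0) := by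
      have := ((hc1.sub_const ξ).mul (hc1.sub_const (conj ξ))).norm
      simpa using this
    have h2 : Tendsto (fun v => √(‖r v‖ ^ 2)) (𝓝[<] 1) (𝓝 0) := by
      rw [← Real.sqrt_zero]
      refine (Real.continuous_sqrt.tendsto 0).comp (h1.congr' ?_)
      filter_upwards [hmem1] with v hv
      rw [← hr2 v hv, norm_pow]
    refine tendsto_zero_iff_norm_tendsto_zero.2 (h2.congr fun v => ?_)
    exact Real.sqrt_sq (norm_nonneg _)
  have hξm : ξ - ξ.re ∈ logDom t ξ := by
    have := hs.boundary_mem hs.data.arc₁.target_mem (ρ := 0) (by simp)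
    rwa [add_zero] at this
  have hEc := (GFun.hasDerivAt_expG (γ := γ) (a := a) hξm).continuousAt.tendsto
  have hξs : ξ ∈ slitPlane := by
    have := hslit 1 (by simp)
    rwa [hs.data.arc₁.target] at this
  have hWc := (hasDerivAt_W (γ := γ) (a := a) hs.t_pos hξs).continuousAt.tendsto
  have l1 : Tendsto (fun v => c₁ v - ξ.re + r v) (𝓝[<] 1) (𝓝 (ξ - ξ.re)) := by
    simpa using (hc1.sub_const (ξ.re : ℂ)).add hr1
  have l2 : Tendsto (fun v => c₁ v - ξ.re + -r v) (𝓝[<] 1) (𝓝 (ξ - ξ.re)) := by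
    simpa using (hc1.sub_const (ξ.re : ℂ)).add hr1.neg
  have hlim := ((hEc.comp l1).mul (hEc.comp l2)).mul (hWc.comp hc1).neg.cexp
  rw [← sq] at hlim
  have hlim2 : Tendsto J (𝓝[<] 1) (𝓝 (J u)) := by
    refine tendsto_const_nhds.congr' ?_
    filter_upwards [hmem1] with v hv using (hconst v hv).symm
  exact tendsto_nhds_unique hlim2 hlim

/-! ### The function `exp (2 g - W - ℓ)` -/

/-- `exp (-W)`, as a function that is analytic also across `(-1/t, -t)`. -/
noncomputable def expNegW (t γ a : ℝ) (z : ℂ) : ℂ :=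
  exp (γ * a * log (1 + t * z) + a * log (1 + t / z)) / z

theorem exp_neg_W {z : ℂ} (hz : z ≠ 0) : exp (-W t γ a z) = expNegW t γ a z := by
  unfold W expNegW
  rw [show -(-((γ : ℂ) * a * log (1 + t * z)) - a * log (1 + t / z) + log z)
    = (γ * a * log (1 + t * z) + a * log (1 + t / z)) - log z by ring, exp_sub, exp_log hz]

/-- The complement of the cuts of `exp (-W)`. -/
def cutPlane (t : ℝ) : Set ℂ := {z | z.im = 0 → (-t⁻¹ < z.re ∧ z.re < -t) ∨ 0 < z.re}

theorem den_ne_zero_of_mem_cutPlane (ht : 0 < t) {z : ℂ} (hz : z ∈ cutPlane t) : den t z ≠ 0 := by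
  have hti : 0 < t⁻¹ := inv_pos.2 ht
  intro h0
  rcases den_eq_zero_iff.1 h0 with rfl | rfl | rfl
  · rcases hz (by simp) with h | h
    · have := h.2; simp at this; linarith
    · simp at h
  · rcases hz (by simp) with h | h
    · have := h.2; simp at this
    · simp at h; linarith
  · rw [← ofReal_inv] at hz
    rcases hz (by simp) with h | h
    · have := h.1; simp at this
    · simp at h; linarith

/-- On `cutPlane t` the two remaining logarithms are off their cuts; the third has become the factor
`1/z`. -/
theorem hasDerivAt_expNegW (ht : 0 < t) {z : ℂ} (hz : z ∈ cutPlane t) :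
    HasDerivAt (expNegW t γ a) (-W' t γ a z * expNegW t γ a z) z := by
  have hti : 0 < t⁻¹ := inv_pos.2 ht
  have hden := den_ne_zero_of_mem_cutPlane ht hz
  unfold den at hden
  have n3 : z + (t : ℂ)⁻¹ ≠ 0 := (mul_ne_zero_iff.1 hden).2
  have n4 : z + (t : ℂ) ≠ 0 := (mul_ne_zero_iff.1 (mul_ne_zero_iff.1 hden).1).2
  have hz0 : z ≠ 0 := (mul_ne_zero_iff.1 (mul_ne_zero_iff.1 hden).1).1
  have htc : (t : ℂ) ≠ 0 := by exact_mod_cast ht.ne'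
  have hn : 0 < normSq z := normSq_pos.2 hz0
  have hreal : z.im = 0 → z = z.re := fun him => by apply Complex.ext <;> simp [him]
  have h1 : (1 + t * z : ℂ) ∈ slitPlane := by
    rw [mem_slitPlane_iff]
    by_cases him : z.im = 0
    · left
      have : 0 < 1 + t * z.re := by
        rcases hz him with h | h
        · have := mul_lt_mul_of_pos_left h.1 ht
          rw [mul_neg, mul_inv_cancel₀ ht.ne'] at this
          linarith
        · positivity
      simpa using this
    · right; simp [ht.ne', him]
  have h2 : (1 + t / z : ℂ) ∈ slitPlane := by
    rw [mem_slitPlane_iff]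
    by_cases him : z.im = 0
    · left
      have : 0 < 1 + t / z.re := by
        rcases hz him with h | h
        · have h0 : z.re < 0 := by linarith [h.2]
          have : t / z.re > -1 := by
            rw [gt_iff_lt, lt_div_iff_of_neg h0]; linarith [h.2]
          linarith
        · positivity
      rw [hreal him, ← ofReal_div, add_re, one_re, ofReal_re]
      exact this
    · right; simp [Complex.div_im, ht.ne', him, hn.ne']
  have n1 := slitPlane_ne_zero h1
  have n2 := slitPlane_ne_zero h2
  have d1 : HasDerivAt (fun z : ℂ => 1 + t * z) (t : ℂ) z := by
    simpa using ((hasDerivAt_id z).const_mul (t : ℂ)).const_add 1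
  have d2 : HasDerivAt (fun z : ℂ => 1 + t / z) (-(t : ℂ) / z ^ 2) z := by
    have := ((hasDerivAt_inv hz0).const_mul (t : ℂ)).const_add 1
    exact this.congr_deriv (by ring)
  have := ((((d1.clog h1).const_mul ((γ : ℂ) * a)).add
    ((d2.clog h2).const_mul (a : ℂ))).cexp).div (hasDerivAt_id z) hz0
  refine this.congr_deriv ?_
  have e1 : (t : ℂ) / (1 + t * z) = 1 / (z + (t : ℂ)⁻¹) := by
    rw [div_eq_div_iff n1 n3, mul_add, mul_inv_cancel₀ htc]; ring
  have e2 : -(t : ℂ) / z ^ 2 / (1 + t / z) = 1 / (z + t) - 1 / z := by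
    have : (1 + t / z : ℂ) = (z + t) / z := by field_simp
    rw [this]; field_simp; ring
  simp only [Pi.add_apply, id]
  rw [e1, e2]
  unfold W' expNegW
  set X := exp (γ * a * log (1 + t * z) + a * log (1 + t / z))
  set i := (t : ℂ)⁻¹
  field_simp
  ring

/-- The left side does not involve `R`, so every admissible root gives the same `Φ` off the arc. -/
theorem IsSetup.two_mul_h_sub (hs : IsSetup t γ a ξ c₁ c₂ h hp hm R p) {z : ℂ}
    (hz : z ∈ (closedArc c₁)ᶜ) (hden : den t z ≠ 0) : 2 * h z - W' t γ a z = Φ t γ a R z := by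
  have h1 := hs.data.two_mul_h_mul_den hs.t_pos hs.coeff hs.branch hz
  have h2 := W'_mul_den (γ := γ) (a := a) hden
  have h3 : Φ t γ a R z * den t z = R z * ((1 + γ * a) * (z + z0 γ a R)) := by
    unfold Φ
    change (1 + γ * a) * (R z * (z + z0 γ a R) / den t z) * den t z = _
    field_simp
  refine mul_right_cancel₀ hden ?_
  linear_combination h1 - h2 - h3

/-- `exp (2 g - W)` up to a constant factor, as an analytic function. -/
noncomputable def expPsi (t γ a : ℝ) (ξ : ℂ) (R : ℂ → ℂ) (ℓ z : ℂ) : ℂ :=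
  expG t γ a ξ (outer ξ R z) ^ 2 * expNegW t γ a z * exp (-ℓ)

theorem IsSetup.hasDerivAt_expPsi (hs : IsSetup t γ a ξ c₁ c₂ h hp hm R p) (ℓ : ℂ) {z : ℂ}
    (hz : z ∈ (closedArc c₁)ᶜ) (hzc : z ∈ cutPlane t) :
    HasDerivAt (expPsi t γ a ξ R ℓ) (Φ t γ a R z * expPsi t γ a ξ R ℓ z) z := by
  have hden := den_ne_zero_of_mem_cutPlane hs.t_pos hzc
  refine ((((hs.hasDerivAt_expG hz hden).pow 2).mul
    (hasDerivAt_expNegW (γ := γ) (a := a) hs.t_pos hzc)).mul_const (exp (-ℓ))).congr_deriv ?_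
  rw [← hs.two_mul_h_sub hz hden]
  simp only [expPsi, Pi.pow_apply]
  push_cast
  ring

theorem continuousAt_Φ (hs : IsSetup t γ a ξ c₁ c₂ h hp hm R p) {z : ℂ}
    (hz : z ∈ (closedArc c₁)ᶜ) (hden : den t z ≠ 0) : ContinuousAt (Φ t γ a R) z := by
  have h1 : ContinuousAt R z := (hs.branch.analytic z hz).continuousAt
  exact ((h1.mul (continuousAt_id.add continuousAt_const)).div
    (show ContinuousAt (den t) z by unfold den; fun_prop) hden).const_mul _

/-- Along a curve starting at `ξ`, the function `exp (2 g - W - ℓ)` is the exponential of the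
contour integral of `Φ`. -/
theorem IsSetup.exp_contourIntegral (hs : IsSetup t γ a ξ c₁ c₂ h hp hm R p) {ℓ : ℂ}
    (hℓ : Tendsto (expPsi t γ a ξ R ℓ) (𝓝[(closedArc c₁)ᶜ] ξ) (𝓝 1)) {c : ℝ → ℂ}
    (hc : ContDiff ℝ 1 c) (hc0 : c 0 = ξ) {T : ℝ} (hT : 0 < T)
    (hmem : ∀ u ∈ Ioc (0 : ℝ) T, c u ∈ (closedArc c₁)ᶜ ∧ c u ∈ cutPlane t) :
    ContourIntegrable (Φ t γ a R) c 0 T ∧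
      exp (contourIntegral (Φ t γ a R) c 0 T) = expPsi t γ a ξ R ℓ (c T) := by
  have hcc := hc.continuous
  have hcd : Continuous (deriv c) := hc.continuous_deriv le_rfl
  have hlimc : Tendsto c (𝓝[Ioc 0 T] 0) (𝓝[(closedArc c₁)ᶜ] ξ) := by
    refine tendsto_nhdsWithin_iff.2 ⟨?_, ?_⟩
    · have := hcc.tendsto 0
      rw [hc0] at this
      exact this.mono_left nhdsWithin_le_nhds
    · filter_upwards [self_mem_nhdsWithin] with u hu using (hmem u hu).1
  have hdiff : Icc (0 : ℝ) T \ {0} = Ioc 0 T := Icc_sdiff_left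
  set f : ℝ → ℂ := fun u => Φ t γ a R (c u) * deriv c u with hf
  -- Nothing is known about `R` at `ξ` itself, so the integrand is given its limit `0` at the
  -- starting parameter. For the same reason `y` below is given the value `1` there.
  set ψ : ℝ → ℂ := Function.update f 0 0 with hψ
  have hfc : ∀ u ∈ Ioc (0 : ℝ) T, ContinuousAt f u := by
    intro u hu
    have h1 := continuousAt_Φ hs (hmem u hu).1
      (den_ne_zero_of_mem_cutPlane hs.t_pos (hmem u hu).2)
    exact (ContinuousAt.comp (f := c) h1 hcc.continuousAt).mul hcd.continuousAt
  have hψne : ∀ u : ℝ, u ≠ 0 → ψ =ᶠ[𝓝 u] f := by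
    intro u hu
    filter_upwards [isOpen_ne.mem_nhds hu] with v hv
    rw [hψ, Function.update_of_ne hv]
  have hf0 : Tendsto f (𝓝[Ioc 0 T] 0) (𝓝 0) := by
    have hdenξ := hs.data.den_ne_zero hs.t_pos hs.data.arc₁.target_mem
    have hR0 := (hs.branch.tendsto_zero (z := ξ) (by simp)).comp hlimc
    have h2 : Tendsto c (𝓝[Ioc 0 T] 0) (𝓝 ξ) := hlimc.mono_right nhdsWithin_le_nhds
    have h3 : Tendsto (fun u => den t (c u)) (𝓝[Ioc 0 T] 0) (𝓝 (den t ξ)) := by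
      have : Continuous (den t) := by unfold den; fun_prop
      exact (this.tendsto ξ).comp h2
    have h4 := ((((hR0.mul (h2.add_const (z0 γ a R))).div h3 hdenξ).const_mul
      (1 + γ * a : ℂ))).mul (show Tendsto (deriv c) (𝓝[Ioc 0 T] 0) (𝓝 (deriv c 0)) from
        (hcd.tendsto 0).mono_left nhdsWithin_le_nhds)
    simp only [zero_mul, zero_div, mul_zero] at h4
    exact h4
  have hψc : ContinuousOn ψ (Icc 0 T) := by
    intro u hu
    rcases eq_or_lt_of_le hu.1 with h0 | h0
    · subst h0
      rw [hψ, continuousWithinAt_update_same, hdiff]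
      exact hf0
    · exact ((hfc u ⟨h0, hu.2⟩).congr (hψne u h0.ne').symm).continuousWithinAt
  have hψi : ∀ u ∈ Icc (0 : ℝ) T, IntervalIntegrable ψ volume 0 u := by
    intro u hu
    refine (hψc.mono ?_).intervalIntegrable
    rw [uIcc_of_le hu.1]
    exact Icc_subset_Icc_right hu.2
  have hfψ : EqOn ψ f (uIoc 0 T) := by
    intro u hu
    rw [uIoc_of_le hT.le] at hu
    rw [hψ, Function.update_of_ne hu.1.ne']
  refine ⟨(hψi T ⟨hT.le, le_rfl⟩).congr hfψ, ?_⟩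
  have hint : contourIntegral (Φ t γ a R) c 0 T = ∫ u in (0 : ℝ)..T, ψ u :=
    intervalIntegral.integral_congr_ae (Eventually.of_forall fun u hu => (hfψ hu).symm)
  set y : ℝ → ℂ := Function.update (fun u => expPsi t γ a ξ R ℓ (c u)) 0 1 with hy
  have hyc : ContinuousOn y (Icc 0 T) := by
    intro u hu
    rcases eq_or_lt_of_le hu.1 with h0 | h0
    · subst h0
      rw [hy, continuousWithinAt_update_same, hdiff]
      exact hℓ.comp hlimc
    · have h1 := (hs.hasDerivAt_expPsi ℓ (hmem u ⟨h0, hu.2⟩).1 (hmem u ⟨h0, hu.2⟩).2).continuousAt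
      have h2 : ContinuousAt (fun u => expPsi t γ a ξ R ℓ (c u)) u :=
        ContinuousAt.comp (f := c) h1 hcc.continuousAt
      rw [hy, continuousWithinAt_update_of_ne h0.ne']
      exact h2.continuousWithinAt
  have hIc : ContinuousOn (fun u => ∫ s in (0 : ℝ)..u, ψ s) (Icc 0 T) := by
    have := intervalIntegral.continuousOn_primitive_interval (μ := volume) (a := 0) (b := T) (f := ψ)
      (by rw [uIcc_of_le hT.le]; exact hψc.integrableOn_Icc)
    rwa [uIcc_of_le hT.le] at this
  -- Since `y' = ψ y`, the product of `y` with the exponential of minus the integral of `ψ` is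
  -- constant.
  have hK := integral_eq_of_hasDerivAt_off_countable_of_le
    (fun u => y u * exp (-∫ s in (0 : ℝ)..u, ψ s)) (fun _ => 0) hT.le countable_empty
    (hyc.mul hIc.neg.cexp) (fun u hu => by
      have hu' : u ∈ Ioo 0 T := hu.1
      have huc : u ∈ Ioc 0 T := Ioo_subset_Ioc_self hu'
      have h1 : HasDerivAt y (Φ t γ a R (c u) * expPsi t γ a ξ R ℓ (c u) * deriv c u) u := by
        refine (HasDerivAt.comp_of_eq u (hs.hasDerivAt_expPsi ℓ (hmem u huc).1 (hmem u huc).2)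
          (hc.differentiable (by simp) u).hasDerivAt rfl).congr_of_eventuallyEq ?_
        filter_upwards [isOpen_ne.mem_nhds hu'.1.ne'] with v hv
        rw [hy, Function.update_of_ne hv]
        rfl
      have h2 : HasDerivAt (fun u => ∫ s in (0 : ℝ)..u, ψ s) (ψ u) u := by
        refine intervalIntegral.integral_hasDerivAt_right (hψi u (Ioo_subset_Icc_self hu')) ?_
          ((hfc u huc).congr (hψne u hu'.1.ne').symm)
        exact ContinuousOn.stronglyMeasurableAtFilter isOpen_Ioo
          (hψc.mono Ioo_subset_Icc_self) u hu'
      refine (h1.mul h2.neg.cexp).congr_deriv ?_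
      rw [(hψne u hu'.1.ne').self_of_nhds]
      simp only [hy, Function.update_of_ne hu'.1.ne', hf]
      ring) (by simp)
  simp only [intervalIntegral.integral_zero, intervalIntegral.integral_same, neg_zero, exp_zero,
    mul_one] at hK
  have hy0 : y 0 = 1 := by rw [hy, Function.update_self]
  have hyT : y T = expPsi t γ a ξ R ℓ (c T) := by rw [hy, Function.update_of_ne hT.ne']
  rw [hy0, hyT, exp_neg] at hK
  rw [hint]
  have := exp_ne_zero (∫ s in (0 : ℝ)..T, ψ s)
  field_simp at hK
  linear_combination hK

/-! ### The set-up -/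

theorem one_add_mul_ne_zero (ht : 0 < t) (ht1 : t < 1) (hγ : 1 ≤ γ) (ha : a0 t γ < a) :
    (1 + γ * a : ℂ) ≠ 0 := by
  have h1 : 0 < a0 t γ := by
    have : 0 < 1 - t ^ 2 := by nlinarith
    unfold a0
    positivity
  have h2 : 0 < 1 + γ * a := by
    have := h1.trans ha
    positivity
  exact_mod_cast h2.ne'

theorem IsContourData.exists_crossing (hd : IsContourData t γ a ξ c₁ c₂ h hp hm) :
    ∃ p : ℝ, 0 < p ∧ (∀ x : ℝ, (x : ℂ) ∈ openArc c₁ ↔ x = p) ∧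
      (∀ x : ℝ, (x : ℂ) ∈ closedArc c₁ ↔ x = p) ∧
      IsPreconnected (closedArc c₁ ∪ leftRay p)ᶜ := by
  obtain ⟨u₀, hu₀, him, hneg, hpos⟩ := hd.arc₁.exists_crossing hd.im_pos hd.symm₁
  have hcu : c₁ u₀ = (c₁ u₀).re := by apply Complex.ext <;> simp [him]
  have hmem : ((c₁ u₀).re : ℂ) ∈ openArc c₁ := ⟨u₀, hu₀, hcu⟩
  have hsub : openArc c₁ ⊆ closedArc c₁ := image_mono Ioo_subset_Icc_self
  have hcl : ∀ x : ℝ, (x : ℂ) ∈ closedArc c₁ → x = (c₁ u₀).re := by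
    rintro x ⟨u, hu, hux⟩
    have hui : (c₁ u).im = 0 := by rw [hux, ofReal_im]
    rcases lt_trichotomy u u₀ with hlt | rfl | hlt
    · exact absurd hui (hneg u hu hlt).ne
    · rw [hux, ofReal_re]
    · exact absurd hui (hpos u hu hlt).ne'
  refine ⟨(c₁ u₀).re, ?_, fun x => ⟨fun hx => hcl x (hsub hx), fun hx => hx ▸ hmem⟩,
    fun x => ⟨hcl x, fun hx => hx ▸ hsub hmem⟩,
    hd.arc₁.isPreconnected_compl_union_leftRay hu₀ him hneg hpos⟩
  by_contra! hle
  exact hd.notMem_leftRay (hsub hmem) (mem_leftRay.2 ⟨ofReal_im _, by rwa [ofReal_re]⟩)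

theorem IsSimpleArc.isOpen_compl_union_leftRay {c : ℝ → ℂ} {A B : ℂ} (hc : IsSimpleArc c A B)
    (x : ℝ) : IsOpen (closedArc c ∪ leftRay x)ᶜ :=
  ((closedArc_isCompact hc.contDiff.continuous).isClosed.union (isClosed_leftRay x)).isOpen_compl

/-- The domain of `exp Ψ₁` is connected if the domain of `g` is. -/
theorem IsSimpleArc.isPreconnected_compl_union_leftRay_zero {c : ℝ → ℂ} {A B : ℂ}
    (hc : IsSimpleArc c A B) (hp : 0 < p) (hpre : IsPreconnected (closedArc c ∪ leftRay p)ᶜ) :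
    IsPreconnected (closedArc c ∪ leftRay 0)ᶜ := by
  -- The domain of `g` is dense in this one: the additional points are real, hence limits of points
  -- of the upper half plane.
  refine hpre.subset_closure (fun z hz => ?_) fun z hz => ?_
  · rw [mem_compl_iff, mem_union, not_or, mem_leftRay] at hz ⊢
    exact ⟨hz.1, fun h0 => hz.2 ⟨h0.1, h0.2.trans hp.le⟩⟩
  · by_cases him : z.im = 0
    · have hzr : z = z.re := by apply Complex.ext <;> simp [him]
      rw [hzr] at hz ⊢
      refine closure_mono ?_ (mem_closure_halfPlane (hc.isOpen_compl_union_leftRay 0) hz 1 one_ne_zero)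
      rintro w ⟨hw, hwS⟩
      rw [mem_compl_iff, mem_union, not_or, mem_leftRay] at hwS ⊢
      refine ⟨hwS.1, fun h0 => ?_⟩
      rw [mem_ofPred_eq, h0.1] at hw
      simp at hw
    · refine subset_closure ?_
      rw [mem_compl_iff, mem_union, not_or, mem_leftRay] at hz ⊢
      exact ⟨hz.1, fun h0 => him h0.1⟩

/-- A segment from the end point of a simple arc runs outside the arc. -/
theorem IsSimpleArc.exists_segment {c : ℝ → ℂ} {A B : ℂ} (hc : IsSimpleArc c A B) {U : Set ℂ}
    (hU : U ∈ 𝓝 B) :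
    ∃ (k : ℂ) (τ : ℝ), 0 < τ ∧ ∀ s ∈ Ioc (0 : ℝ) τ, B + s * k ∈ (closedArc c)ᶜ ∩ U := by
  have h1 : ∀ᶠ s : ℝ in 𝓝 0, c 1 + s * I * deriv c 1 ∈ closedArc c → s = 0 := by
    have h2 : Tendsto (fun s : ℝ => ((1 : ℝ), s)) (𝓝 0) (𝓝 (1, 0)) :=
      (by fun_prop : Continuous fun s : ℝ => ((1 : ℝ), s)).tendsto 0
    filter_upwards [h2.eventually (hc.eventually_normalMap_notMem (u := 1) (by simp))] with s hs h0
    exact (hs h0).1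
  have h3 : ∀ᶠ s : ℝ in 𝓝 0, B + s * (I * deriv c 1) ∈ U := by
    have h4 : Tendsto (fun s : ℝ => B + s * (I * deriv c 1)) (𝓝 0) (𝓝 B) := by
      have := (by fun_prop : Continuous fun s : ℝ => B + s * (I * deriv c 1)).tendsto 0
      simpa using this
    exact h4 hU
  obtain ⟨τ, hτ, hball⟩ := Metric.eventually_nhds_iff.1 (h1.and h3)
  refine ⟨I * deriv c 1, τ / 2, half_pos hτ, fun s hs => ?_⟩
  have hd : dist s 0 < τ := by
    rw [Real.dist_0_eq_abs, abs_of_pos hs.1]; linarith [hs.2]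
  refine ⟨fun hmem => hs.1.ne' ((hball hd).1 ?_), (hball hd).2⟩
  rwa [hc.target, mul_assoc]

theorem IsContourData.exists_isCurveFrom (hd : IsContourData t γ a ξ c₁ c₂ h hp hm)
    (hpre : IsPreconnected (closedArc c₁ ∪ leftRay 0)ᶜ) {z : ℂ}
    (hz : z ∈ (closedArc c₁ ∪ leftRay 0)ᶜ) :
    ∃ c, IsCurveFrom (closedArc c₁ ∪ leftRay 0)ᶜ ξ c z := by
  obtain ⟨k, τ, hτ, hk⟩ := hd.arc₁.exists_segment (U := {z | 0 < z.im})
    ((isOpen_lt continuous_const continuous_im).mem_nhds hd.im_pos)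
  refine GFun.exists_isCurveFrom (k := k) (hd.arc₁.isOpen_compl_union_leftRay 0) hpre hτ
    (fun s hs => ?_) hz
  obtain ⟨hsK, him⟩ := hk s hs
  have him : 0 < (ξ + s * k).im := him
  rw [mem_compl_iff, mem_union, not_or, mem_leftRay]
  exact ⟨hsK, fun h0 => him.ne' h0.1⟩

theorem mem_cutPlane_of_notMem_leftRay {z : ℂ} (hz : z ∉ leftRay 0) : z ∈ cutPlane t := by
  intro him
  right
  by_contra! hle
  exact hz (mem_leftRay.2 ⟨him, hle⟩)

/-! ### The values at `ξ` -/

theorem IsSetup.endpoint_mem (hs : IsSetup t γ a ξ c₁ c₂ h hp hm R p) :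
    ξ - ξ.re ∈ logDom t ξ := by
  have := hs.boundary_mem hs.data.arc₁.target_mem (ρ := 0) (by simp)
  rwa [add_zero] at this

theorem IsSetup.tendsto_outer_endpoint (hs : IsSetup t γ a ξ c₁ c₂ h hp hm R p) :
    Tendsto (outer ξ R) (𝓝[(closedArc c₁)ᶜ] ξ) (𝓝 (ξ - ξ.re)) := by
  have := tendsto_outer_of_tendsto (ξ := ξ) nhdsWithin_le_nhds (hs.branch.tendsto_zero (z := ξ) (by simp))
  rwa [add_zero] at this

/-- The boundary value of `g` at `ξ`. -/
noncomputable def gEnd (t γ a : ℝ) (ξ : ℂ) : ℂ :=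
  log ((ξ - ξ.re) / 2) + logS t γ a ξ (ξ - ξ.re)

theorem IsSetup.tendsto_gEnd (hs : IsSetup t γ a ξ c₁ c₂ h hp hm R p) :
    Tendsto (gFun t γ a ξ R) (𝓝[(closedArc c₁)ᶜ] ξ) (𝓝 (gEnd t γ a ξ)) := by
  refine tendsto_gFun hs.endpoint_mem ?_ hs.tendsto_outer_endpoint
  have := boundary_half_mem (z := ξ) (ρ := 0) hs.data.im_pos hs.data.im_pos.ne' (by simp)
  rwa [add_zero] at this

theorem IsSetup.exp_gEnd (hs : IsSetup t γ a ξ c₁ c₂ h hp hm R p) :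
    exp (gEnd t γ a ξ) = expG t γ a ξ (ξ - ξ.re) :=
  exp_log_add_logS hs.endpoint_mem.1

theorem IsSetup.tendsto_expPsi (hs : IsSetup t γ a ξ c₁ c₂ h hp hm R p) :
    Tendsto (expPsi t γ a ξ R (2 * gEnd t γ a ξ - W t γ a ξ)) (𝓝[(closedArc c₁)ᶜ] ξ) (𝓝 1) := by
  have hnot := hs.data.notMem_leftRay hs.data.arc₁.target_mem
  have hξ0 : ξ ≠ 0 := fun h0 => hnot (by rw [h0]; exact mem_leftRay.2 (by simp))
  have h1 := tendsto_expG (γ := γ) (a := a) hs.endpoint_mem hs.tendsto_outer_endpoint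
  have h2 : Tendsto (expNegW t γ a) (𝓝[(closedArc c₁)ᶜ] ξ) (𝓝 (expNegW t γ a ξ)) :=
    (hasDerivAt_expNegW hs.t_pos
      (mem_cutPlane_of_notMem_leftRay hnot)).continuousAt.tendsto.mono_left nhdsWithin_le_nhds
  have h3 := ((h1.pow 2).mul h2).mul_const (exp (-(2 * gEnd t γ a ξ - W t γ a ξ)))
  rw [← hs.exp_gEnd, ← exp_neg_W hξ0, ← exp_nat_mul, ← exp_add, ← exp_add] at h3
  rw [show (((2 : ℕ) : ℂ) * gEnd t γ a ξ + -W t γ a ξ + -(2 * gEnd t γ a ξ - W t γ a ξ)) = 0 by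
    push_cast; ring, exp_zero] at h3
  exact h3

/-- The function `exp (2 g - W - ℓ)` is the exponential of the contour integral of `Φ`, for any
choice of the root in `Φ`. -/
theorem IsSetup.exp_contourIntegral_of_isSqrtBranch (hs : IsSetup t γ a ξ c₁ c₂ h hp hm R p)
    {R' : ℂ → ℂ} (hR' : IsSqrtBranch ξ (closedArc c₁) R') {c : ℝ → ℂ} (hc : ContDiff ℝ 1 c)
    (hc0 : c 0 = ξ) {T : ℝ} (hT : 0 < T)
    (hmem : ∀ u ∈ Ioc (0 : ℝ) T, c u ∈ (closedArc c₁)ᶜ ∧ c u ∈ cutPlane t) :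
    ContourIntegrable (Φ t γ a R') c 0 T ∧ exp (contourIntegral (Φ t γ a R') c 0 T)
      = expPsi t γ a ξ R (2 * gEnd t γ a ξ - W t γ a ξ) (c T) := by
  have hs' : IsSetup t γ a ξ c₁ c₂ h hp hm R' p := { hs with branch := hR' }
  have heq : ∀ u ∈ uIoc 0 T, Φ t γ a R (c u) * deriv c u = Φ t γ a R' (c u) * deriv c u := by
    intro u hu
    rw [uIoc_of_le hT.le] at hu
    have hden := den_ne_zero_of_mem_cutPlane hs.t_pos (hmem u hu).2
    rw [← hs.two_mul_h_sub (hmem u hu).1 hden, ← hs'.two_mul_h_sub (hmem u hu).1 hden]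
  obtain ⟨h1, h2⟩ := hs.exp_contourIntegral hs.tendsto_expPsi hc hc0 hT hmem
  refine ⟨IntervalIntegrable.congr heq h1, ?_⟩
  rw [← h2]
  congr 1
  exact intervalIntegral.integral_congr_ae (Eventually.of_forall fun u hu => (heq u hu).symm)

/-- The curve `Γ₂` avoids `Γ₁` and the cuts. -/
theorem IsContourData.arc₂_mem (hd : IsContourData t γ a ξ c₁ c₂ h hp hm) {u : ℝ}
    (hu : u ∈ Ioo (0 : ℝ) 1) : c₂ u ∈ (closedArc c₁)ᶜ ∧ c₂ u ∈ cutPlane t := by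
  have hmem : c₂ u ∈ openArc c₂ := ⟨u, hu, rfl⟩
  have huI := Ioo_subset_Icc_self hu
  constructor
  · rintro ⟨v, hv, hvu⟩
    rcases eq_or_lt_of_le hv.1 with h0 | h0
    · rw [← h0, hd.arc₁.source, ← hd.arc₂.target] at hvu
      exact hu.2.ne (hd.arc₂.inj (by simp) huI hvu).symm
    rcases eq_or_lt_of_le hv.2 with h1 | h1
    · rw [h1, hd.arc₁.target, ← hd.arc₂.source] at hvu
      exact hu.1.ne (hd.arc₂.inj (by simp) huI hvu)
    · exact disjoint_left.1 hd.disj ⟨v, ⟨h0, h1⟩, rfl⟩ (hvu ▸ hmem)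
  · intro him
    have hzr : c₂ u = (c₂ u).re := by apply Complex.ext <;> simp [him]
    left
    rw [hzr] at hmem
    by_contra hcon
    rw [not_and_or, not_lt, not_lt] at hcon
    exact hd.avoid₂ _ hcon hmem

/-! ### Boundary values on the arc -/

/-- A logarithm of a boundary value of `exp g`, in the Joukowski coordinate `w`; it is the
boundary value of `g` away from the real axis. -/
noncomputable def gBdry (t γ a : ℝ) (ξ : ℂ) (p : ℝ) (z w : ℂ) : ℂ := open Classical in
  if z = p then log (expG t γ a ξ w) else log (w / 2) + logS t γ a ξ w

theorem exp_gBdry {z w : ℂ} (hw : w ≠ 0) : exp (gBdry t γ a ξ p z w) = expG t γ a ξ w := by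
  unfold gBdry
  split_ifs
  · exact exp_log (mul_ne_zero (div_ne_zero hw two_ne_zero) (exp_ne_zero _))
  · exact exp_log_add_logS hw

theorem IsSetup.tendsto_gBdry (hs : IsSetup t γ a ξ c₁ c₂ h hp hm R p) {z ρ : ℂ}
    (hz : z ∈ closedArc c₁) (hzp : z ≠ p) (hρ : ρ ^ 2 = (z - ξ) * (z - conj ξ)) {l : Filter ℂ}
    (hl : l ≤ 𝓝 z) (hR : Tendsto R l (𝓝 ρ)) :
    Tendsto (gFun t γ a ξ R) l (𝓝 (gBdry t γ a ξ p z (z - ξ.re + ρ))) := by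
  unfold gBdry
  rw [if_neg hzp]
  refine tendsto_gFun (hs.boundary_mem hz hρ)
    (boundary_half_mem hs.data.im_pos (fun him => hzp ?_) hρ) (tendsto_outer_of_tendsto hl hR)
  have hzr : z = z.re := by apply Complex.ext <;> simp [him]
  rw [hzr] at hz ⊢
  rw [(hs.crossing _).1 hz]

theorem IsSetup.tendsto_exp_gBdry (hs : IsSetup t γ a ξ c₁ c₂ h hp hm R p) {z ρ : ℂ}
    (hz : z ∈ closedArc c₁) (hρ : ρ ^ 2 = (z - ξ) * (z - conj ξ)) {l : Filter ℂ}
    (hl : l ≤ 𝓝 z) (hR : Tendsto R l (𝓝 ρ)) :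
    Tendsto (fun z => expG t γ a ξ (outer ξ R z)) l
      (𝓝 (exp (gBdry t γ a ξ p z (z - ξ.re + ρ)))) := by
  have hw := hs.boundary_mem hz hρ
  rw [exp_gBdry hw.1]
  exact tendsto_expG hw (tendsto_outer_of_tendsto hl hR)

theorem IsSetup.isBigO_expG (hs : IsSetup t γ a ξ c₁ c₂ h hp hm R p) :
    (fun z => expG t γ a ξ (outer ξ R z) / z - 1) =O[cobounded ℂ] (fun z => 1 / z) := by
  refine isBigO_inv_of_tendsto_one ?_ hs.tendsto_expG_div
  filter_upwards [hs.data.compl_mem_cobounded, eventually_ne_cobounded (0 : ℂ)] with z hz hz0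
  exact (hs.differentiableAt_expG hz).div differentiableAt_id hz0

end GFun

/-! ### The theorem. -/

open GFun in
theorem proposition4p1 (t γ a : ℝ) (ht : 0 < t) (ht1 : t < 1) (hγ : 1 ≤ γ) (ha : a0 t γ < a)
    (ξ : ℂ) (c₁ c₂ : ℝ → ℂ) (h : ℂ → ℂ) (hp hm : ℝ → ℂ)
    (hdata : IsContourData t γ a ξ c₁ c₂ h hp hm) :
    -- `Γ₁` meets the real axis in exactly one point `pᵢ`, and `pᵢ > 0`
    ∃ pᵢ : ℝ, 0 < pᵢ ∧ (∀ x : ℝ, (x : ℂ) ∈ openArc c₁ ↔ x = pᵢ) ∧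
    ∃ D : Set ℂ, D = (closedArc c₁ ∪ leftRay pᵢ)ᶜ ∧
    ∃ g : ℂ → ℂ,
      -- (1) on `D`, `g(z) = ∫_∞^z (h(s) - 1/s) ds + ln z` is well defined
      (∀ z ∈ D, (∃ c, IsCurveFromInfty D c z) ∧
        ∀ c, IsCurveFromInfty D c z →
          Tendsto (fun T : ℝ => contourIntegral (fun s => h s - 1 / s) c T 0) atTop
            (𝓝 (g z - log z))) ∧
      -- `g` is analytic in `D`, and `exp g` extends to an analytic function `E` off `Γ₁`
      AnalyticOnNhd ℂ g D ∧
      ∃ E : ℂ → ℂ, (∀ z ∈ D, E z = exp (g z)) ∧ AnalyticOnNhd ℂ E (closedArc c₁)ᶜ ∧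
      -- (2) `exp g(z) = z (1 + O(1/z))`
      (fun z => E z / z - 1) =O[cobounded ℂ] (fun z => 1 / z) ∧
      -- `ℓ = 2 g(ξ) - W(ξ)`, with the boundary value `g(ξ)`
      ∃ gξ ℓ : ℂ, Tendsto g (𝓝[D] ξ) (𝓝 gξ) ∧ ℓ = 2 * gξ - W t γ a ξ ∧
      -- the boundary values `g₊` and `g₋` on `Γ₁`; at `pᵢ`, where `g` has a cut, they are
      -- logarithms of the boundary values of `exp g`
      ∃ gp gm : ℝ → ℂ,
        (∀ u ∈ Ioo (0 : ℝ) 1, c₁ u ≠ pᵢ →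
          Tendsto g (plusSide c₁ u) (𝓝 (gp u)) ∧ Tendsto g (minusSide c₁ u) (𝓝 (gm u))) ∧
        (∀ u ∈ Ioo (0 : ℝ) 1,
          Tendsto E (plusSide c₁ u) (𝓝 (exp (gp u))) ∧
          Tendsto E (minusSide c₁ u) (𝓝 (exp (gm u)))) ∧
        -- (3)
        (∀ u ∈ Ioo (0 : ℝ) 1, exp (gp u + gm u - W t γ a (c₁ u) - ℓ) = 1) ∧
        -- the square root `R` exists, and for it:
        (∃ R, IsSqrtBranch ξ (closedArc c₁) R) ∧
        ∀ R, IsSqrtBranch ξ (closedArc c₁) R →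
          -- (4) `F = exp Ψ₁` is well defined, and `exp (g₊ - g₋) = exp Ψ₁₊` on `Γ₁`
          (∃ F : ℂ → ℂ,
            (∀ z ∈ (closedArc c₁ ∪ leftRay 0)ᶜ,
              (∃ c, IsCurveFrom (closedArc c₁ ∪ leftRay 0)ᶜ ξ c z) ∧
              ∀ c, IsCurveFrom (closedArc c₁ ∪ leftRay 0)ᶜ ξ c z →
                ContourIntegrable (Φ t γ a R) c 0 1 ∧
                exp (contourIntegral (Φ t γ a R) c 0 1) = F z) ∧
            ∀ u ∈ Ioo (0 : ℝ) 1, Tendsto F (plusSide c₁ u) (𝓝 (exp (gp u - gm u)))) ∧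
          -- (5) `exp (2g - W - ℓ) = exp Ψ₂` on `Γ₂`
          (∀ u ∈ Ioo (0 : ℝ) 1,
            ContourIntegrable (Φ t γ a R) c₂ 0 u ∧
            E (c₂ u) ^ 2 * exp (-W t γ a (c₂ u) - ℓ) =
              exp (contourIntegral (Φ t γ a R) c₂ 0 u)) := by
  obtain ⟨p, hp0, hop, hcl, hpre⟩ := hdata.exists_crossing
  have harc := hdata.arc₁
  have hγa := one_add_mul_ne_zero ht ht1 hγ ha
  -- `g` is built from one fixed root `R₀`; the root `R` in (4) and (5) is arbitrary.
  obtain ⟨R₀, hR₀⟩ := harc.exists_isSqrtBranch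
  have hs : IsSetup t γ a ξ c₁ c₂ h hp hm R₀ p := ⟨hdata, ht, ht1, hγa, hR₀, hp0, hcl⟩
  obtain ⟨r, hrc, hr⟩ := hR₀.exists_boundary harc hdata.im_pos
  have hrn : ∀ u ∈ Ioo (0 : ℝ) 1, (-r u) ^ 2 = (c₁ u - ξ) * (c₁ u - conj ξ) := fun u hu => by
    rw [neg_sq, (hr u hu).1]
  have hmem : ∀ u ∈ Ioo (0 : ℝ) 1, c₁ u ∈ closedArc c₁ := fun u hu =>
    ⟨u, Ioo_subset_Icc_self hu, rfl⟩
  have hlp : ∀ u ∈ Ioo (0 : ℝ) 1, plusSide c₁ u ≤ 𝓝 (c₁ u) := fun u hu =>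
    (harc.plusSide_le (Ioo_subset_Icc_self hu)).trans nhdsWithin_le_nhds
  have hlm : ∀ u ∈ Ioo (0 : ℝ) 1, minusSide c₁ u ≤ 𝓝 (c₁ u) := fun u hu =>
    (harc.minusSide_le (Ioo_subset_Icc_self hu)).trans nhdsWithin_le_nhds
  have hDo := harc.isOpen_compl_union_leftRay p
  set gp : ℝ → ℂ := fun u => gBdry t γ a ξ p (c₁ u) (c₁ u - ξ.re + r u) with hgp
  set gm : ℝ → ℂ := fun u => gBdry t γ a ξ p (c₁ u) (c₁ u - ξ.re + -r u) with hgm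
  have hegp : ∀ u ∈ Ioo (0 : ℝ) 1, exp (gp u) = expG t γ a ξ (c₁ u - ξ.re + r u) := fun u hu =>
    exp_gBdry (hs.boundary_mem (hmem u hu) (hr u hu).1).1
  have hegm : ∀ u ∈ Ioo (0 : ℝ) 1, exp (gm u) = expG t γ a ξ (c₁ u - ξ.re + -r u) := fun u hu =>
    exp_gBdry (hs.boundary_mem (hmem u hu) (hrn u hu)).1
  set ℓ := 2 * gEnd t γ a ξ - W t γ a ξ with hℓ
  have h3 : ∀ u ∈ Ioo (0 : ℝ) 1, exp (gp u + gm u - W t γ a (c₁ u) - ℓ) = 1 := by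
    intro u hu
    have hprod := hs.expG_mul_expG hrc (fun v hv => (hr v hv).1) hu
    rw [← hegp u hu, ← hegm u hu, ← hs.exp_gEnd, ← exp_add, ← exp_add, ← exp_nat_mul,
      ← exp_add] at hprod
    rw [show gp u + gm u - W t γ a (c₁ u) - ℓ = (gp u + gm u + -W t γ a (c₁ u)) + -ℓ by ring,
      exp_add, hprod, ← exp_add, hℓ, ← exp_zero]
    congr 1
    push_cast
    ring
  have hnz : ∀ z ∈ closedArc c₁, z ≠ 0 := fun z hz h0 =>
    hdata.notMem_leftRay hz (by rw [h0]; exact mem_leftRay.2 (by simp))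
  refine ⟨p, hp0, hop, _, rfl, gFun t γ a ξ R₀, fun z hz => ⟨?_, fun c hc =>
      hs.tendsto_contourIntegral hc⟩, ?_, fun z => expG t γ a ξ (outer ξ R₀ z), fun z hz =>
      (exp_log_add_logS (hs.outer_mem fun h0 => hz (Or.inl h0)).1).symm, ?_, hs.isBigO_expG,
      gEnd t γ a ξ, ℓ, ?_, rfl, gp, gm, fun u hu hne => ⟨?_, ?_⟩, fun u hu => ⟨?_, ?_⟩, h3,
      ⟨R₀, hR₀⟩, fun R hR => ⟨⟨expPsi t γ a ξ R₀ ℓ, fun z hz => ⟨?_, fun c hc => ?_⟩,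
        fun u hu => ?_⟩, fun u hu => ?_⟩⟩
  · refine exists_isCurveFromInfty hDo hpre (x₀ := p + 1) (fun x hx => ?_) hz
    rw [mem_compl_iff, mem_union, not_or, mem_leftRay, hcl, ofReal_re]
    exact ⟨by linarith, fun h0 => by linarith [h0.2]⟩
  · exact DifferentiableOn.analyticOnNhd (fun z hz =>
      (hs.hasDerivAt_gFun hz).differentiableAt.differentiableWithinAt) hDo
  · exact DifferentiableOn.analyticOnNhd (fun z hz =>
      (hs.differentiableAt_expG hz).differentiableWithinAt) harc.isOpen_compl
  · exact hs.tendsto_gEnd.mono_left (nhdsWithin_mono _ fun z hz h0 => hz (Or.inl h0))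
  · exact hs.tendsto_gBdry (hmem u hu) hne (hr u hu).1 (hlp u hu) (hr u hu).2.1
  · exact hs.tendsto_gBdry (hmem u hu) hne (hrn u hu) (hlm u hu) (hr u hu).2.2
  · exact hs.tendsto_exp_gBdry (hmem u hu) (hr u hu).1 (hlp u hu) (hr u hu).2.1
  · exact hs.tendsto_exp_gBdry (hmem u hu) (hrn u hu) (hlm u hu) (hr u hu).2.2
  · exact hdata.exists_isCurveFrom (harc.isPreconnected_compl_union_leftRay_zero hp0 hpre) hz
  · rw [← hc.target]
    refine hs.exp_contourIntegral_of_isSqrtBranch hR hc.contDiff hc.source one_pos fun u hu => ?_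
    have := hc.mem u hu
    rw [mem_compl_iff, mem_union, not_or] at this
    exact ⟨this.1, mem_cutPlane_of_notMem_leftRay this.2⟩
  · have h4 := hs.tendsto_exp_gBdry (hmem u hu) (hr u hu).1 (hlp u hu) (hr u hu).2.1
    have h5 : Tendsto (expNegW t γ a) (plusSide c₁ u) (𝓝 (expNegW t γ a (c₁ u))) :=
      (hasDerivAt_expNegW ht (mem_cutPlane_of_notMem_leftRay
        (hdata.notMem_leftRay (hmem u hu)))).continuousAt.tendsto.mono_left (hlp u hu)
    have h6 := ((h4.pow 2).mul h5).mul_const (exp (-ℓ))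
    -- `exp (2 g₊ - W - ℓ)` is `exp (g₊ - g₋)` times `exp (g₊ + g₋ - W - ℓ)`, and the last factor is
    -- `1` by (3).
    have h7 : exp (gp u) ^ 2 * expNegW t γ a (c₁ u) * exp (-ℓ) = exp (gp u - gm u) := by
      rw [← exp_neg_W (hnz _ (hmem u hu)), ← exp_nat_mul, ← exp_add, ← exp_add,
        ← mul_one (exp (gp u - gm u)), ← h3 u hu, ← exp_add]
      congr 1
      push_cast
      ring
    rw [← h7]
    exact h6
  · have hc2 := hdata.arc₂
    obtain ⟨h4, h5⟩ := hs.exp_contourIntegral_of_isSqrtBranch hR hc2.contDiff hc2.source hu.1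
      fun v hv => hdata.arc₂_mem ⟨hv.1, hv.2.trans_lt hu.2⟩
    refine ⟨h4, ?_⟩
    rw [h5]
    have hu2 := (hdata.arc₂_mem hu).2
    have h0 : c₂ u ≠ 0 := by
      have := den_ne_zero_of_mem_cutPlane ht hu2
      intro h0
      exact this (by simp [den, h0])
    -- `exp (-W)` agrees with `expNegW` at every non-zero point, also on the cut of `log`, so a
    -- crossing of `(-1/t, -t)` does no harm.
    rw [sub_eq_add_neg, exp_add, exp_neg_W h0, ← mul_assoc]
    rfl
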